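/- Let $d,N\in\mathbb N$ and write $z=(x,\xi)\in\mathbb R^{2d}$, $u=(y,\eta)\in\mathbb R^{2N}$ for the phase space variables of a system $(S)$ and an environment $(E)$. Let $H_S$, $H_E$ be real quadratic forms on $\mathbb R^{2d}$, $\mathbb R^{2N}$, let $G$ be a real $2d\times 2N$ matrix, and let $\hat H$ be the Weyl quantization (with $\hbar=1$) of $H_S(z)+H_E(u)+z\cdot Gu$, acting in $L^2(\mathbb R^d\times\mathbb R^N)=L^2(\mathbb R^d)\otimes L^2(\mathbb R^N)$, with unitary group $U(t)=e^{-it\hat H}$. Let $\psi_0\in\mathcal S(\mathbb R^d)$ with $\|\psi_0\|_{L^2}=1$, and let $\hat\rho_E$ be a density operator (positive, trace class, of trace one) on $L^2(\mathbb R^N)$ whose Weyl symbol $\rho_E$ belongs to $\mathcal S(\mathbb R^{2N})$ and is centered, $\int u\,\rho_E(u)\,du=0$ (for instance a centered Gaussian state). Put $$\hat\rho_S(t)=\mathrm{tr}_E\big(U(t)(\Pi_{\psi_0}\otimes\hat\rho_E)U(t)^*\big),\qquad p_{ur}(t)=\mathrm{tr}\big(\hat\rho_S(t)^2\big),$$ where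 $\Pi_{\psi_0}$ is the orthogonal projector on $\psi_0$. Let $\rho_S$ be the Wigner function of $\psi_0$, let $\pi_S=(2\pi)^{-d}\rho_S$ and $\pi_E=(2\pi)^{-N}\rho_E$ be the associated quasi-probability densities, $\mathrm{Cov}_\pi=\big(\int z_az_b\,\pi-\int z_a\,\pi\int z_b\,\pi\big)_{a,b}$ their covariance matrices, and let $J_S$, $J_E$ be the matrices of the canonical symplectic forms of $\mathbb R^{2d}$, $\mathbb R^{2N}$. 1. For every $t$, $\hat\rho_S(t)$ is a density operator; $p_{ur}$ is of class $C^2$; and $$\ddot p_{ur}(0)=-4\,\mathrm{tr}\big(\mathrm{Cov}_{\pi_S}\,G\,\mathrm{Cov}_{\pi_E}\,G^{\top}\big)-\mathrm{tr}\big(J_S\,G\,J_E\,G^{\top}\big).$$ 2. (Quantum Brownian Motion with a thermal bath.) Let $d=1$, let the coupling be $z\cdot Gu=x\sum_{j=1}^N c_jy_j$ with real $c_1,\dots,c_N$, and let $\hat\rho_E$ be the thermal state with Weyl symbol $(2\tau)^N\exp\big(-\tau\sum_{j}(y_j^2+\eta_j^2)\big)$, $0<\tau<1$. Then $$\ddot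 p_{ur}(0)=-\frac2\tau\,(c_1^2+\cdots+c_N^2)\,\mathrm{Cov}_{x,x}(\psi_0),\qquad \mathrm{Cov}_{x,x}(\psi_0)=\int x^2|\psi_0(x)|^2dx-\Big(\int x|\psi_0(x)|^2dx\Big)^2.$$ More generally, if the oscillators of the bath have different temperatures, that is, if the symbol of $\hat\rho_E$ is $\prod_j 2\tau_j\exp(-\tau_j(y_j^2+\eta_j^2))$ with $0<\tau_j<1$, then $\ddot p_{ur}(0)=-2\Big(\sum_j c_j^2/\tau_j\Big)\mathrm{Cov}_{x,x}(\psi_0)$. -/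

import Mathlib

open MeasureTheory Complex
open scoped SchwartzMap ENNReal InnerProductSpace LineDeriv

noncomputable section

namespace OpenQuantum

/-! ### Configuration space, phase space, Hilbert spaces -/

/-- The configuration space `ℝⁿ`. -/
abbrev Conf (n : ℕ) : Type := EuclideanSpace ℝ (Fin n)

/-- The phase space `ℝ²ⁿ`, with points `(x, ξ)`. -/
abbrev Phase (n : ℕ) : Type := Conf n × Conf n

/-- The complex Hilbert space `L²(X)` for the standard measure of `X`. It is used for `X = ℝᵈ`
(system), `X = ℝᴺ` (environment) and `X = ℝᵈ × ℝᴺ` (total system); in the last case it is the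
Hilbert tensor product of the first two. -/
abbrev L2 (X : Type) [MeasureSpace X] : Type := Lp ℂ 2 (volume : Measure X)

instance hasTemperateGrowth_volume_prod {d N : ℕ} :
    (volume : Measure (Conf d × Conf N)).HasTemperateGrowth := by
  have : (volume : Measure (Conf d × Conf N)).IsAddHaarMeasure :=
    inferInstanceAs (((volume : Measure (Conf d)).prod
      (volume : Measure (Conf N))).IsAddHaarMeasure)
  infer_instance

/-- The coordinates of `z = (x, ξ)`: first the positions, then the momenta. -/
def coord {n : ℕ} (a : Fin n ⊕ Fin n) (z : Phase n) : ℝ :=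
  Sum.elim (fun j => z.1 j) (fun j => z.2 j) a

/-! ### Tensor products -/

theorem memLp_tensor {d N : ℕ} (f : L2 (Conf d)) (g : L2 (Conf N)) :
    MemLp (fun p : Conf d × Conf N => f p.1 * g p.2) 2 volume := by
  have hf := Lp.memLp f
  have hg := Lp.memLp g
  have hm : AEStronglyMeasurable (fun p : Conf d × Conf N => f p.1 * g p.2)
      (volume : Measure (Conf d × Conf N)) :=
    (hf.1.comp_fst).mul (hg.1.comp_snd)
  rw [memLp_two_iff_integrable_sq_norm hm]
  have h1 := (memLp_two_iff_integrable_sq_norm hf.1).1 hf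
  have h2 := (memLp_two_iff_integrable_sq_norm hg.1).1 hg
  refine (h1.mul_prod h2).congr (Filter.Eventually.of_forall fun p => ?_)
  simp [mul_pow]

/-- The tensor product `f ⊗ g ∈ L²(ℝᵈ × ℝᴺ)`, that is `(x, y) ↦ f x * g y`. -/
def tensor {d N : ℕ} (f : L2 (Conf d)) (g : L2 (Conf N)) : L2 (Conf d × Conf N) :=
  (memLp_tensor f g).toLp

theorem coeFn_tensor {d N : ℕ} (f : L2 (Conf d)) (g : L2 (Conf N)) :
    tensor f g =ᵐ[volume] fun p : Conf d × Conf N => f p.1 * g p.2 :=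
  MemLp.coeFn_toLp _

theorem ae_fst {d N : ℕ} {P : Conf d → Prop} (h : ∀ᵐ x, P x) :
    ∀ᵐ p : Conf d × Conf N, P p.1 :=
  Measure.quasiMeasurePreserving_fst.ae h

theorem ae_snd {d N : ℕ} {P : Conf N → Prop} (h : ∀ᵐ x, P x) :
    ∀ᵐ p : Conf d × Conf N, P p.2 :=
  Measure.quasiMeasurePreserving_snd.ae h

theorem inner_tensor {d N : ℕ} (f f' : L2 (Conf d)) (g g' : L2 (Conf N)) :
    ⟪tensor f g, tensor f' g'⟫_ℂ = ⟪f, f'⟫_ℂ * ⟪g, g'⟫_ℂ := by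
  simp only [L2.inner_def]
  rw [← integral_prod_mul]
  refine integral_congr_ae ?_
  filter_upwards [coeFn_tensor f g, coeFn_tensor f' g'] with p h1 h2
  simp only [h1, h2, RCLike.inner_apply, map_mul]
  ring

theorem norm_tensor {d N : ℕ} (f : L2 (Conf d)) (g : L2 (Conf N)) :
    ‖tensor f g‖ = ‖f‖ * ‖g‖ := by
  have h := inner_tensor f f g g
  simp only [inner_self_eq_norm_sq_to_K] at h
  have h' : ‖tensor f g‖ ^ 2 = (‖f‖ * ‖g‖) ^ 2 := by
    rw [mul_pow]
    exact_mod_cast h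
  exact (pow_left_inj₀ (norm_nonneg _) (by positivity) two_ne_zero).1 h'

/-- The bounded operator `g ↦ f ⊗ g` from `L²(ℝᴺ)` to `L²(ℝᵈ × ℝᴺ)`. -/
def tensorLeft {d N : ℕ} (f : L2 (Conf d)) : L2 (Conf N) →L[ℂ] L2 (Conf d × Conf N) :=
  LinearMap.mkContinuous
    { toFun := fun g => tensor f g
      map_add' := fun g g' => by
        apply Lp.ext
        filter_upwards [coeFn_tensor f (g + g'), coeFn_tensor f g, coeFn_tensor f g',
          Lp.coeFn_add (tensor f g) (tensor f g'), ae_snd (d := d) (Lp.coeFn_add g g')]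
          with p h1 h2 h3 h4 h5
        rw [h1, h4, Pi.add_apply, h2, h3, h5, Pi.add_apply, mul_add]
      map_smul' := fun c g => by
        apply Lp.ext
        filter_upwards [coeFn_tensor f (c • g), coeFn_tensor f g,
          Lp.coeFn_smul c (tensor f g), ae_snd (d := d) (Lp.coeFn_smul c g)] with p h1 h2 h3 h4
        simp only [RingHom.id_apply]
        rw [h1, h3, Pi.smul_apply, h2, h4, Pi.smul_apply, smul_eq_mul, smul_eq_mul]
        ring }
    ‖f‖ (fun g => (norm_tensor f g).le)

/-- The bounded operator `f ↦ f ⊗ g` from `L²(ℝᵈ)` to `L²(ℝᵈ × ℝᴺ)`. -/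
def tensorRight {d N : ℕ} (g : L2 (Conf N)) : L2 (Conf d) →L[ℂ] L2 (Conf d × Conf N) :=
  LinearMap.mkContinuous
    { toFun := fun f => tensor f g
      map_add' := fun f f' => by
        apply Lp.ext
        filter_upwards [coeFn_tensor (f + f') g, coeFn_tensor f g, coeFn_tensor f' g,
          Lp.coeFn_add (tensor f g) (tensor f' g), ae_fst (N := N) (Lp.coeFn_add f f')]
          with p h1 h2 h3 h4 h5
        rw [h1, h4, Pi.add_apply, h2, h3, h5, Pi.add_apply, add_mul]
      map_smul' := fun c f => by
        apply Lp.ext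
        filter_upwards [coeFn_tensor (c • f) g, coeFn_tensor f g,
          Lp.coeFn_smul c (tensor f g), ae_fst (N := N) (Lp.coeFn_smul c f)] with p h1 h2 h3 h4
        simp only [RingHom.id_apply]
        rw [h1, h3, Pi.smul_apply, h2, h4, Pi.smul_apply, smul_eq_mul, smul_eq_mul]
        ring }
    ‖g‖ (fun f => (norm_tensor f g).le.trans_eq (mul_comm _ _))

/-! ### Traces, density operators, partial trace -/

/-- A Hilbert basis of `H`. Traces of trace class operators do not depend on the choice. -/
def hilbertBasis (H : Type) [NormedAddCommGroup H] [InnerProductSpace ℂ H] [CompleteSpace H] :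
    HilbertBasis (exists_hilbertBasis ℂ H).choose ℂ H :=
  (exists_hilbertBasis ℂ H).choose_spec.choose

/-- The trace `∑ ⟨eᵢ, A eᵢ⟩` of a (trace class) operator. -/
def opTrace {H : Type} [NormedAddCommGroup H] [InnerProductSpace ℂ H] [CompleteSpace H]
    (A : H →L[ℂ] H) : ℂ :=
  ∑' i, ⟪hilbertBasis H i, A (hilbertBasis H i)⟫_ℂ

/-- Density operators: positive, trace class (for a positive operator this means that the series
of its diagonal elements converges) and of trace one. -/
structure IsDensityOperator {H : Type} [NormedAddCommGroup H] [InnerProductSpace ℂ H]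
    [CompleteSpace H] (ρ : H →L[ℂ] H) : Prop where
  isPositive : ρ.IsPositive
  summable : Summable fun i => ⟪hilbertBasis H i, ρ (hilbertBasis H i)⟫_ℂ
  trace_eq_one : opTrace ρ = 1

/-- The partial trace over the environment: the operator on `L²(ℝᵈ)` with matrix elements
`⟨f, (tr_E A) f'⟩ = ∑ₖ ⟨f ⊗ eₖ, A (f' ⊗ eₖ)⟩`, where `(eₖ)` is a Hilbert basis of `L²(ℝᴺ)`. For a
trace class operator `A` the series converges absolutely in operator norm. -/
def partialTrace {d N : ℕ} (A : L2 (Conf d × Conf N) →L[ℂ] L2 (Conf d × Conf N)) :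
    L2 (Conf d) →L[ℂ] L2 (Conf d) :=
  ∑' k, (tensorRight (d := d) (hilbertBasis (L2 (Conf N)) k)).adjoint ∘L A ∘L
    tensorRight (hilbertBasis (L2 (Conf N)) k)

/-- The orthogonal projector `Π_ψ f = ⟨ψ, f⟩ ψ` on a unit vector `ψ`. -/
def pureState {d : ℕ} (ψ : L2 (Conf d)) : L2 (Conf d) →L[ℂ] L2 (Conf d) :=
  InnerProductSpace.rankOne ℂ ψ ψ

/-- The decoupled initial state `Π_ψ ⊗ ρ_E`; see `initialState_tensor`. -/
def initialState {d N : ℕ} (ψ : L2 (Conf d)) (ρE : L2 (Conf N) →L[ℂ] L2 (Conf N)) :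
    L2 (Conf d × Conf N) →L[ℂ] L2 (Conf d × Conf N) :=
  tensorLeft ψ ∘L ρE ∘L (tensorLeft ψ).adjoint

theorem initialState_tensor {d N : ℕ} (ψ : L2 (Conf d))
    (ρE : L2 (Conf N) →L[ℂ] L2 (Conf N)) (f : L2 (Conf d)) (g : L2 (Conf N)) :
    initialState ψ ρE (tensor f g) = tensor (pureState ψ f) (ρE g) := by
  have h : (tensorLeft (N := N) ψ).adjoint (tensor f g) = ⟪ψ, f⟫_ℂ • g := by
    refine ext_inner_left ℂ fun v => ?_
    rw [ContinuousLinearMap.adjoint_inner_right, inner_smul_right]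
    exact inner_tensor ψ f v g
  change tensorLeft ψ (ρE ((tensorLeft ψ).adjoint (tensor f g))) = _
  rw [h, map_smul, map_smul, pureState, InnerProductSpace.rankOne_apply]
  exact ((tensorRight (ρE g)).map_smul ⟪ψ, f⟫_ℂ ψ).symm

/-! ### Weyl symbols -/

/-- `T` is the Weyl quantization of the symbol `a` (with Planck constant one):
`(T φ)(x) = (2π)⁻ⁿ ∫∫ exp (i (x - y) · ξ) a ((x + y) / 2, ξ) φ y dξ dy` for Schwartz `φ`. -/
def HasWeylSymbol {n : ℕ} (T : L2 (Conf n) →L[ℂ] L2 (Conf n)) (a : Phase n → ℝ) : Prop :=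
  ∀ φ : 𝓢(Conf n, ℂ), T (φ.toLp 2) =ᵐ[volume] fun x =>
    ((2 * Real.pi : ℝ) : ℂ)⁻¹ ^ n * ∫ y : Conf n, ∫ ξ : Conf n,
      exp (I * (⟪ξ, x - y⟫_ℝ : ℂ)) * (a ((1 / 2 : ℝ) • (x + y), ξ) : ℂ) * φ y

/-- The Wigner function of `ψ`, that is the Weyl symbol of `Π_ψ`:
`(x, ξ) ↦ ∫ exp (-i y · ξ) ψ (x + y / 2) conj (ψ (x - y / 2)) dy` (the integral is real). -/
def wigner {n : ℕ} (ψ : 𝓢(Conf n, ℂ)) (z : Phase n) : ℝ :=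
  (∫ y : Conf n, exp (-I * (⟪z.2, y⟫_ℝ : ℂ)) * ψ (z.1 + (1 / 2 : ℝ) • y) *
    (starRingEnd ℂ) (ψ (z.1 - (1 / 2 : ℝ) • y))).re

/-- The quasi-probability density `π = (2π)⁻ⁿ ρ` attached to the Weyl symbol `ρ` of a state. -/
def quasiProb {n : ℕ} (ρ : Phase n → ℝ) (z : Phase n) : ℝ := (2 * Real.pi)⁻¹ ^ n * ρ z

/-- The mean vector of a quasi-probability density on phase space. -/
def mean {n : ℕ} (π : Phase n → ℝ) (a : Fin n ⊕ Fin n) : ℝ := ∫ z, coord a z * π z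

/-- The covariance matrix of a quasi-probability density on phase space. -/
def cov {n : ℕ} (π : Phase n → ℝ) : Matrix (Fin n ⊕ Fin n) (Fin n ⊕ Fin n) ℝ :=
  Matrix.of fun a b => (∫ z, coord a z * coord b z * π z) - mean π a * mean π b

/-! ### Quadratic Hamiltonians with bilinear coupling -/

/-- Multiplication by the real linear form `ℓ` on Schwartz functions. -/
def posOp {W : Type} [NormedAddCommGroup W] [NormedSpace ℝ W] (l : W →L[ℝ] ℝ) :
    𝓢(W, ℂ) →L[ℂ] 𝓢(W, ℂ) :=
  SchwartzMap.smulLeftCLM ℂ fun w => (l w : ℂ)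

theorem posOp_apply {W : Type} [NormedAddCommGroup W] [NormedSpace ℝ W] (l : W →L[ℝ] ℝ)
    (φ : 𝓢(W, ℂ)) (w : W) : posOp l φ w = (l w : ℂ) * φ w := by
  have h : (fun w : W => (l w : ℂ)).HasTemperateGrowth :=
    (ofRealCLM ∘L l).hasTemperateGrowth
  rw [posOp, SchwartzMap.smulLeftCLM_apply_apply h, smul_eq_mul]

/-- The derivative `-i ∂_v` on Schwartz functions. -/
def momOp {W : Type} [NormedAddCommGroup W] [NormedSpace ℝ W] (v : W) :
    𝓢(W, ℂ) →L[ℂ] 𝓢(W, ℂ) :=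
  (-I) • LineDeriv.lineDerivOpCLM ℂ 𝓢(W, ℂ) v

/-- The quantized phase space coordinates of the system, acting on functions of `(x, y)`:
multiplication by `xⱼ` and `-i ∂/∂xⱼ`. -/
def sysOp {d N : ℕ} (a : Fin d ⊕ Fin d) : 𝓢(Conf d × Conf N, ℂ) →L[ℂ] 𝓢(Conf d × Conf N, ℂ) :=
  Sum.elim (fun j => posOp (EuclideanSpace.proj j ∘L ContinuousLinearMap.fst ℝ (Conf d) (Conf N)))
    (fun j => momOp (EuclideanSpace.single j (1 : ℝ), 0)) a

/-- The quantized phase space coordinates of the environment, acting on functions of `(x, y)`: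
multiplication by `yⱼ` and `-i ∂/∂yⱼ`. -/
def envOp {d N : ℕ} (a : Fin N ⊕ Fin N) : 𝓢(Conf d × Conf N, ℂ) →L[ℂ] 𝓢(Conf d × Conf N, ℂ) :=
  Sum.elim (fun j => posOp (EuclideanSpace.proj j ∘L ContinuousLinearMap.snd ℝ (Conf d) (Conf N)))
    (fun j => momOp (0, EuclideanSpace.single j (1 : ℝ))) a

/-- The Weyl quantization, on Schwartz functions, of the classical Hamiltonian
`½ z · MS z + ½ u · ME u + z · G u` for symmetric `MS`, `ME`. The symmetry of `MS` and `ME` makes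
the operator products symmetrized; system and environment coordinates commute. -/
def hamiltonian {d N : ℕ} (MS : Matrix (Fin d ⊕ Fin d) (Fin d ⊕ Fin d) ℝ)
    (ME : Matrix (Fin N ⊕ Fin N) (Fin N ⊕ Fin N) ℝ)
    (G : Matrix (Fin d ⊕ Fin d) (Fin N ⊕ Fin N) ℝ) :
    𝓢(Conf d × Conf N, ℂ) →L[ℂ] 𝓢(Conf d × Conf N, ℂ) :=
  (1 / 2 : ℂ) • (∑ a, ∑ b, (MS a b : ℂ) • (sysOp a ∘L sysOp b))
    + (1 / 2 : ℂ) • (∑ a, ∑ b, (ME a b : ℂ) • (envOp a ∘L envOp b))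
    + ∑ a, ∑ b, (G a b : ℂ) • (sysOp a ∘L envOp b)

/-- `U t = exp (-i t Ĥ)`: `U` is a strongly continuous one-parameter unitary group which solves the
Schrödinger equation `i ∂ₜ U φ = Ĥ φ` at time zero (hence at all times) for Schwartz initial data.
Since a quadratic Hamiltonian is essentially self-adjoint on the Schwartz space, this determines
`U`. -/
structure IsPropagator {d N : ℕ} (H : 𝓢(Conf d × Conf N, ℂ) →L[ℂ] 𝓢(Conf d × Conf N, ℂ))
    (U : ℝ → L2 (Conf d × Conf N) →L[ℂ] L2 (Conf d × Conf N)) : Prop where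
  unitary : ∀ t, U t ∈ unitary (L2 (Conf d × Conf N) →L[ℂ] L2 (Conf d × Conf N))
  zero : U 0 = 1
  add : ∀ s t, U (s + t) = U s * U t
  continuous : ∀ f, Continuous fun t => U t f
  hasDerivAt : ∀ φ : 𝓢(Conf d × Conf N, ℂ),
    HasDerivAt (fun t => U t (φ.toLp 2 volume)) ((-I) • (H φ).toLp 2 volume) 0

/-- The reduced state `ρ_S(t) = tr_E (U(t) (Π_ψ ⊗ ρ_E) U(t)*)` of the system. -/
def reducedState {d N : ℕ} (U : ℝ → L2 (Conf d × Conf N) →L[ℂ] L2 (Conf d × Conf N))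
    (ψ : 𝓢(Conf d, ℂ)) (ρE : L2 (Conf N) →L[ℂ] L2 (Conf N)) (t : ℝ) :
    L2 (Conf d) →L[ℂ] L2 (Conf d) :=
  partialTrace (U t ∘L initialState (ψ.toLp 2) ρE ∘L (U t).adjoint)

/-- The purity `tr (ρ_S(t)²)` of the system. -/
def purity {d N : ℕ} (U : ℝ → L2 (Conf d × Conf N) →L[ℂ] L2 (Conf d × Conf N))
    (ψ : 𝓢(Conf d, ℂ)) (ρE : L2 (Conf N) →L[ℂ] L2 (Conf N)) (t : ℝ) : ℝ :=
  (opTrace (reducedState U ψ ρE t ∘L reducedState U ψ ρE t)).re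

/-! ### Quantum Brownian motion -/

/-- The matrix of the coupling `x (c₁ y₁ + ⋯ + c_N y_N)` of one degree of freedom to `N`. -/
def qbmCoupling {N : ℕ} (c : Fin N → ℝ) : Matrix (Fin 1 ⊕ Fin 1) (Fin N ⊕ Fin N) ℝ :=
  Matrix.fromBlocks (Matrix.of fun _ j => c j) 0 0 0

/-- The Weyl symbol `∏ⱼ 2 τⱼ exp (-τⱼ (yⱼ² + ηⱼ²))` of a thermal state of `N` oscillators. -/
def thermalSymbol {N : ℕ} (τ : Fin N → ℝ) (u : Phase N) : ℝ :=
  ∏ j, 2 * τ j * Real.exp (-τ j * (u.1 j ^ 2 + u.2 j ^ 2))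

/-- The variance of the position for the probability density `|ψ(x)|²` on the line. -/
def positionVariance (ψ : 𝓢(Conf 1, ℂ)) : ℝ :=
  (∫ x : Conf 1, x 0 ^ 2 * ‖ψ x‖ ^ 2) - (∫ x : Conf 1, x 0 * ‖ψ x‖ ^ 2) ^ 2

end OpenQuantum

end

open OpenQuantum

/-! The state of the environment is first made concrete. Its Weyl symbol is Schwartz, so it is an
integral operator with a Schwartz kernel `K` (`eq_kernelCLM_weylKernel`). Being positive and trace
class, it has an eigenbasis `eᵢ` with eigenvalues `lᵢ` (`exists_eigenbasis`), hence it equals `∑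
|χᵢ⟩⟨χᵢ|` with `χᵢ = √lᵢ eᵢ`. Applying `K` to an eigenvector shows that every `χᵢ` is a Schwartz
function (`eigenFun`).

The total state at time `t` is then `∑ |Wᵢ⟩⟨Wᵢ|` with `Wᵢ = U(t)(ψ ⊗ χᵢ)`, and the purity is the
double series `∑ᵢⱼ ‖gram Wᵢ Wⱼ‖²` of squared Hilbert-Schmidt norms (`opTrace_partialTrace_sq`). Each
summand is twice differentiable, because `Ĥ` preserves the Schwartz space. The series may be
differentiated termwise (`contDiff_two_tsum_norm_sq`) as soon as `∑ ‖Ĥᵏ(ψ ⊗ χᵢ)‖²` converges for `k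
≤ 2`. This reduces to traces of operators `BK` with `B` a polynomial in positions and momenta; such
an operator again has a Schwartz kernel, and its trace converges to the integral of the kernel over
the diagonal (`hasSum_inner_kernelCLM`).

At time zero write `Ĥ = ∑ S_θ ⊗ E_θ` over the system term, the environment term and the elementary
couplings. All contributions to the second derivative combine (`hasSum_normSqDeriv₂_tensor`) into
`-4 Re ∑ (⟨S_θ S_θ'⟩ - ⟨S_θ⟩⟨S_θ'⟩) (⟨E_θ E_θ'⟩ - ⟨E_θ⟩⟨E_θ'⟩)`. A covariance with the identity
vanishes, so the free Hamiltonians drop out and only couplings remain. Moyal calculus gives the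
operator covariance of two phase space coordinates as `Cov - (i/2) J` (`sysOp_weylKernel`,
`integral_moyal_moyal`). The real part of the product of two such matrices leaves `Cov Cov` and `J
J`, which is the formula (`sum_sum_coupling`).

For Brownian motion the coupling selects the position entry of the system, where `J` is zero, and
Gaussian integration by parts gives the bath position covariance `1 / (2τⱼ)` on the diagonal. -/

open MeasureTheory Complex
open scoped SchwartzMap ENNReal InnerProductSpace LineDeriv FourierTransform

noncomputable section

namespace OpenQuantum

/-! ### Positive trace class operators and sums of rank one operators on a Hilbert space -/

section Hilbert

variable {H : Type} [NormedAddCommGroup H] [InnerProductSpace ℂ H] [CompleteSpace H]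

omit [CompleteSpace H] in
theorem hasSum_norm_inner_sq {κ : Type} (b : HilbertBasis κ ℂ H) (x : H) :
    HasSum (fun k => ‖⟪b k, x⟫_ℂ‖ ^ 2) (‖x‖ ^ 2) := by
  have h := b.hasSum_inner_mul_inner x x
  rw [← Complex.hasSum_ofReal]
  rw [inner_self_eq_norm_sq_to_K] at h
  have e : ((‖x‖ ^ 2 : ℝ) : ℂ) = (‖x‖ : ℂ) ^ 2 := by push_cast; rfl
  rw [e]
  refine (congrArg (HasSum · _ _) (funext fun k => ?_)).mp h
  rw [← inner_conj_symm x (b k), ← Complex.normSq_eq_conj_mul_self, Complex.normSq_eq_norm_sq]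

-- Cauchy-Schwarz for the two coefficient families, combined with Parseval. The bound does not
-- depend on the basis, and it is what permits exchanging a trace with a sum or an integral.
omit [CompleteSpace H] in
theorem summable_norm_inner_mul_inner {κ : Type} (b : HilbertBasis κ ℂ H) (x y : H) :
    Summable (fun k => ‖⟪x, b k⟫_ℂ * ⟪b k, y⟫_ℂ‖) ∧
      ∑' k, ‖⟪x, b k⟫_ℂ * ⟪b k, y⟫_ℂ‖ ≤ ‖x‖ * ‖y‖ := by
  have hx := hasSum_norm_inner_sq b x
  have hy := hasSum_norm_inner_sq b y
  have h := Real.summable_and_inner_le_Lp_mul_Lq_tsum_of_nonneg (p := 2) (q := 2)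
    (f := fun k => ‖⟪b k, x⟫_ℂ‖) (g := fun k => ‖⟪b k, y⟫_ℂ‖) Real.HolderConjugate.two_two
    (fun _ => norm_nonneg _) (fun _ => norm_nonneg _)
    (by simpa using hx.summable) (by simpa using hy.summable)
  have e : (fun k => ‖⟪x, b k⟫_ℂ * ⟪b k, y⟫_ℂ‖) = fun k => ‖⟪b k, x⟫_ℂ‖ * ‖⟪b k, y⟫_ℂ‖ := by
    ext k
    rw [norm_mul, norm_inner_symm]
  rw [e]
  refine ⟨h.1, h.2.trans_eq ?_⟩
  simp only [Real.rpow_two, hx.tsum_eq, hy.tsum_eq]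
  rw [← Real.sqrt_eq_rpow, ← Real.sqrt_eq_rpow, Real.sqrt_sq (norm_nonneg _),
    Real.sqrt_sq (norm_nonneg _)]

omit [CompleteSpace H] in
/-- The trace of an absolutely convergent sum of operators of rank one. -/
theorem hasSum_inner_of_hasSum_rankOne {ι κ : Type} (b : HilbertBasis κ ℂ H) {u v : ι → H}
    (h : Summable fun i => ‖u i‖ * ‖v i‖) {A : H →L[ℂ] H}
    (hA : HasSum (fun i => InnerProductSpace.rankOne ℂ (u i) (v i)) A) :
    HasSum (fun k => ⟪b k, A (b k)⟫_ℂ) (∑' i, ⟪v i, u i⟫_ℂ) := by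
  -- Each row of the double family has absolute sum at most `‖v i‖ * ‖u i‖`. Summing over the basis
  -- first gives the stated value; summing over `ι` first gives the diagonal elements of `A`.
  have hs : Summable fun p : ι × κ => ⟪v p.1, b p.2⟫_ℂ * ⟪b p.2, u p.1⟫_ℂ := by
    apply Summable.of_norm
    rw [summable_prod_of_nonneg (fun _ => norm_nonneg _)]
    refine ⟨fun i => (summable_norm_inner_mul_inner b (v i) (u i)).1, ?_⟩
    refine Summable.of_nonneg_of_le (fun i => tsum_nonneg fun _ => norm_nonneg _)
      (fun i => (summable_norm_inner_mul_inner b (v i) (u i)).2) ?_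
    simpa [mul_comm] using h
  have h1 : HasSum (fun p : ι × κ => ⟪v p.1, b p.2⟫_ℂ * ⟪b p.2, u p.1⟫_ℂ)
      (∑' i, ⟪v i, u i⟫_ℂ) := by
    convert hs.hasSum using 1
    rw [hs.tsum_prod]
    exact tsum_congr fun i => (b.tsum_inner_mul_inner (v i) (u i)).symm
  have h2 := (Equiv.prodComm κ ι).hasSum_iff.2 h1
  refine h2.prod_fiberwise fun k => ?_
  have h3 := (hA.mapL (ContinuousLinearMap.apply ℂ H (b k))).mapL (innerSL ℂ (b k))
  simpa [InnerProductSpace.rankOne_apply, inner_smul_right] using h3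

theorem exists_sqrt {ρ : H →L[ℂ] H} (hρ : ρ.IsPositive) :
    ∃ R : H →L[ℂ] H, IsSelfAdjoint R ∧ R ∘L R = ρ := by
  have h0 : 0 ≤ ρ := (ContinuousLinearMap.nonneg_iff_isPositive ρ).2 hρ
  exact ⟨CFC.sqrt ρ, (CFC.sqrt_nonneg ρ).isSelfAdjoint, CFC.sqrt_mul_sqrt_self ρ h0⟩

/-- With `R` the square root, `ρ = ∑ |R bₖ⟩⟨R bₖ|`, and the norm of the `k`-th summand is `‖R bₖ‖² =
⟨bₖ, ρ bₖ⟩`. The series therefore converges in operator norm, and `ρ` is a limit of finite rank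
operators. -/
theorem isCompactOperator_of_summable {ρ : H →L[ℂ] H} (hρ : ρ.IsPositive) {κ : Type}
    (b : HilbertBasis κ ℂ H) (hs : Summable fun k => ⟪b k, ρ (b k)⟫_ℂ) :
    IsCompactOperator ρ := by
  obtain ⟨R, hR, rfl⟩ := exists_sqrt hρ
  have hRs : ∀ x y, ⟪R x, y⟫_ℂ = ⟪x, R y⟫_ℂ := fun x y => by
    rw [← ContinuousLinearMap.adjoint_inner_right, hR.adjoint_eq]
  have hs' : Summable fun k => ‖InnerProductSpace.rankOne ℂ (R (b k)) (R (b k))‖ := by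
    have := hs.norm
    refine this.congr fun k => ?_
    rw [ContinuousLinearMap.comp_apply, ← hRs, inner_self_eq_norm_sq_to_K,
      InnerProductSpace.norm_rankOne]
    simp [sq]
  have h1 := hs'.of_norm.hasSum
  have h2 : ∑' k, InnerProductSpace.rankOne ℂ (R (b k)) (R (b k)) = R ∘L R := by
    ext x
    have h3 := h1.mapL (ContinuousLinearMap.apply ℂ H x)
    have h4 := (b.hasSum_repr (R x)).mapL R
    refine h3.unique ?_
    simpa [InnerProductSpace.rankOne_apply, HilbertBasis.repr_apply_apply, hRs] using h4
  rw [h2] at h1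
  refine isCompactOperator_of_tendsto h1 (Filter.Eventually.of_forall fun s => ?_)
  induction s using Finset.cons_induction with
  | empty => simpa using isCompactOperator_zero
  | cons a s ha ih =>
    rw [Finset.sum_cons]
    refine IsCompactOperator.add ?_ ih
    change IsCompactOperator (InnerProductSpace.rankOne ℂ (R (b a)) (R (b a)) : H → H)
    have : (InnerProductSpace.rankOne ℂ (R (b a)) (R (b a)) : H → H) =
      (ContinuousLinearMap.toSpanSingleton ℂ (R (b a))) ∘ (innerSL ℂ (R (b a))) := by
      ext x
      simp [InnerProductSpace.rankOne_apply]
    rw [this]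
    have hc : IsCompactOperator (innerSL ℂ (R (b a)) : H → ℂ) := by
      refine ⟨Metric.closedBall 0 1, isCompact_closedBall _ _, ?_⟩
      exact (innerSL ℂ (R (b a))).continuous.continuousAt.preimage_mem_nhds
        (by simpa using Metric.closedBall_mem_nhds (0:ℂ) one_pos)
    exact hc.clm_comp _

open scoped ComplexOrder in
/-- A positive operator of trace class has an orthonormal basis of eigenvectors. -/
theorem exists_eigenbasis {ρ : H →L[ℂ] H} (hρ : ρ.IsPositive) {κ : Type}
    (b : HilbertBasis κ ℂ H) (hs : Summable fun k => ⟪b k, ρ (b k)⟫_ℂ) :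
    ∃ (ι : Type) (e : HilbertBasis ι ℂ H) (l : ι → ℝ),
      (∀ i, 0 ≤ l i) ∧ ∀ i, ρ (e i) = (l i : ℂ) • e i := by
  have hc := isCompactOperator_of_summable hρ b hs
  have hsym : (ρ : H →ₗ[ℂ] H).IsSymmetric := hρ.isSymmetric
  have hbot := ContinuousLinearMap.orthogonalComplement_iSup_eigenspaces_eq_bot hc hsym
  let V : ℂ → Submodule ℂ H := fun μ => Module.End.eigenspace (ρ : H →ₗ[ℂ] H) μ
  have hcl : ∀ μ, IsClosed (V μ : Set H) := fun μ => by
    have : (V μ : Set H) = {x | ρ x = μ • x} := by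
      ext x
      exact Module.End.mem_eigenspace_iff
    rw [this]
    exact isClosed_eq ρ.continuous (continuous_const_smul μ)
  have hcomp : ∀ μ, CompleteSpace (V μ) := fun μ => (hcl μ).completeSpace_coe
  choose w B hB using fun μ => exists_hilbertBasis ℂ (V μ)
  -- Hilbert bases of all the eigenspaces are glued together. For `μ` that is not an eigenvalue the
  -- space is zero and contributes no index. Completeness is the spectral theorem for compact
  -- symmetric operators.
  let v : (Σ μ, w μ) → H := fun p => (B p.1 p.2 : H)
  have hv : Orthonormal ℂ v :=
    hsym.orthogonalFamily_eigenspaces.orthonormal_sigma_orthonormal (fun μ => (B μ).orthonormal)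
  have hspan : (Submodule.span ℂ (Set.range v))ᗮ = ⊥ := by
    rw [eq_bot_iff, ← hbot]
    intro x hx
    rw [Submodule.mem_orthogonal]
    intro y hy
    have hle : (⨆ μ, V μ) ≤ (ℂ ∙ x)ᗮ := by
      refine iSup_le fun μ z hz => ?_
      rw [Submodule.mem_orthogonal_singleton_iff_inner_left]
      have hz' := ((B μ).hasSum_repr ⟨z, hz⟩).mapL (V μ).subtypeL
      have hz'' := hz'.mapL (innerSL ℂ x)
      have h0 : ∀ i : w μ, ⟪x, (B μ i : H)⟫_ℂ = 0 := fun i => by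
        rw [Submodule.mem_orthogonal'] at hx
        exact hx _ (Submodule.subset_span ⟨⟨μ, i⟩, rfl⟩)
      have h1 : ⟪x, z⟫_ℂ = 0 := by
        refine hz''.unique ?_
        convert hasSum_zero with i
        simp [h0]
      rw [← inner_conj_symm, h1, map_zero]
    exact Submodule.mem_orthogonal_singleton_iff_inner_left.1 (hle hy)
  let e := HilbertBasis.mkOfOrthogonalEqBot hv hspan
  have he : ∀ p, ρ (e p) = p.1 • e p := fun p => by
    rw [HilbertBasis.coe_mkOfOrthogonalEqBot]
    exact Module.End.mem_eigenspace_iff.1 (B p.1 p.2).2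
  have hμ : ∀ p : (Σ μ, w μ), p.1 = ⟪e p, ρ (e p)⟫_ℂ := fun p => by
    rw [he, inner_smul_right, inner_self_eq_norm_sq_to_K, e.orthonormal.1 p]
    simp
  have hre : ∀ p : (Σ μ, w μ), 0 ≤ p.1 := fun p => by
    rw [hμ]
    exact hρ.inner_nonneg_right (e p)
  refine ⟨_, e, fun p => p.1.re, fun p => (Complex.nonneg_iff.1 (hre p)).1, fun p => ?_⟩
  have : ((p.1.re : ℝ) : ℂ) = p.1 := by
    apply Complex.ext
    · simp
    · simpa using (Complex.nonneg_iff.1 (hre p)).2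
  rw [this, he]

/-- A trace class operator in terms of an eigenbasis. -/
theorem hasSum_eigenbasis {ρ : H →L[ℂ] H} {ι : Type} (e : HilbertBasis ι ℂ H) {l : ι → ℝ}
    (hl : ∀ i, 0 ≤ l i) (hs : Summable l) (he : ∀ i, ρ (e i) = (l i : ℂ) • e i) :
    HasSum (fun i => (l i : ℂ) • InnerProductSpace.rankOne ℂ (e i) (e i)) ρ := by
  have hs' : Summable fun i => ‖(l i : ℂ) • InnerProductSpace.rankOne ℂ (e i) (e i)‖ := by
    refine hs.congr fun i => ?_
    rw [norm_smul, InnerProductSpace.norm_rankOne, e.orthonormal.1 i]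
    simp [abs_of_nonneg (hl i)]
  have h1 : HasSum (fun i => (l i : ℂ) • InnerProductSpace.rankOne ℂ (e i) (e i)) _ :=
    hs'.of_norm.hasSum
  convert h1 using 1
  ext x
  have h3 := h1.mapL (ContinuousLinearMap.apply ℂ H x)
  have h4 := (e.hasSum_repr x).mapL ρ
  refine HasSum.unique ?_ h3
  convert h4 using 1
  ext i
  simp only [ContinuousLinearMap.apply_apply, InnerProductSpace.rankOne_apply,
    HilbertBasis.repr_apply_apply, map_smul, he]
  exact smul_comm _ _ _

omit [CompleteSpace H] in
theorem gram_isPositive {ι : Type} {τ : ι → H} {S : H →L[ℂ] H}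
    (hS : HasSum (fun i => InnerProductSpace.rankOne ℂ (τ i) (τ i)) S) : S.IsPositive := by
  rw [ContinuousLinearMap.isPositive_iff_complex]
  intro x
  have h := (hS.mapL (ContinuousLinearMap.apply ℂ H x)).mapL (innerSL ℂ x)
  have h1 : HasSum (fun i => ((‖⟪τ i, x⟫_ℂ‖ ^ 2 : ℝ) : ℂ)) ⟪x, S x⟫_ℂ := by
    refine (congrArg (HasSum · _ _) (funext fun i => ?_)).mp h
    simp only [ContinuousLinearMap.apply_apply, InnerProductSpace.rankOne_apply,
      innerSL_apply_apply, inner_smul_right]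
    rw [← inner_conj_symm x (τ i), Complex.mul_conj, Complex.normSq_eq_norm_sq]
  have h2 := h1.mapL Complex.reCLM
  have h3 := Complex.hasSum_ofReal.2 (h2 : HasSum (fun i => ‖⟪τ i, x⟫_ℂ‖ ^ 2) (⟪x, S x⟫_ℂ).re)
  have h4 := h1.unique h3
  rw [← inner_conj_symm (S x) x, h4]
  simp only [Complex.conj_ofReal]
  exact ⟨rfl, h2.nonneg fun i => by rw [Complex.reCLM_apply, Complex.ofReal_re]; positivity⟩

/-- The trace of the square of `∑ |τᵢ⟩⟨τᵢ|`. -/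
theorem gram_trace_sq {ι κ : Type} (b : HilbertBasis κ ℂ H) {τ : ι → H} {S : H →L[ℂ] H}
    (h : Summable fun i => ‖τ i‖ ^ 2)
    (hS : HasSum (fun i => InnerProductSpace.rankOne ℂ (τ i) (τ i)) S) :
    HasSum (fun k => ⟪b k, (S ∘L S) (b k)⟫_ℂ)
      (∑' p : ι × ι, ((‖⟪τ p.1, τ p.2⟫_ℂ‖ ^ 2 : ℝ) : ℂ)) := by
  have hs2 : Summable fun p : ι × ι => ‖τ p.1‖ ^ 2 * ‖τ p.2‖ ^ 2 :=
    h.mul_of_nonneg h (fun _ => by positivity) (fun _ => by positivity)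
  have hn : Summable fun p : ι × ι => ‖⟪τ p.1, τ p.2⟫_ℂ • τ p.1‖ * ‖τ p.2‖ := by
    refine Summable.of_nonneg_of_le (fun _ => by positivity) (fun p => ?_) hs2
    rw [norm_smul]
    calc ‖⟪τ p.1, τ p.2⟫_ℂ‖ * ‖τ p.1‖ * ‖τ p.2‖ ≤ (‖τ p.1‖ * ‖τ p.2‖) * ‖τ p.1‖ * ‖τ p.2‖ := by
          gcongr
          exact norm_inner_le_norm _ _
      _ = _ := by ring
  have hsn : Summable fun p : ι × ι =>
      InnerProductSpace.rankOne ℂ (⟪τ p.1, τ p.2⟫_ℂ • τ p.1) (τ p.2) := by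
    refine Summable.of_norm (hn.congr fun p => ?_)
    rw [InnerProductSpace.norm_rankOne]
  -- The square expands as `∑ ⟨τᵢ, τⱼ⟩ |τᵢ⟩⟨τⱼ|`, absolutely convergent in norm, so the trace can be
  -- taken term by term.
  have hSS : HasSum (fun p : ι × ι =>
      InnerProductSpace.rankOne ℂ (⟪τ p.1, τ p.2⟫_ℂ • τ p.1) (τ p.2)) (S ∘L S) := by
    convert hsn.hasSum using 1
    rw [hsn.tsum_prod]
    have h1 := hS.mapL ((ContinuousLinearMap.compL ℂ H H H).flip S)
    rw [← h1.tsum_eq.trans (by rfl : _ = S ∘L S)]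
    refine tsum_congr fun i => ?_
    have h2 := hS.mapL (ContinuousLinearMap.compL ℂ H H H (InnerProductSpace.rankOne ℂ (τ i) (τ i)))
    refine h2.tsum_eq.symm.trans (tsum_congr fun j => ?_)
    ext x
    simp [InnerProductSpace.rankOne_apply, smul_smul, mul_comm]
  convert hasSum_inner_of_hasSum_rankOne b hn hSS using 1
  refine tsum_congr fun p => ?_
  rw [inner_smul_right, ← inner_conj_symm (τ p.2) (τ p.1), Complex.mul_conj,
    Complex.normSq_eq_norm_sq]

end Hilbert

/-! ### Tensor products in `L²(ℝᵈ × ℝᴺ)` -/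

section Tensor

variable {d N : ℕ}

/-- The indicator of a rectangle of finite measure is itself a product vector. -/
theorem setIntegral_prod_eq_zero {Φ : L2 (Conf d × Conf N)}
    (h : ∀ f g, ⟪tensor f g, Φ⟫_ℂ = 0) {A : Set (Conf d)} {B : Set (Conf N)}
    (hA : MeasurableSet A) (hB : MeasurableSet B) (hA' : volume A ≠ ⊤) (hB' : volume B ≠ ⊤) :
    ∫ p in A ×ˢ B, Φ p = 0 := by
  have h1 := h (indicatorConstLp 2 hA hA' 1) (indicatorConstLp 2 hB hB' 1)
  rw [L2.inner_def] at h1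
  rw [← integral_indicator (hA.prod hB), ← h1]
  refine integral_congr_ae ?_
  filter_upwards [coeFn_tensor (indicatorConstLp 2 hA hA' (1:ℂ)) (indicatorConstLp 2 hB hB' (1:ℂ)),
    ae_fst (N := N) (indicatorConstLp_coeFn (p := 2) (hs := hA) (hμs := hA') (c := (1:ℂ))),
    ae_snd (d := d) (indicatorConstLp_coeFn (p := 2) (hs := hB) (hμs := hB') (c := (1:ℂ)))]
    with p h2 h3 h4
  rw [h2, h3, h4]
  by_cases hp1 : p.1 ∈ A <;> by_cases hp2 : p.2 ∈ B <;>
    simp [Set.indicator, hp1, hp2]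

/-- Products are total in `L²` of the product space. The integrals of `Φ` over rectangles vanish,
and a π-λ argument extends this to all measurable sets. It is run inside bounded rectangles `K n`,
since `Φ` is only locally integrable. -/
theorem eq_zero_of_inner_tensor {Φ : L2 (Conf d × Conf N)}
    (h : ∀ f g, ⟪tensor f g, Φ⟫_ℂ = 0) : Φ = 0 := by
  let K : ℕ → Set (Conf d × Conf N) := fun n => Metric.ball 0 n ×ˢ Metric.ball 0 n
  have hKm : ∀ n, MeasurableSet (K n) := fun n => measurableSet_ball.prod measurableSet_ball
  have hKf : ∀ n, volume (K n) < ⊤ := fun n => by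
    rw [Measure.volume_eq_prod, Measure.prod_prod]
    exact ENNReal.mul_lt_top measure_ball_lt_top measure_ball_lt_top
  have hint : ∀ n, IntegrableOn Φ (K n) := fun n => by
    have : IsFiniteMeasure (volume.restrict (K n)) := ⟨by simpa using hKf n⟩
    exact ((Lp.memLp Φ).restrict (K n)).integrable one_le_two
  have hset : ∀ n (s : Set (Conf d × Conf N)), MeasurableSet s → ∫ p in s ∩ K n, Φ p = 0 := by
    intro n s hs
    have h0 : ∫ p in K n, Φ p = 0 :=
      setIntegral_prod_eq_zero h measurableSet_ball measurableSet_ball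
        measure_ball_lt_top.ne measure_ball_lt_top.ne
    refine MeasurableSpace.induction_on_inter (C := fun s _ => ∫ p in s ∩ K n, Φ p = 0)
      generateFrom_prod.symm isPiSystem_prod (by simp) ?_ ?_ ?_ s hs
    · rintro _ ⟨A, hA, B, hB, rfl⟩
      change ∫ p in (A ×ˢ B) ∩ (Metric.ball 0 n ×ˢ Metric.ball 0 n), Φ p = 0
      rw [Set.prod_inter_prod]
      refine setIntegral_prod_eq_zero h (MeasurableSet.inter (Set.mem_ofPred.1 hA) measurableSet_ball)
        (MeasurableSet.inter (Set.mem_ofPred.1 hB) measurableSet_ball)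
        ?_ ?_
      · exact (measure_mono Set.inter_subset_right).trans_lt measure_ball_lt_top |>.ne
      · exact (measure_mono Set.inter_subset_right).trans_lt measure_ball_lt_top |>.ne
    · intro t ht hzero
      have := integral_inter_add_sdiff (μ := volume) (s := K n) ht (hint n)
      rw [Set.inter_comm, hzero, h0, zero_add] at this
      rwa [Set.inter_comm, ← Set.sdiff_eq]
    · intro f hdis hf hzero
      rw [Set.iUnion_inter, integral_iUnion (fun i => (hf i).inter (hKm n))]
      · simp [hzero]
      · exact fun i j hij => (hdis hij).mono Set.inter_subset_left Set.inter_subset_left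
      · exact (hint n).mono_set (by simp [← Set.iUnion_inter])
  have hae : ∀ n, ∀ᵐ p ∂(volume.restrict (K n)), Φ p = 0 := fun n => by
    refine Integrable.ae_eq_zero_of_forall_setIntegral_eq_zero (hint n) fun s hs _ => ?_
    rw [Measure.restrict_restrict hs]
    exact hset n s hs
  have hU : (⋃ n, K n) = Set.univ := by
    refine Set.eq_univ_of_forall fun p => ?_
    obtain ⟨n, hn⟩ := exists_nat_gt (max ‖p.1‖ ‖p.2‖)
    refine Set.mem_iUnion.2 ⟨n, ?_, ?_⟩
    · simpa using (le_max_left _ _).trans_lt hn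
    · simpa using (le_max_right _ _).trans_lt hn
  apply Lp.ext
  have h1 : ∀ᵐ p ∂(volume.restrict (⋃ n, K n)), Φ p = 0 := by
    rw [ae_restrict_iUnion_iff]
    exact hae
  rw [hU, Measure.restrict_univ] at h1
  filter_upwards [h1, Lp.coeFn_zero ℂ 2 (volume : Measure (Conf d × Conf N))] with p h2 h3
  rw [h2, h3, Pi.zero_apply]

/-- Partial scalar product `⟨g, Φ⟩` over the environment. -/
def partialInner (g : L2 (Conf N)) : L2 (Conf d × Conf N) →L[ℂ] L2 (Conf d) :=
  (tensorRight g).adjoint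

theorem inner_partialInner (f : L2 (Conf d)) (g : L2 (Conf N)) (Φ : L2 (Conf d × Conf N)) :
    ⟪f, partialInner g Φ⟫_ℂ = ⟪tensor f g, Φ⟫_ℂ :=
  ContinuousLinearMap.adjoint_inner_right _ _ _

theorem partialInner_tensor (f : L2 (Conf d)) (g g' : L2 (Conf N)) :
    partialInner g (tensor f g') = ⟪g, g'⟫_ℂ • f := by
  refine ext_inner_left ℂ fun v => ?_
  rw [inner_partialInner, inner_tensor, inner_smul_right, mul_comm]

/-- The products of two Hilbert bases form a Hilbert basis of the product space; Parseval is applied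
there and then the system index is summed out. -/
theorem hasSum_norm_partialInner_sq {κ : Type} (b : HilbertBasis κ ℂ (L2 (Conf N)))
    (Φ : L2 (Conf d × Conf N)) : HasSum (fun k => ‖partialInner (b k) Φ‖ ^ 2) (‖Φ‖ ^ 2) := by
  let a := hilbertBasis (L2 (Conf d))
  have ho : Orthonormal ℂ fun p : κ × _ => tensor (a p.2) (b p.1) := by
    classical
    rw [orthonormal_iff_ite]
    intro p q
    rw [inner_tensor, orthonormal_iff_ite.1 a.orthonormal, orthonormal_iff_ite.1 b.orthonormal]
    by_cases h1 : p.1 = q.1 <;> by_cases h2 : p.2 = q.2 <;> simp [h1, h2, Prod.ext_iff]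
  have hbot : (Submodule.span ℂ (Set.range fun p : κ × _ => tensor (a p.2) (b p.1)))ᗮ = ⊥ := by
    rw [Submodule.eq_bot_iff]
    intro Φ hΦ
    rw [Submodule.mem_orthogonal] at hΦ
    refine eq_zero_of_inner_tensor fun f g => ?_
    have h1 : ∀ k, partialInner (b k) Φ = 0 := fun k => by
      apply a.repr.injective
      ext i
      rw [HilbertBasis.repr_apply_apply, inner_partialInner,
        hΦ _ (Submodule.subset_span ⟨(k, i), rfl⟩)]
      simp
    have h2 : (tensorLeft (N := N) f).adjoint Φ = 0 := by
      apply b.repr.injective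
      ext k
      rw [HilbertBasis.repr_apply_apply, ContinuousLinearMap.adjoint_inner_right]
      change ⟪tensor f (b k), Φ⟫_ℂ = _
      rw [← inner_partialInner, h1]
      simp
    have h3 := ContinuousLinearMap.adjoint_inner_right (tensorLeft (N := N) f) g Φ
    rw [h2, inner_zero_right] at h3
    exact h3.symm
  have h := hasSum_norm_inner_sq (HilbertBasis.mkOfOrthogonalEqBot ho hbot) Φ
  rw [HilbertBasis.coe_mkOfOrthogonalEqBot] at h
  refine h.prod_fiberwise fun k => ?_
  have h1 := hasSum_norm_inner_sq a (partialInner (b k) Φ)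
  simpa only [inner_partialInner] using h1

theorem summable_gramCoeff {κ : Type} (b : HilbertBasis κ ℂ (L2 (Conf N)))
    (Φ Ψ : L2 (Conf d × Conf N)) :
    Summable (fun p : κ × κ => ‖⟪partialInner (b p.1) Φ, partialInner (b p.2) Ψ⟫_ℂ‖ ^ 2) ∧
    ∑' p : κ × κ, ‖⟪partialInner (b p.1) Φ, partialInner (b p.2) Ψ⟫_ℂ‖ ^ 2 ≤
      ‖Φ‖ ^ 2 * ‖Ψ‖ ^ 2 := by
  have h1 := hasSum_norm_partialInner_sq b Φ
  have h2 := hasSum_norm_partialInner_sq b Ψ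
  have hs := h1.summable.mul_of_nonneg h2.summable (fun _ => by positivity)
    (fun _ => by positivity)
  have hle : ∀ p : κ × κ, ‖⟪partialInner (b p.1) Φ, partialInner (b p.2) Ψ⟫_ℂ‖ ^ 2 ≤
      ‖partialInner (b p.1) Φ‖ ^ 2 * ‖partialInner (b p.2) Ψ‖ ^ 2 := fun p => by
    rw [← mul_pow]
    gcongr
    exact norm_inner_le_norm _ _
  have hs' := Summable.of_nonneg_of_le (fun _ => by positivity) hle hs
  refine ⟨hs', (hs'.tsum_le_tsum hle hs).trans_eq ?_⟩
  exact (h1.mul h2 hs).tsum_eq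

/-- The coefficients of the partial trace of `|Ψ⟩⟨Φ|` over the system, as a square summable
family. -/
def gramVec {κ : Type} (b : HilbertBasis κ ℂ (L2 (Conf N))) (Φ Ψ : L2 (Conf d × Conf N)) :
    lp (fun _ : κ × κ => ℂ) 2 :=
  ⟨fun p : κ × κ => ⟪partialInner (b p.1) Φ, partialInner (b p.2) Ψ⟫_ℂ,
    memℓp_gen (by simpa using (summable_gramCoeff b Φ Ψ).1)⟩

theorem gramVec_apply {κ : Type} (b : HilbertBasis κ ℂ (L2 (Conf N)))
    (Φ Ψ : L2 (Conf d × Conf N)) (p : κ × κ) :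
    gramVec b Φ Ψ p = ⟪partialInner (b p.1) Φ, partialInner (b p.2) Ψ⟫_ℂ := rfl

theorem hasSum_norm_gramVec_sq {κ : Type} (b : HilbertBasis κ ℂ (L2 (Conf N)))
    (Φ Ψ : L2 (Conf d × Conf N)) :
    HasSum (fun p : κ × κ => ‖⟪partialInner (b p.1) Φ, partialInner (b p.2) Ψ⟫_ℂ‖ ^ 2)
      (‖gramVec b Φ Ψ‖ ^ 2) := by
  have := lp.norm_rpow_eq_tsum (p := 2) (by simp) (gramVec b Φ Ψ)
  have h : ‖gramVec b Φ Ψ‖ ^ 2 =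
      ∑' p : κ × κ, ‖⟪partialInner (b p.1) Φ, partialInner (b p.2) Ψ⟫_ℂ‖ ^ 2 := by
    simpa [gramVec_apply] using this
  rw [h]
  exact (summable_gramCoeff b Φ Ψ).1.hasSum

theorem norm_gramVec_le {κ : Type} (b : HilbertBasis κ ℂ (L2 (Conf N)))
    (Φ Ψ : L2 (Conf d × Conf N)) : ‖gramVec b Φ Ψ‖ ≤ ‖Φ‖ * ‖Ψ‖ := by
  rw [← pow_le_pow_iff_left₀ (norm_nonneg _) (by positivity) two_ne_zero, mul_pow,
    ← (hasSum_norm_gramVec_sq b Φ Ψ).tsum_eq]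
  exact (summable_gramCoeff b Φ Ψ).2

/-- `gramVec` as a bilinear map over the reals. -/
def gramLin {κ : Type} (b : HilbertBasis κ ℂ (L2 (Conf N))) :
    L2 (Conf d × Conf N) →ₗ[ℝ] L2 (Conf d × Conf N) →ₗ[ℝ] lp (fun _ : κ × κ => ℂ) 2 :=
  LinearMap.mk₂ ℝ (gramVec b)
    (fun Φ Φ' Ψ => by
      ext p
      rw [lp.coeFn_add, Pi.add_apply]
      simp only [gramVec_apply, map_add, inner_add_left])
    (fun c Φ Ψ => by
      ext p
      rw [lp.coeFn_smul, Pi.smul_apply]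
      simp only [gramVec_apply]
      rw [← algebraMap_smul ℂ c Φ, map_smul, inner_smul_left, Complex.coe_algebraMap,
        Complex.conj_ofReal, Complex.real_smul])
    (fun Φ Ψ Ψ' => by
      ext p
      rw [lp.coeFn_add, Pi.add_apply]
      simp only [gramVec_apply, map_add, inner_add_right])
    (fun c Φ Ψ => by
      ext p
      rw [lp.coeFn_smul, Pi.smul_apply]
      simp only [gramVec_apply]
      rw [← algebraMap_smul ℂ c Ψ, map_smul, inner_smul_right, Complex.coe_algebraMap,
        Complex.real_smul])

theorem gramLin_apply {κ : Type} (b : HilbertBasis κ ℂ (L2 (Conf N)))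
    (Φ Ψ : L2 (Conf d × Conf N)) : gramLin b Φ Ψ = gramVec b Φ Ψ := by
  rw [gramLin, LinearMap.mk₂_apply]

theorem norm_gramLin_le {κ : Type} (b : HilbertBasis κ ℂ (L2 (Conf N)))
    (Φ Ψ : L2 (Conf d × Conf N)) : ‖gramLin b Φ Ψ‖ ≤ 1 * ‖Φ‖ * ‖Ψ‖ := by
  rw [one_mul, gramLin_apply]
  exact norm_gramVec_le b Φ Ψ

/-- `gramVec` as a bounded bilinear map over the reals. -/
def gram {κ : Type} (b : HilbertBasis κ ℂ (L2 (Conf N))) :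
    L2 (Conf d × Conf N) →L[ℝ] L2 (Conf d × Conf N) →L[ℝ] lp (fun _ : κ × κ => ℂ) 2 :=
  (gramLin b).mkContinuous₂ 1 (norm_gramLin_le b)

theorem gram_eq {κ : Type} (b : HilbertBasis κ ℂ (L2 (Conf N)))
    (Φ Ψ : L2 (Conf d × Conf N)) : gram b Φ Ψ = gramVec b Φ Ψ := by
  rw [gram, LinearMap.mkContinuous₂_apply, gramLin_apply]

theorem hasSum_mul_prod {ι κ : Type} {f : ι → ℂ} {g : κ → ℂ} {a c : ℂ} (hf : HasSum f a)
    (hg : HasSum g c) : HasSum (fun p : ι × κ => f p.1 * g p.2) (a * c) := by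
  have hs : Summable fun p : ι × κ => f p.1 * g p.2 :=
    summable_mul_of_summable_norm hf.summable.norm hg.summable.norm
  exact hf.mul hg hs

/-- The two basis indices separate, and each is removed by one Parseval sum. The numbering of the
four slots, `⟪gram 1 4, gram 2 3⟫`, is the cyclic order in the trace of the square of the reduced
state. -/
theorem inner_gramVec_tensor {κ : Type} (b : HilbertBasis κ ℂ (L2 (Conf N)))
    (f₁ f₂ f₃ f₄ : L2 (Conf d)) (g₁ g₂ g₃ g₄ : L2 (Conf N)) :
    ⟪gramVec b (tensor f₁ g₁) (tensor f₄ g₄), gramVec b (tensor f₂ g₂) (tensor f₃ g₃)⟫_ℂ =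
      ⟪f₄, f₁⟫_ℂ * ⟪f₂, f₃⟫_ℂ * (⟪g₂, g₁⟫_ℂ * ⟪g₄, g₃⟫_ℂ) := by
  have h1 := b.hasSum_inner_mul_inner g₂ g₁
  have h2 := b.hasSum_inner_mul_inner g₄ g₃
  have h3 := (hasSum_mul_prod h1 h2).mul_left (⟪f₄, f₁⟫_ℂ * ⟪f₂, f₃⟫_ℂ)
  refine (lp.hasSum_inner _ _).unique ?_
  refine (congrArg (HasSum · _ _) (funext fun p => ?_)).mp h3
  simp only [gramVec_apply, partialInner_tensor, inner_smul_left, inner_smul_right,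
    RCLike.inner_apply, map_mul, inner_conj_symm]
  ring

/-! ### The partial trace of a density operator -/

theorem comp_rankOne_comp_adjoint {H K : Type} [NormedAddCommGroup H] [InnerProductSpace ℂ H]
    [CompleteSpace H] [NormedAddCommGroup K] [InnerProductSpace ℂ K] [CompleteSpace K]
    (L : H →L[ℂ] K) (x y : H) :
    L ∘L InnerProductSpace.rankOne ℂ x y ∘L L.adjoint =
      InnerProductSpace.rankOne ℂ (L x) (L y) := by
  ext z
  simp [InnerProductSpace.rankOne_apply, ContinuousLinearMap.adjoint_inner_right]

theorem HasSum.conj_adjoint {H K ι : Type} [NormedAddCommGroup H] [InnerProductSpace ℂ H]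
    [CompleteSpace H] [NormedAddCommGroup K] [InnerProductSpace ℂ K] [CompleteSpace K]
    {W : ι → H} {A : H →L[ℂ] H}
    (hA : HasSum (fun i => InnerProductSpace.rankOne ℂ (W i) (W i)) A) (L : H →L[ℂ] K) :
    HasSum (fun i => InnerProductSpace.rankOne ℂ (L (W i)) (L (W i))) (L ∘L A ∘L L.adjoint) := by
  have h1 := (hA.mapL ((ContinuousLinearMap.compL ℂ K H H).flip L.adjoint)).mapL
    (ContinuousLinearMap.compL ℂ K H K L)
  refine (congrArg (HasSum · _ _) (funext fun i => ?_)).mp h1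
  exact comp_rankOne_comp_adjoint L (W i) (W i)

theorem summable_norm_partialInner_family {κ ι : Type} (b : HilbertBasis κ ℂ (L2 (Conf N)))
    {W : ι → L2 (Conf d × Conf N)} (hW : Summable fun i => ‖W i‖ ^ 2) :
    HasSum (fun p : κ × ι => ‖partialInner (b p.1) (W p.2)‖ ^ 2) (∑' i, ‖W i‖ ^ 2) := by
  have hs : Summable fun p : ι × κ => ‖partialInner (b p.2) (W p.1)‖ ^ 2 := by
    rw [summable_prod_of_nonneg (fun _ => by positivity)]
    refine ⟨fun i => (hasSum_norm_partialInner_sq b (W i)).summable, ?_⟩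
    simpa only [(hasSum_norm_partialInner_sq b (W _)).tsum_eq] using hW
  have h : HasSum (fun p : ι × κ => ‖partialInner (b p.2) (W p.1)‖ ^ 2) (∑' i, ‖W i‖ ^ 2) := by
    convert hs.hasSum using 1
    rw [hs.tsum_prod]
    exact tsum_congr fun i => (hasSum_norm_partialInner_sq b (W i)).tsum_eq.symm
  exact ((Equiv.prodComm κ ι).hasSum_iff
    (f := fun p : ι × κ => ‖partialInner (b p.2) (W p.1)‖ ^ 2)).2 h

/-- Tracing out the environment replaces each `|W⟩⟨W|` by `∑ₖ |Tₖ W⟩⟨Tₖ W|`, where `Tₖ` is the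
partial scalar product with the `k`-th basis vector, so a sum of squares stays a sum of squares. The
squared norms form a summable family with the same total, which makes the partial trace again a
state. -/
theorem hasSum_partialTrace {ι : Type} {W : ι → L2 (Conf d × Conf N)}
    (hW : Summable fun i => ‖W i‖ ^ 2) {A : L2 (Conf d × Conf N) →L[ℂ] L2 (Conf d × Conf N)}
    (hA : HasSum (fun i => InnerProductSpace.rankOne ℂ (W i) (W i)) A) :
    HasSum (fun p : _ × ι => InnerProductSpace.rankOne ℂ
      (partialInner (hilbertBasis (L2 (Conf N)) p.1) (W p.2))
      (partialInner (hilbertBasis (L2 (Conf N)) p.1) (W p.2))) (partialTrace A) := by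
  have hs := (summable_norm_partialInner_family (hilbertBasis (L2 (Conf N))) hW).summable
  have hs' : Summable fun p : _ × ι => InnerProductSpace.rankOne ℂ
      (partialInner (hilbertBasis (L2 (Conf N)) p.1) (W p.2))
      (partialInner (hilbertBasis (L2 (Conf N)) p.1) (W p.2)) := by
    refine Summable.of_norm (hs.congr fun p => ?_)
    rw [InnerProductSpace.norm_rankOne, sq]
  convert hs'.hasSum using 1
  rw [hs'.tsum_prod, partialTrace]
  refine tsum_congr fun k => ?_
  have h1 := HasSum.conj_adjoint hA (partialInner (hilbertBasis (L2 (Conf N)) k))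
  rw [h1.tsum_eq, partialInner, ContinuousLinearMap.adjoint_adjoint]

theorem isDensityOperator_partialTrace {ι : Type} {W : ι → L2 (Conf d × Conf N)}
    (hW : HasSum (fun i => ‖W i‖ ^ 2) 1)
    {A : L2 (Conf d × Conf N) →L[ℂ] L2 (Conf d × Conf N)}
    (hA : HasSum (fun i => InnerProductSpace.rankOne ℂ (W i) (W i)) A) :
    IsDensityOperator (partialTrace A) := by
  have h1 := hasSum_partialTrace hW.summable hA
  have h2 := summable_norm_partialInner_family (hilbertBasis (L2 (Conf N))) hW.summable
  rw [hW.tsum_eq] at h2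
  have h3 := hasSum_inner_of_hasSum_rankOne (hilbertBasis (L2 (Conf d)))
    (h2.summable.congr fun p => by rw [sq]) h1
  have h4 : (1 : ℂ) = ∑' p : _ × ι,
      ⟪partialInner (hilbertBasis (L2 (Conf N)) p.1) (W p.2),
        partialInner (hilbertBasis (L2 (Conf N)) p.1) (W p.2)⟫_ℂ := by
    refine HasSum.tsum_eq ?_ |>.symm
    have := Complex.hasSum_ofReal.2 h2
    simpa [inner_self_eq_norm_sq_to_K] using this
  rw [← h4] at h3
  exact ⟨gram_isPositive h1, h3.summable, h3.tsum_eq⟩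

/-- This is the form of the purity that is differentiated: each summand involves only two vectors
and is the squared Hilbert norm of a bounded bilinear expression in them. -/
theorem opTrace_partialTrace_sq {ι : Type} {W : ι → L2 (Conf d × Conf N)}
    (hW : Summable (fun i => ‖W i‖ ^ 2))
    {A : L2 (Conf d × Conf N) →L[ℂ] L2 (Conf d × Conf N)}
    (hA : HasSum (fun i => InnerProductSpace.rankOne ℂ (W i) (W i)) A) :
    (opTrace (partialTrace A ∘L partialTrace A)).re =
      ∑' p : ι × ι, ‖gramVec (hilbertBasis (L2 (Conf N))) (W p.1) (W p.2)‖ ^ 2 := by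
  have h1 := hasSum_partialTrace hW hA
  have h2 := summable_norm_partialInner_family (hilbertBasis (L2 (Conf N))) hW
  have h3 := gram_trace_sq (hilbertBasis (L2 (Conf d))) h2.summable h1
  rw [opTrace, h3.tsum_eq, ← Complex.ofReal_tsum, Complex.ofReal_re]
  let T := fun (k : (exists_hilbertBasis ℂ (L2 (Conf N))).choose) =>
    partialInner (d := d) (hilbertBasis (L2 (Conf N)) k)
  have hs : Summable fun q : (ι × ι) × (_ × _) => ‖⟪T q.2.1 (W q.1.1), T q.2.2 (W q.1.2)⟫_ℂ‖ ^ 2 := by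
    rw [summable_prod_of_nonneg (fun _ => by positivity)]
    refine ⟨fun i => (summable_gramCoeff (hilbertBasis (L2 (Conf N))) (W i.1) (W i.2)).1, ?_⟩
    refine Summable.of_nonneg_of_le (fun i => tsum_nonneg fun _ => by positivity)
      (fun i => (summable_gramCoeff (hilbertBasis (L2 (Conf N))) (W i.1) (W i.2)).2) ?_
    exact hW.mul_of_nonneg hW (fun _ => by positivity) (fun _ => by positivity)
  -- The trace is summed over pairs of (basis index, vector index); the pairs are regrouped as (two
  -- vector indices, two basis indices), and the inner sum is the norm of a `gramVec`.
  rw [← ((Equiv.prodProdProdComm ι ι _ _).trans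
    (Equiv.prodCongr (Equiv.prodComm ι (exists_hilbertBasis ℂ (L2 (Conf N))).choose)
      (Equiv.prodComm ι (exists_hilbertBasis ℂ (L2 (Conf N))).choose))).tsum_eq]
  refine (hs.tsum_prod).trans (tsum_congr fun i => ?_)
  exact (hasSum_norm_gramVec_sq (hilbertBasis (L2 (Conf N))) (W i.1) (W i.2)).tsum_eq

end Tensor

/-! ### Second derivatives of series of squared norms -/

section Calculus

variable {E K : Type} [NormedAddCommGroup E] [NormedSpace ℝ E] [NormedAddCommGroup K]
  [InnerProductSpace ℂ K] [NormedSpace ℝ K]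

omit [InnerProductSpace ℂ K] in
theorem hasDerivAt_bilinear (B : E →L[ℝ] E →L[ℝ] K) {x y : ℝ → E} {x' y' : E} {t : ℝ}
    (hx : HasDerivAt x x' t) (hy : HasDerivAt y y' t) :
    HasDerivAt (fun s => B (x s) (y s)) (B x' (y t) + B (x t) y') t := by
  rw [add_comm]
  exact B.hasDerivAt_of_bilinear (fun _ => hx) (fun _ => hy)

theorem hasDerivAt_re_inner {F G : ℝ → K} {F' G' : K} {t : ℝ} (hF : HasDerivAt F F' t)
    (hG : HasDerivAt G G' t) :
    HasDerivAt (fun s => (⟪F s, G s⟫_ℂ).re) ((⟪F', G t⟫_ℂ).re + (⟪F t, G'⟫_ℂ).re) t := by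
  have h := (HasDerivAt.inner ℂ hF hG)
  have h2 : HasDerivAt (fun s => (⟪F s, G s⟫_ℂ).re) (⟪F t, G'⟫_ℂ + ⟪F', G t⟫_ℂ).re t :=
    Complex.reCLM.hasFDerivAt.comp_hasDerivAt t h
  rwa [Complex.add_re, add_comm] at h2

/-- The first derivative of `‖B (x, y)‖²` along a curve. -/
def normSqDeriv (B : E →L[ℝ] E →L[ℝ] K) (x y x' y' : E) : ℝ :=
  2 * (⟪B x y, B x' y + B x y'⟫_ℂ).re

/-- The second derivative of `‖B (x, y)‖²` along a curve. -/
def normSqDeriv₂ (B : E →L[ℝ] E →L[ℝ] K) (x y x' y' x'' y'' : E) : ℝ :=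
  2 * ((⟪B x' y + B x y', B x' y + B x y'⟫_ℂ).re +
    (⟪B x y, (B x'' y + B x' y') + (B x' y' + B x y'')⟫_ℂ).re)

theorem hasDerivAt_norm_sq_bilinear (B : E →L[ℝ] E →L[ℝ] K) {x y : ℝ → E} {x' y' : E} {t : ℝ}
    (hx : HasDerivAt x x' t) (hy : HasDerivAt y y' t) :
    HasDerivAt (fun s => ‖B (x s) (y s)‖ ^ 2) (normSqDeriv B (x t) (y t) x' y') t := by
  have hB := hasDerivAt_bilinear B hx hy
  have h := hasDerivAt_re_inner hB hB
  have e : (fun s => ‖B (x s) (y s)‖ ^ 2) =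
      fun s => (⟪B (x s) (y s), B (x s) (y s)⟫_ℂ).re := by
    ext s
    exact (inner_self_eq_norm_sq (𝕜 := ℂ) (B (x s) (y s))).symm
  rw [e]
  refine h.congr_deriv ?_
  rw [normSqDeriv, two_mul]
  congr 1
  exact inner_re_symm (𝕜 := ℂ) _ _

theorem hasDerivAt_normSqDeriv (B : E →L[ℝ] E →L[ℝ] K) {x y x' y' : ℝ → E} {x'' y'' : E} {t : ℝ}
    (hx : HasDerivAt x (x' t) t) (hy : HasDerivAt y (y' t) t)
    (hx' : HasDerivAt x' x'' t) (hy' : HasDerivAt y' y'' t) :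
    HasDerivAt (fun s => normSqDeriv B (x s) (y s) (x' s) (y' s))
      (normSqDeriv₂ B (x t) (y t) (x' t) (y' t) x'' y'') t := by
  exact (hasDerivAt_re_inner (hasDerivAt_bilinear B hx hy)
    ((hasDerivAt_bilinear B hx' hy).add (hasDerivAt_bilinear B hx hy'))).const_mul 2

omit [NormedSpace ℝ K] in
theorem abs_re_inner_le {u v : K} {r s : ℝ} (hu : ‖u‖ ≤ r) (hv : ‖v‖ ≤ s) :
    |(⟪u, v⟫_ℂ).re| ≤ r * s :=
  (Complex.abs_re_le_norm _).trans ((norm_inner_le_norm u v).trans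
    (mul_le_mul hu hv (norm_nonneg _) ((norm_nonneg _).trans hu)))

/-- The constant is `2 · 2`: the factor in front times two terms of size `m n`. -/
theorem abs_normSqDeriv_le {B : E →L[ℝ] E →L[ℝ] K} (hB : ∀ x y, ‖B x y‖ ≤ ‖x‖ * ‖y‖)
    {x y x' y' : E} {m n : ℝ} (hx : ‖x‖ ≤ m) (hx' : ‖x'‖ ≤ m) (hy : ‖y‖ ≤ n) (hy' : ‖y'‖ ≤ n) :
    |normSqDeriv B x y x' y'| ≤ 4 * (m ^ 2 * n ^ 2) := by
  have h : ∀ {u v : E}, ‖u‖ ≤ m → ‖v‖ ≤ n → ‖B u v‖ ≤ m * n := fun {u v} hu hv =>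
    (hB u v).trans (mul_le_mul hu hv (norm_nonneg _) ((norm_nonneg _).trans hu))
  have h1 := abs_re_inner_le (h hx hy) ((norm_add_le _ _).trans (add_le_add (h hx' hy) (h hx hy')))
  rw [normSqDeriv, abs_mul, abs_two]
  linarith

/-- The constant is `2 · (2 · 2 + 4)`: the square of a sum of two terms, plus one factor against a
sum of four terms, each of size `m n`. -/
theorem abs_normSqDeriv₂_le {B : E →L[ℝ] E →L[ℝ] K} (hB : ∀ x y, ‖B x y‖ ≤ ‖x‖ * ‖y‖)
    {x y x' y' x'' y'' : E} {m n : ℝ} (hx : ‖x‖ ≤ m) (hx' : ‖x'‖ ≤ m) (hx'' : ‖x''‖ ≤ m)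
    (hy : ‖y‖ ≤ n) (hy' : ‖y'‖ ≤ n) (hy'' : ‖y''‖ ≤ n) :
    |normSqDeriv₂ B x y x' y' x'' y''| ≤ 16 * (m ^ 2 * n ^ 2) := by
  have h : ∀ {u v : E}, ‖u‖ ≤ m → ‖v‖ ≤ n → ‖B u v‖ ≤ m * n := fun {u v} hu hv =>
    (hB u v).trans (mul_le_mul hu hv (norm_nonneg _) ((norm_nonneg _).trans hu))
  have h1 := (norm_add_le _ _).trans (add_le_add (h hx' hy) (h hx hy'))
  have h2 := abs_re_inner_le h1 h1
  have h3 := abs_re_inner_le (h hx hy) ((norm_add_le _ _).trans (add_le_add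
    ((norm_add_le _ _).trans (add_le_add (h hx'' hy) (h hx' hy')))
    ((norm_add_le _ _).trans (add_le_add (h hx' hy') (h hx hy'')))))
  rw [normSqDeriv₂, abs_mul, abs_two]
  have h4 := abs_add_le (⟪B x' y + B x y', B x' y + B x y'⟫_ℂ).re
    (⟪B x y, (B x'' y + B x' y') + (B x' y' + B x y'')⟫_ℂ).re
  linarith

/-- A single square summable sequence `n` dominates the vectors and their first two derivatives
uniformly in time. Hence `n p.1 ^ 2 * n p.2 ^ 2` majorizes the double series and its first two
derived series, up to constants. -/
theorem contDiff_two_tsum_norm_sq {ι : Type} {B : E →L[ℝ] E →L[ℝ] K}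
    (hB : ∀ x y, ‖B x y‖ ≤ ‖x‖ * ‖y‖) {x x' x'' : ι → ℝ → E} {n : ι → ℝ}
    (hn : Summable fun i => n i ^ 2)
    (hx : ∀ i t, HasDerivAt (x i) (x' i t) t) (hx' : ∀ i t, HasDerivAt (x' i) (x'' i t) t)
    (hx'' : ∀ i, Continuous (x'' i))
    (hxn : ∀ i t, ‖x i t‖ ≤ n i) (hxn' : ∀ i t, ‖x' i t‖ ≤ n i) (hxn'' : ∀ i t, ‖x'' i t‖ ≤ n i) :
    ContDiff ℝ 2 (fun t => ∑' p : ι × ι, ‖B (x p.1 t) (x p.2 t)‖ ^ 2) ∧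
    iteratedDeriv 2 (fun t => ∑' p : ι × ι, ‖B (x p.1 t) (x p.2 t)‖ ^ 2) 0 =
      ∑' p : ι × ι, normSqDeriv₂ B (x p.1 0) (x p.2 0) (x' p.1 0) (x' p.2 0)
        (x'' p.1 0) (x'' p.2 0) := by
  have hs : Summable fun p : ι × ι => n p.1 ^ 2 * n p.2 ^ 2 :=
    hn.mul_of_nonneg hn (fun _ => by positivity) (fun _ => by positivity)
  have hd : ∀ t, HasDerivAt (fun t => ∑' p : ι × ι, ‖B (x p.1 t) (x p.2 t)‖ ^ 2)
      (∑' p : ι × ι, normSqDeriv B (x p.1 t) (x p.2 t) (x' p.1 t) (x' p.2 t)) t := fun t => by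
    refine hasDerivAt_tsum (hs.mul_left 4)
      (fun p t => hasDerivAt_norm_sq_bilinear B (hx p.1 t) (hx p.2 t))
      (fun p t => abs_normSqDeriv_le hB (hxn _ _) (hxn' _ _) (hxn _ _) (hxn' _ _)) (y₀ := 0) ?_ t
    refine Summable.of_nonneg_of_le (fun _ => by positivity) (fun p => ?_) hs
    rw [← mul_pow]
    exact pow_le_pow_left₀ (norm_nonneg _) ((hB _ _).trans
      (mul_le_mul (hxn _ _) (hxn _ _) (norm_nonneg _) ((norm_nonneg _).trans (hxn p.1 0)))) 2
  have hd' : ∀ t, HasDerivAt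
      (fun t => ∑' p : ι × ι, normSqDeriv B (x p.1 t) (x p.2 t) (x' p.1 t) (x' p.2 t))
      (∑' p : ι × ι, normSqDeriv₂ B (x p.1 t) (x p.2 t) (x' p.1 t) (x' p.2 t)
        (x'' p.1 t) (x'' p.2 t)) t := fun t => by
    refine hasDerivAt_tsum (hs.mul_left 16)
      (fun p t => hasDerivAt_normSqDeriv B (hx p.1 t) (hx p.2 t) (hx' p.1 t) (hx' p.2 t))
      (fun p t => abs_normSqDeriv₂_le hB (hxn _ _) (hxn' _ _) (hxn'' _ _) (hxn _ _) (hxn' _ _)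
        (hxn'' _ _)) (y₀ := 0) ?_ t
    refine Summable.of_norm_bounded (hs.mul_left 4) fun p => ?_
    exact abs_normSqDeriv_le hB (hxn _ _) (hxn' _ _) (hxn _ _) (hxn' _ _)
  have hc : Continuous fun t => ∑' p : ι × ι, normSqDeriv₂ B (x p.1 t) (x p.2 t) (x' p.1 t)
      (x' p.2 t) (x'' p.1 t) (x'' p.2 t) := by
    refine continuous_tsum (fun p => ?_) (hs.mul_left 16) (fun p t => abs_normSqDeriv₂_le hB
      (hxn _ _) (hxn' _ _) (hxn'' _ _) (hxn _ _) (hxn' _ _) (hxn'' _ _))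
    have hcx : ∀ i, Continuous (x i) := fun i =>
      continuous_iff_continuousAt.2 fun t => (hx i t).continuousAt
    have hcx' : ∀ i, Continuous (x' i) := fun i =>
      continuous_iff_continuousAt.2 fun t => (hx' i t).continuousAt
    have hBc : ∀ {u v : ℝ → E}, Continuous u → Continuous v → Continuous fun t => B (u t) (v t) :=
      fun hu hv => (B.continuous.comp hu).clm_apply hv
    unfold normSqDeriv₂
    refine continuous_const.mul ((Complex.continuous_re.comp ?_).add (Complex.continuous_re.comp ?_))
    · exact ((hBc (hcx' _) (hcx _)).add (hBc (hcx _) (hcx' _))).inner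
        ((hBc (hcx' _) (hcx _)).add (hBc (hcx _) (hcx' _)))
    · exact (hBc (hcx _) (hcx _)).inner
        (((hBc (hx'' _) (hcx _)).add (hBc (hcx' _) (hcx' _))).add
          ((hBc (hcx' _) (hcx' _)).add (hBc (hcx _) (hx'' _))))
  have e1 := funext fun t => (hd t).deriv
  have e2 := funext fun t => (hd' t).deriv
  constructor
  · rw [show (2 : WithTop ℕ∞) = 1 + 1 by norm_num, contDiff_succ_iff_deriv]
    refine ⟨fun t => (hd t).differentiableAt, by simp, ?_⟩
    rw [e1, contDiff_one_iff_deriv]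
    refine ⟨fun t => (hd' t).differentiableAt, ?_⟩
    rwa [e2]
  · rw [iteratedDeriv_succ, iteratedDeriv_one, e1, e2]

end Calculus

/-! ### The propagator on Schwartz functions -/

section Propagator

variable {d N : ℕ} {H : 𝓢(Conf d × Conf N, ℂ) →L[ℂ] 𝓢(Conf d × Conf N, ℂ)}
  {U : ℝ → L2 (Conf d × Conf N) →L[ℂ] L2 (Conf d × Conf N)}

theorem IsPropagator.norm_apply (hU : IsPropagator H U) (t : ℝ) (f : L2 (Conf d × Conf N)) :
    ‖U t f‖ = ‖f‖ := by
  have h := (Unitary.mem_iff.1 (hU.unitary t)).1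
  rw [← pow_left_inj₀ (norm_nonneg _) (norm_nonneg _) two_ne_zero]
  have h1 := ContinuousLinearMap.apply_norm_sq_eq_inner_adjoint_left (U t) f
  have h2 : (U t).adjoint ∘L U t = 1 := h
  rw [h1, h2, one_apply_eq_self]
  exact inner_self_eq_norm_sq (𝕜 := ℂ) f

/-- The group law `U s = U t * U (s - t)` transports the Schrödinger equation from time zero. The
derivative is again the orbit of a Schwartz vector, so the lemma can be iterated. -/
theorem IsPropagator.hasDerivAt_apply (hU : IsPropagator H U) (φ : 𝓢(Conf d × Conf N, ℂ))
    (t : ℝ) : HasDerivAt (fun t => U t (φ.toLp 2 volume))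
      (U t ((((-I) • H) φ).toLp 2 volume)) t := by
  have h0 := hU.hasDerivAt φ
  have h1 : HasDerivAt (fun s => U (s - t) (φ.toLp 2 volume)) ((-I) • (H φ).toLp 2 volume) t := by
    have := HasDerivAt.comp_sub_const (x := t) (a := t) (f := fun t => U t (φ.toLp 2 volume))
      (f' := (-I) • (H φ).toLp 2 volume) (by rw [sub_self]; exact h0)
    exact this
  have h2 := ((U t).restrictScalars ℝ).hasFDerivAt.comp_hasDerivAt t h1
  have e : (fun s => U s (φ.toLp 2 volume)) =
      fun s => ((U t).restrictScalars ℝ) (U (s - t) (φ.toLp 2 volume)) := by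
    ext1 s
    change _ = (U t * U (s - t)) _
    rw [← hU.add, add_sub_cancel]
  rw [e]
  exact h2

end Propagator

/-! ### The second derivative at time zero on product vectors -/

section TensorCurve

variable {d N : ℕ} {κ : Type}

theorem gramVec_sum_left (b : HilbertBasis κ ℂ (L2 (Conf N))) {Θ : Type} (s : Finset Θ)
    (Φ : Θ → L2 (Conf d × Conf N)) (Ψ : L2 (Conf d × Conf N)) :
    gramVec b (∑ θ ∈ s, Φ θ) Ψ = ∑ θ ∈ s, gramVec b (Φ θ) Ψ := by
  simp only [← gram_eq, map_sum, sum_apply]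

theorem gramVec_sum_right (b : HilbertBasis κ ℂ (L2 (Conf N))) {Θ : Type} (s : Finset Θ)
    (Φ : L2 (Conf d × Conf N)) (Ψ : Θ → L2 (Conf d × Conf N)) :
    gramVec b Φ (∑ θ ∈ s, Ψ θ) = ∑ θ ∈ s, gramVec b Φ (Ψ θ) := by
  simp only [← gram_eq, map_sum]

theorem gramVec_smul_left (b : HilbertBasis κ ℂ (L2 (Conf N))) (c : ℂ)
    (Φ Ψ : L2 (Conf d × Conf N)) :
    gramVec b (c • Φ) Ψ = (starRingEnd ℂ) c • gramVec b Φ Ψ := by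
  ext p
  rw [lp.coeFn_smul, Pi.smul_apply]
  simp only [gramVec_apply, map_smul, inner_smul_left, smul_eq_mul]

theorem gramVec_smul_right (b : HilbertBasis κ ℂ (L2 (Conf N))) (c : ℂ)
    (Φ Ψ : L2 (Conf d × Conf N)) : gramVec b Φ (c • Ψ) = c • gramVec b Φ Ψ := by
  ext p
  rw [lp.coeFn_smul, Pi.smul_apply]
  simp only [gramVec_apply, map_smul, inner_smul_right, smul_eq_mul]

/-- The complex number of which `normSqDeriv₂` is twice the real part, for `B = gram`. -/
def gramDeriv₂ (b : HilbertBasis κ ℂ (L2 (Conf N)))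
    (x y x' y' x'' y'' : L2 (Conf d × Conf N)) : ℂ :=
  ⟪gramVec b x' y, gramVec b x' y⟫_ℂ + ⟪gramVec b x' y, gramVec b x y'⟫_ℂ +
    ⟪gramVec b x y', gramVec b x' y⟫_ℂ + ⟪gramVec b x y', gramVec b x y'⟫_ℂ +
    ⟪gramVec b x y, gramVec b x'' y⟫_ℂ + 2 * ⟪gramVec b x y, gramVec b x' y'⟫_ℂ +
    ⟪gramVec b x y, gramVec b x y''⟫_ℂ

theorem normSqDeriv₂_gram (b : HilbertBasis κ ℂ (L2 (Conf N)))
    (x y x' y' x'' y'' : L2 (Conf d × Conf N)) :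
    normSqDeriv₂ (gram b) x y x' y' x'' y'' = 2 * (gramDeriv₂ b x y x' y' x'' y'').re := by
  rw [normSqDeriv₂, ← Complex.add_re, gramDeriv₂]
  simp only [gram_eq, inner_add_left, inner_add_right]
  congr 2
  ring

variable {Θ : Type} [Fintype Θ]

/-- Here and in the following lemmas the name lists the slots, numbered as in
`inner_gramVec_tensor`, that carry a derivative; the other slots carry `tensor ψ _`. -/
theorem inner_gramVec_one_two (b : HilbertBasis κ ℂ (L2 (Conf N))) (ψ : L2 (Conf d))
    (s₁ s₂ : Θ → L2 (Conf d)) (e₁ e₂ : Θ → L2 (Conf N)) (g : L2 (Conf N)) (c₁ c₂ : ℂ) :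
    ⟪gramVec b (c₁ • ∑ θ, tensor (s₁ θ) (e₁ θ)) (tensor ψ g),
      gramVec b (c₂ • ∑ θ, tensor (s₂ θ) (e₂ θ)) (tensor ψ g)⟫_ℂ =
    ∑ θ, ∑ θ', c₁ * (starRingEnd ℂ) c₂ * (⟪ψ, s₁ θ⟫_ℂ * ⟪s₂ θ', ψ⟫_ℂ *
      (⟪e₂ θ', e₁ θ⟫_ℂ * ⟪g, g⟫_ℂ)) := by
  simp only [gramVec_smul_left, gramVec_sum_left, inner_smul_left, inner_smul_right, sum_inner,
    inner_sum, inner_gramVec_tensor, Complex.conj_conj, Finset.mul_sum]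
  rw [Finset.sum_comm]
  refine Finset.sum_congr rfl fun θ _ => Finset.sum_congr rfl fun θ' _ => ?_
  ring

theorem inner_gramVec_one_three (b : HilbertBasis κ ℂ (L2 (Conf N))) (ψ : L2 (Conf d))
    (s₁ s₂ : Θ → L2 (Conf d)) (e₁ e₂ : Θ → L2 (Conf N)) (g g' : L2 (Conf N)) (c₁ c₂ : ℂ) :
    ⟪gramVec b (c₁ • ∑ θ, tensor (s₁ θ) (e₁ θ)) (tensor ψ g'),
      gramVec b (tensor ψ g) (c₂ • ∑ θ, tensor (s₂ θ) (e₂ θ))⟫_ℂ =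
    ∑ θ, ∑ θ', c₁ * c₂ * (⟪ψ, s₁ θ⟫_ℂ * ⟪ψ, s₂ θ'⟫_ℂ *
      (⟪g, e₁ θ⟫_ℂ * ⟪g', e₂ θ'⟫_ℂ)) := by
  simp only [gramVec_smul_left, gramVec_sum_left, gramVec_smul_right, gramVec_sum_right,
    inner_smul_left, inner_smul_right, sum_inner,
    inner_sum, inner_gramVec_tensor, Complex.conj_conj, Finset.mul_sum]
  rw [Finset.sum_comm]
  refine Finset.sum_congr rfl fun θ _ => Finset.sum_congr rfl fun θ' _ => ?_
  ring

theorem inner_gramVec_four_three (b : HilbertBasis κ ℂ (L2 (Conf N))) (ψ : L2 (Conf d))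
    (s₁ s₂ : Θ → L2 (Conf d)) (e₁ e₂ : Θ → L2 (Conf N)) (g : L2 (Conf N)) (c₁ c₂ : ℂ) :
    ⟪gramVec b (tensor ψ g) (c₁ • ∑ θ, tensor (s₁ θ) (e₁ θ)),
      gramVec b (tensor ψ g) (c₂ • ∑ θ, tensor (s₂ θ) (e₂ θ))⟫_ℂ =
    ∑ θ, ∑ θ', (starRingEnd ℂ) c₁ * c₂ * (⟪s₁ θ, ψ⟫_ℂ * ⟪ψ, s₂ θ'⟫_ℂ *
      (⟪g, g⟫_ℂ * ⟪e₁ θ, e₂ θ'⟫_ℂ)) := by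
  simp only [gramVec_smul_right, gramVec_sum_right, inner_smul_left, inner_smul_right, sum_inner,
    inner_sum, inner_gramVec_tensor, Finset.mul_sum]
  rw [Finset.sum_comm]
  refine Finset.sum_congr rfl fun θ _ => Finset.sum_congr rfl fun θ' _ => ?_
  ring

theorem inner_gramVec_four_two (b : HilbertBasis κ ℂ (L2 (Conf N))) (ψ : L2 (Conf d))
    (s₁ s₂ : Θ → L2 (Conf d)) (e₁ e₂ : Θ → L2 (Conf N)) (g g' : L2 (Conf N)) (c₁ c₂ : ℂ) :
    ⟪gramVec b (tensor ψ g) (c₁ • ∑ θ, tensor (s₁ θ) (e₁ θ)),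
      gramVec b (c₂ • ∑ θ, tensor (s₂ θ) (e₂ θ)) (tensor ψ g')⟫_ℂ =
    ∑ θ, ∑ θ', (starRingEnd ℂ) c₁ * (starRingEnd ℂ) c₂ * (⟪s₁ θ, ψ⟫_ℂ * ⟪s₂ θ', ψ⟫_ℂ *
      (⟪e₂ θ', g⟫_ℂ * ⟪e₁ θ, g'⟫_ℂ)) := by
  simp only [gramVec_smul_left, gramVec_sum_left, gramVec_smul_right, gramVec_sum_right,
    inner_smul_left, inner_smul_right, sum_inner,
    inner_sum, inner_gramVec_tensor, Finset.mul_sum]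
  rw [Finset.sum_comm]
  refine Finset.sum_congr rfl fun θ _ => Finset.sum_congr rfl fun θ' _ => ?_
  ring

theorem inner_gramVec_two_three (b : HilbertBasis κ ℂ (L2 (Conf N))) (ψ : L2 (Conf d))
    (s₁ s₂ : Θ → L2 (Conf d)) (e₁ e₂ : Θ → L2 (Conf N)) (g g' : L2 (Conf N)) (c₁ c₂ : ℂ) :
    ⟪gramVec b (tensor ψ g) (tensor ψ g'),
      gramVec b (c₁ • ∑ θ, tensor (s₁ θ) (e₁ θ)) (c₂ • ∑ θ, tensor (s₂ θ) (e₂ θ))⟫_ℂ =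
    ∑ θ, ∑ θ', (starRingEnd ℂ) c₁ * c₂ * (⟪ψ, ψ⟫_ℂ * ⟪s₁ θ, s₂ θ'⟫_ℂ *
      (⟪e₁ θ, g⟫_ℂ * ⟪g', e₂ θ'⟫_ℂ)) := by
  simp only [gramVec_smul_left, gramVec_sum_left, gramVec_smul_right, gramVec_sum_right,
    inner_smul_right, inner_sum, inner_gramVec_tensor, Finset.mul_sum]
  rw [Finset.sum_comm]
  refine Finset.sum_congr rfl fun θ _ => Finset.sum_congr rfl fun θ' _ => ?_
  ring

theorem inner_gramVec_two (b : HilbertBasis κ ℂ (L2 (Conf N))) (ψ : L2 (Conf d))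
    (s : Θ → Θ → L2 (Conf d)) (e : Θ → Θ → L2 (Conf N)) (g g' : L2 (Conf N)) :
    ⟪gramVec b (tensor ψ g) (tensor ψ g'),
      gramVec b ((-1 : ℂ) • ∑ θ, ∑ θ', tensor (s θ θ') (e θ θ')) (tensor ψ g')⟫_ℂ =
    ∑ θ, ∑ θ', -(⟪ψ, ψ⟫_ℂ * ⟪s θ θ', ψ⟫_ℂ * (⟪e θ θ', g⟫_ℂ * ⟪g', g'⟫_ℂ)) := by
  simp only [gramVec_smul_left, gramVec_sum_left, inner_smul_right,
    inner_sum, inner_gramVec_tensor, Finset.mul_sum, map_neg, map_one, neg_one_mul]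

theorem inner_gramVec_three (b : HilbertBasis κ ℂ (L2 (Conf N))) (ψ : L2 (Conf d))
    (s : Θ → Θ → L2 (Conf d)) (e : Θ → Θ → L2 (Conf N)) (g g' : L2 (Conf N)) :
    ⟪gramVec b (tensor ψ g) (tensor ψ g'),
      gramVec b (tensor ψ g) ((-1 : ℂ) • ∑ θ, ∑ θ', tensor (s θ θ') (e θ θ'))⟫_ℂ =
    ∑ θ, ∑ θ', -(⟪ψ, ψ⟫_ℂ * ⟪ψ, s θ θ'⟫_ℂ * (⟪g, g⟫_ℂ * ⟪g', e θ θ'⟫_ℂ)) := by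
  simp only [gramVec_smul_right, gramVec_sum_right, inner_smul_right,
    inner_sum, inner_gramVec_tensor, Finset.mul_sum, neg_one_mul]

theorem hasSum_sum_sum_mul {ι : Type} {c : Θ → Θ → ℂ} {P R : Θ → Θ → ι → ℂ} {p r : Θ → Θ → ℂ}
    (hP : ∀ θ θ', HasSum (P θ θ') (p θ θ')) (hR : ∀ θ θ', HasSum (R θ θ') (r θ θ')) :
    HasSum (fun q : ι × ι => ∑ θ, ∑ θ', c θ θ' * (P θ θ' q.1 * R θ θ' q.2))
      (∑ θ, ∑ θ', c θ θ' * (p θ θ' * r θ θ')) :=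
  hasSum_sum fun θ _ => hasSum_sum fun θ' _ =>
    (hasSum_mul_prod (hP θ θ') (hR θ θ')).mul_left (c θ θ')

/-- The hypotheses encode symmetric operators: `σ`, `ε` are expectations of `S_θ`, `E_θ`, and `σ₂`,
`ε₂` those of the products `S_θ S_θ'`, `E_θ E_θ'`. Every inner product factors into a system part
and two environment parts, one for each of `i` and `j`, so the double series splits into products of
single ones. -/
theorem hasSum_normSqDeriv₂_tensor {ι : Type} (b : HilbertBasis κ ℂ (L2 (Conf N)))
    {ψ : L2 (Conf d)} {s : Θ → L2 (Conf d)} {s₂ : Θ → Θ → L2 (Conf d)}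
    {g : ι → L2 (Conf N)} {e : ι → Θ → L2 (Conf N)} {e₂ : ι → Θ → Θ → L2 (Conf N)}
    {σ ε : Θ → ℂ} {σ₂ ε₂ : Θ → Θ → ℂ}
    (hψ : ⟪ψ, ψ⟫_ℂ = 1) (hσ : ∀ θ, ⟪ψ, s θ⟫_ℂ = σ θ) (hσ' : ∀ θ, ⟪s θ, ψ⟫_ℂ = σ θ)
    (hσ₂ : ∀ θ θ', ⟪s θ, s θ'⟫_ℂ = σ₂ θ θ') (hs₂ : ∀ θ θ', ⟪ψ, s₂ θ θ'⟫_ℂ = σ₂ θ θ')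
    (hs₂' : ∀ θ θ', ⟪s₂ θ θ', ψ⟫_ℂ = σ₂ θ' θ)
    (hg : HasSum (fun i => ⟪g i, g i⟫_ℂ) 1)
    (hε : ∀ θ, HasSum (fun i => ⟪g i, e i θ⟫_ℂ) (ε θ))
    (hε' : ∀ θ, HasSum (fun i => ⟪e i θ, g i⟫_ℂ) (ε θ))
    (hε₂ : ∀ θ θ', HasSum (fun i => ⟪e i θ, e i θ'⟫_ℂ) (ε₂ θ θ'))
    (he₂ : ∀ θ θ', HasSum (fun i => ⟪g i, e₂ i θ θ'⟫_ℂ) (ε₂ θ θ'))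
    (he₂' : ∀ θ θ', HasSum (fun i => ⟪e₂ i θ θ', g i⟫_ℂ) (ε₂ θ' θ))
    {x x' x'' : ι → L2 (Conf d × Conf N)} (hx : ∀ i, x i = tensor ψ (g i))
    (hx' : ∀ i, x' i = (-I) • ∑ θ, tensor (s θ) (e i θ))
    (hx'' : ∀ i, x'' i = (-1 : ℂ) • ∑ θ, ∑ θ', tensor (s₂ θ θ') (e₂ i θ θ')) :
    HasSum (fun p : ι × ι => normSqDeriv₂ (gram b) (x p.1) (x p.2) (x' p.1) (x' p.2)
        (x'' p.1) (x'' p.2))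
      (-4 * (∑ θ, ∑ θ', (σ₂ θ θ' - σ θ * σ θ') * (ε₂ θ θ' - ε θ * ε θ')).re) := by
  -- The families `A1` to `A4` come from the squared norm of the first derivative, `B1` and `B4`
  -- from the second derivative of a single vector, and `B2` from differentiating both vectors once.
  -- Up to exchanging `θ` and `θ'` they add up to `-2 (σ₂ - σ σ)(ε₂ - ε ε)`.
  have A1 := hasSum_sum_sum_mul (c := fun θ θ' => σ θ * σ θ') (fun θ θ' => hε₂ θ' θ) (fun _ _ => hg)
  have A2 := hasSum_sum_sum_mul (c := fun θ θ' => -(σ θ * σ θ')) (fun θ _ => hε θ)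
    (fun _ θ' => hε θ')
  have A3 := hasSum_sum_sum_mul (c := fun θ θ' => -(σ θ * σ θ')) (fun _ θ' => hε' θ')
    (fun θ _ => hε' θ)
  have A4 := hasSum_sum_sum_mul (c := fun θ θ' => σ θ * σ θ') (fun _ _ => hg) hε₂
  have B1 := hasSum_sum_sum_mul (c := fun θ θ' => -σ₂ θ' θ) he₂' (fun _ _ => hg)
  have B2 := hasSum_sum_sum_mul (c := σ₂) (fun θ _ => hε' θ) (fun _ θ' => hε θ')
  have B4 := hasSum_sum_sum_mul (c := fun θ θ' => -σ₂ θ θ') (fun _ _ => hg) he₂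
  have S := ((((((A1.add A2).add A3).add A4).add B1).add (B2.mul_left 2)).add B4).mapL Complex.reCLM
  have S2 := S.mul_left 2
  refine (congrArg₂ (HasSum · · _) (funext fun p => ?_) ?_).mp S2
  · symm
    rw [normSqDeriv₂_gram, gramDeriv₂]
    simp only [hx, hx', hx'', inner_gramVec_one_two, inner_gramVec_one_three,
      inner_gramVec_four_two, inner_gramVec_four_three, inner_gramVec_two_three,
      inner_gramVec_two, inner_gramVec_three, hψ, hσ, hσ', hσ₂, hs₂, hs₂', map_neg,
      Complex.conj_I, neg_neg, neg_mul, mul_neg, Complex.I_mul_I, one_mul, Complex.reCLM_apply]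
  · symm
    rw [Complex.reCLM_apply, show (-4 : ℝ) = 2 * (-2) by norm_num, mul_assoc]
    congr 1
    rw [show (-2 : ℝ) = ((-2 : ℂ)).re by simp, ← Complex.re_ofReal_mul]
    congr 1
    -- In `A1` and `B1` the operators occur in the reverse order; exchanging the two summation
    -- indices restores it.
    have c1 : ∑ θ, ∑ θ', (fun θ θ' => σ θ * σ θ') θ θ' * (ε₂ θ' θ * 1) =
        ∑ θ, ∑ θ', σ θ * σ θ' * ε₂ θ θ' := by
      rw [Finset.sum_comm]
      refine Finset.sum_congr rfl fun θ _ => Finset.sum_congr rfl fun θ' _ => ?_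
      ring
    have c2 : ∑ θ, ∑ θ', (fun θ θ' => -σ₂ θ' θ) θ θ' * (ε₂ θ' θ * 1) =
        ∑ θ, ∑ θ', -(σ₂ θ θ' * ε₂ θ θ') := by
      rw [Finset.sum_comm]
      refine Finset.sum_congr rfl fun θ _ => Finset.sum_congr rfl fun θ' _ => ?_
      ring
    rw [c1, c2]
    simp only [Finset.mul_sum, ← Finset.sum_add_distrib]
    refine Finset.sum_congr rfl fun θ _ => Finset.sum_congr rfl fun θ' _ => ?_
    simp
    ring

end TensorCurve

/-! ### Schwartz functions from families closed under differentiation -/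

section Family

variable {A W E ι : Type} [NormedAddCommGroup W] [NormedSpace ℝ W] [NormedAddCommGroup E]
  [NormedSpace ℝ E] [Fintype ι]

theorem fderiv_family {f : A → W → E} {l : ι → W →L[ℝ] ℝ} {D : ι → A → A}
    (hD : ∀ a x, HasFDerivAt (f a) (∑ i, (l i).smulRight (f (D i a) x)) x) (a : A) :
    fderiv ℝ (f a) = fun x => ∑ i, (ContinuousLinearMap.smulRightL ℝ W E (l i) ∘ f (D i a)) x :=
  funext fun x => (hD a x).fderiv

theorem contDiff_family {f : A → W → E} {l : ι → W →L[ℝ] ℝ} {D : ι → A → A}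
    (hD : ∀ a x, HasFDerivAt (f a) (∑ i, (l i).smulRight (f (D i a) x)) x) (n : ℕ) (a : A) :
    ContDiff ℝ n (f a) := by
  induction n generalizing a with
  | zero => exact contDiff_zero.2 (continuous_iff_continuousAt.2 fun x => (hD a x).continuousAt)
  | succ n ih =>
    push_cast
    rw [contDiff_succ_iff_fderiv]
    refine ⟨fun x => (hD a x).differentiableAt, by simp, ?_⟩
    rw [fderiv_family hD]
    exact ContDiff.sum fun i _ => (ContinuousLinearMap.contDiff _).comp (ih _)

/-- A family of rapidly decreasing functions which is closed under differentiation consists of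
Schwartz functions. -/
theorem exists_schwartzMap_family {f : A → W → E} {l : ι → W →L[ℝ] ℝ} {D : ι → A → A}
    (hD : ∀ a x, HasFDerivAt (f a) (∑ i, (l i).smulRight (f (D i a) x)) x)
    (hb : ∀ a k, ∃ C, ∀ x, ‖x‖ ^ k * ‖f a x‖ ≤ C) (a : A) :
    ∃ φ : 𝓢(W, E), ∀ x, φ x = f a x := by
  have h : ∀ k n a, ∃ C, ∀ x, ‖x‖ ^ k * ‖iteratedFDeriv ℝ n (f a) x‖ ≤ C := by
    intro k n
    induction n with
    | zero => simpa only [norm_iteratedFDeriv_zero] using fun a => hb a k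
    | succ n ih =>
      intro a
      choose C hC using ih
      refine ⟨∑ i, ‖ContinuousLinearMap.smulRightL ℝ W E (l i)‖ * C (D i a), fun x => ?_⟩
      rw [← norm_iteratedFDeriv_fderiv, fderiv_family hD, iteratedFDeriv_sum fun i _ =>
        (ContinuousLinearMap.contDiff _).comp (contDiff_family hD n _), Finset.sum_apply]
      calc ‖x‖ ^ k * ‖∑ i, iteratedFDeriv ℝ n
            (ContinuousLinearMap.smulRightL ℝ W E (l i) ∘ f (D i a)) x‖
          ≤ ‖x‖ ^ k * ∑ i, ‖ContinuousLinearMap.smulRightL ℝ W E (l i)‖ *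
              ‖iteratedFDeriv ℝ n (f (D i a)) x‖ := by
            gcongr
            exact norm_sum_le_of_le _ fun i _ => ContinuousLinearMap.norm_iteratedFDeriv_comp_left _
              (contDiff_family hD n _).contDiffAt le_rfl
        _ ≤ _ := by
            rw [Finset.mul_sum]
            refine Finset.sum_le_sum fun i _ => ?_
            rw [mul_left_comm]
            gcongr
            exact hC _ _
  exact ⟨⟨f a, contDiff_infty.2 fun n => contDiff_family hD n a, fun k n => h k n a⟩, fun _ => rfl⟩

end Family

/-! ### Schwartz functions on a product -/

section Product

variable {m n : ℕ}

/-- The integrable weight `(1 + ‖y‖)⁻ⁿ⁻¹` on `ℝⁿ`. -/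
def weight (y : Conf n) : ℝ := ((1 + ‖y‖) ^ (n + 1))⁻¹

theorem weight_pos (y : Conf n) : 0 < weight y := by
  unfold weight
  positivity

theorem weight_le_one (y : Conf n) : weight y ≤ 1 := by
  unfold weight
  exact inv_le_one_of_one_le₀ (one_le_pow₀ (by linarith [norm_nonneg y]))

theorem continuous_weight : Continuous (weight : Conf n → ℝ) := by
  unfold weight
  refine Continuous.inv₀ (by fun_prop) fun y => ?_
  positivity

theorem integrable_weight : Integrable (weight : Conf n → ℝ) := by
  have h := integrable_one_add_norm (E := Conf n) (μ := volume) (r := (n + 1 : ℕ)) (by simp)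
  refine h.congr (Filter.Eventually.of_forall fun y => ?_)
  simp only [weight]
  rw [Real.rpow_neg (by positivity), Real.rpow_natCast]

theorem memLp_weight : MemLp (weight : Conf n → ℝ) 2 := by
  rw [memLp_two_iff_integrable_sq continuous_weight.aestronglyMeasurable]
  refine integrable_weight.mono' (continuous_weight.pow 2).aestronglyMeasurable
    (Filter.Eventually.of_forall fun y => ?_)
  rw [Real.norm_of_nonneg (by positivity), sq]
  exact mul_le_of_le_one_left (weight_pos y).le (weight_le_one y)

theorem exists_bound_prod (F : 𝓢(Conf m × Conf n, ℂ)) (k l : ℕ) :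
    ∃ C, 0 ≤ C ∧ ∀ x y, (1 + ‖x‖) ^ k * ((1 + ‖y‖) ^ l * ‖F (x, y)‖) ≤ C := by
  have h := F.one_add_le_sup_seminorm_apply (𝕜 := ℝ) (m := (k + l, 0)) (k := k + l) (n := 0)
    le_rfl le_rfl
  refine ⟨_, (by positivity : 0 ≤ (1 + ‖(0 : Conf m × Conf n)‖) ^ (k + l) *
    ‖iteratedFDeriv ℝ 0 F 0‖).trans (h 0), fun x y => le_trans ?_ (h (x, y))⟩
  rw [norm_iteratedFDeriv_zero, pow_add, mul_assoc]
  gcongr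
  · exact le_max_left _ _
  · exact le_max_right _ _

/-- Spending `n + 1` powers of decay in `y` produces an integrable majorant that is uniform in `x`;
it serves as the dominating function in all parameter integrals below. -/
theorem exists_bound_weight (F : 𝓢(Conf m × Conf n, ℂ)) (k : ℕ) :
    ∃ C, 0 ≤ C ∧ ∀ x y, (1 + ‖x‖) ^ k * ‖F (x, y)‖ ≤ C * weight y := by
  obtain ⟨C, hC, h⟩ := exists_bound_prod F k (n + 1)
  refine ⟨C, hC, fun x y => ?_⟩
  rw [weight, ← div_eq_mul_inv, le_div_iff₀ (by positivity)]
  have := h x y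
  calc _ = _ := by ring
    _ ≤ C := this

theorem norm_le_weight_of_bound {F : 𝓢(Conf m × Conf n, ℂ)} {k : ℕ} {C : ℝ}
    (h : ∀ x y, (1 + ‖x‖) ^ k * ‖F (x, y)‖ ≤ C * weight y) (x : Conf m) (y : Conf n) :
    ‖F (x, y)‖ ≤ C * weight y :=
  (le_mul_of_one_le_left (norm_nonneg _)
    (one_le_pow₀ (by linarith [norm_nonneg x]))).trans (h x y)

/-- The slice `y ↦ F (x, y)` of a Schwartz function. -/
def slice (F : 𝓢(Conf m × Conf n, ℂ)) (x : Conf m) : 𝓢(Conf n, ℂ) :=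
  SchwartzMap.compCLM ℂ (g := fun y : Conf n => (x, y))
    (by
      have h1 := (Function.HasTemperateGrowth.const (E := Conf n) ((x, 0) : Conf m × Conf n)).add
        (ContinuousLinearMap.inr ℝ (Conf m) (Conf n)).hasTemperateGrowth
      convert h1 using 1
      funext y
      simp)
    ⟨1, 1, fun y => by
      rw [one_mul, pow_one]
      have : ‖y‖ ≤ ‖(x, y)‖ := le_max_right _ _
      linarith⟩ F

theorem slice_apply (F : 𝓢(Conf m × Conf n, ℂ)) (x : Conf m) (y : Conf n) :
    slice F x y = F (x, y) := rfl

theorem lineDeriv_slice (F : 𝓢(Conf m × Conf n, ℂ)) (x : Conf m) (v : Conf n) :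
    ∂_{v} (slice F x) = slice (∂_{((0 : Conf m), v)} F) x := by
  ext y
  rw [slice_apply, SchwartzMap.lineDerivOp_apply_eq_fderiv, SchwartzMap.lineDerivOp_apply_eq_fderiv]
  have h := (F.hasFDerivAt (x, y)).comp y (hasFDerivAt_prodMk_right x y)
  have h2 : fderiv ℝ (slice F x) y = _ := h.fderiv
  rw [h2]
  simp

/-- The exchange of the variables. -/
def swapMap (F : 𝓢(Conf m × Conf n, ℂ)) : 𝓢(Conf n × Conf m, ℂ) :=
  SchwartzMap.compCLMOfContinuousLinearEquiv ℂ
    (ContinuousLinearEquiv.prodComm ℝ (Conf n) (Conf m)) F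

theorem swapMap_apply (F : 𝓢(Conf m × Conf n, ℂ)) (x : Conf m) (y : Conf n) :
    swapMap F (y, x) = F (x, y) := rfl

/-! ### Integral operators with Schwartz kernels -/

theorem memLp_weight_mul_norm (f : L2 (Conf n)) : Integrable fun y => weight y * ‖f y‖ :=
  memLp_weight.integrable_mul (Lp.memLp f).norm

theorem integrable_kernel_mul (K : 𝓢(Conf m × Conf n, ℂ)) (f : L2 (Conf n)) (x : Conf m) :
    Integrable fun y => K (x, y) * f y := by
  obtain ⟨C, hC, h⟩ := exists_bound_weight K 0
  refine ((memLp_weight_mul_norm f).const_mul C).mono'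
    (AEStronglyMeasurable.mul (f := fun y => K (x, y))
      (slice K x).continuous.aestronglyMeasurable (Lp.aestronglyMeasurable f))
    (Filter.Eventually.of_forall fun y => ?_)
  rw [norm_mul, ← mul_assoc]
  gcongr
  exact norm_le_weight_of_bound h x y

theorem sum_coord_smul_single (v : Conf m) :
    ∑ j, v j • EuclideanSpace.single j (1 : ℝ) = v := by
  ext i
  simp [Finset.sum_apply, Pi.single_apply]

theorem hasFDerivAt_fst_slice (K : 𝓢(Conf m × Conf n, ℂ)) (x : Conf m) (y : Conf n) :
    HasFDerivAt (fun x => K (x, y)) (∑ j, (EuclideanSpace.proj j : Conf m →L[ℝ] ℝ).smulRight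
      ((∂_{((EuclideanSpace.single j (1 : ℝ) : Conf m), (0 : Conf n))} K) (x, y))) x := by
  have h := (K.hasFDerivAt (x, y)).comp x (hasFDerivAt_prodMk_left (𝕜 := ℝ) x y)
  refine h.congr_fderiv ?_
  ext v
  have hv : (ContinuousLinearMap.inl ℝ (Conf m) (Conf n)) v = ∑ j, v j •
      ((EuclideanSpace.single j (1 : ℝ) : Conf m), (0 : Conf n)) := by
    conv_lhs => rw [← sum_coord_smul_single v]
    rw [map_sum]
    simp
  rw [ContinuousLinearMap.comp_apply, hv, map_sum, sum_apply]
  refine Finset.sum_congr rfl fun j _ => ?_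
  rw [map_smul, SchwartzMap.lineDerivOp_apply_eq_fderiv]
  rfl

theorem integrable_family_sum {α : Type} [MeasureSpace α] {ι W : Type} [Fintype ι]
    [NormedAddCommGroup W] [NormedSpace ℝ W] (l : ι → W →L[ℝ] ℝ) {f : ι → α → ℂ}
    (hf : ∀ i, Integrable (f i)) :
    ∫ y, ∑ i, (l i).smulRight (f i y) = ∑ i, (l i).smulRight (∫ y, f i y) := by
  refine (integral_finsetSum (f := fun i y => (l i).smulRight (f i y)) _ fun i _ =>
    (ContinuousLinearMap.smulRightL ℝ W ℂ (l i)).integrable_comp (hf i)).trans ?_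
  exact Finset.sum_congr rfl fun i _ =>
    (ContinuousLinearMap.smulRightL ℝ W ℂ (l i)).integral_comp_comm (hf i)

/-- Differentiation under the integral, dominated by `weight y * ‖f y‖`, which is integrable as a
product of two `L²` functions. -/
theorem hasFDerivAt_kernel_integral (K : 𝓢(Conf m × Conf n, ℂ)) (f : L2 (Conf n)) (x : Conf m) :
    HasFDerivAt (fun x => ∫ y, K (x, y) * f y)
      (∑ j, (EuclideanSpace.proj j : Conf m →L[ℝ] ℝ).smulRight (∫ y,
        (∂_{((EuclideanSpace.single j (1 : ℝ) : Conf m), (0 : Conf n))} K) (x, y) * f y)) x := by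
  let D : Fin m → 𝓢(Conf m × Conf n, ℂ) := fun j =>
    ∂_{((EuclideanSpace.single j (1 : ℝ) : Conf m), (0 : Conf n))} K
  let l : Fin m → Conf m →L[ℝ] ℝ := fun j => EuclideanSpace.proj j
  choose C hC hCb using fun j => exists_bound_weight (D j) 0
  rw [← integrable_family_sum l fun j => integrable_kernel_mul (D j) f x]
  have hmeas : ∀ (K : 𝓢(Conf m × Conf n, ℂ)) x,
      AEStronglyMeasurable (fun y => K (x, y) * f y) volume :=
    fun K x => (integrable_kernel_mul K f x).aestronglyMeasurable
  refine hasFDerivAt_integral_of_dominated_of_fderiv_le (s := Set.univ)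
    (F := fun x y => K (x, y) * f y)
    (F' := fun x y => ∑ j, (l j).smulRight (D j (x, y) * f y))
    (bound := fun y => ∑ j, ‖l j‖ * (C j * (weight y * ‖f y‖)))
    Filter.univ_mem (Filter.Eventually.of_forall fun x => hmeas K x)
    (integrable_kernel_mul K f x) ?_ ?_ ?_ ?_
  · exact Finset.aestronglyMeasurable_fun_sum _ fun j _ =>
      (ContinuousLinearMap.smulRightL ℝ (Conf m) ℂ (l j)).continuous.comp_aestronglyMeasurable
        (hmeas (D j) x)
  · refine Filter.Eventually.of_forall fun y x _ => norm_sum_le_of_le _ fun j _ => ?_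
    rw [ContinuousLinearMap.norm_smulRight_apply, norm_mul, ← mul_assoc (C j)]
    gcongr
    exact norm_le_weight_of_bound (hCb j) x y
  · exact integrable_finsetSum _ fun j _ => ((memLp_weight_mul_norm f).const_mul _).const_mul _
  · refine Filter.Eventually.of_forall fun y x _ => ?_
    have h := (hasFDerivAt_fst_slice K x y).mul_const (f y)
    refine h.congr_fderiv ?_
    rw [Finset.smul_sum]
    refine Finset.sum_congr rfl fun j _ => ?_
    ext v
    simp [l, D]
    ring

/-- The closed family is indexed by the kernels themselves: differentiating the integral in `x` only
replaces the kernel by a partial derivative. -/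
theorem exists_kernelOp (K : 𝓢(Conf m × Conf n, ℂ)) (f : L2 (Conf n)) :
    ∃ φ : 𝓢(Conf m, ℂ), ∀ x, φ x = ∫ y, K (x, y) * f y := by
  refine exists_schwartzMap_family (A := 𝓢(Conf m × Conf n, ℂ))
    (f := fun K x => ∫ y, K (x, y) * f y)
    (l := fun j : Fin m => (EuclideanSpace.proj j : Conf m →L[ℝ] ℝ))
    (D := fun j K => ∂_{((EuclideanSpace.single j (1 : ℝ) : Conf m), (0 : Conf n))} K)
    (fun K x => hasFDerivAt_kernel_integral K f x) (fun K k => ?_) K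
  obtain ⟨C, hC, h⟩ := exists_bound_weight K k
  refine ⟨∫ y, C * (weight y * ‖f y‖), fun x => ?_⟩
  have hn : ‖x‖ ^ k = ‖((‖x‖ ^ k : ℝ) : ℂ)‖ := by simp
  rw [hn, ← norm_mul, ← integral_const_mul]
  refine norm_integral_le_of_norm_le ((memLp_weight_mul_norm f).const_mul C)
    (Filter.Eventually.of_forall fun y => ?_)
  rw [norm_mul, ← hn, norm_mul, ← mul_assoc, ← mul_assoc]
  refine mul_le_mul_of_nonneg_right (le_trans ?_ (h x y)) (norm_nonneg _)
  gcongr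
  linarith

/-- The operator with kernel `K`, from `L²` to the Schwartz space. -/
def kernelOp (K : 𝓢(Conf m × Conf n, ℂ)) (f : L2 (Conf n)) : 𝓢(Conf m, ℂ) :=
  (exists_kernelOp K f).choose

theorem kernelOp_apply (K : 𝓢(Conf m × Conf n, ℂ)) (f : L2 (Conf n)) (x : Conf m) :
    kernelOp K f x = ∫ y, K (x, y) * f y :=
  (exists_kernelOp K f).choose_spec x

theorem lineDeriv_kernelOp (K : 𝓢(Conf m × Conf n, ℂ)) (f : L2 (Conf n)) (j : Fin m) :
    ∂_{(EuclideanSpace.single j (1 : ℝ) : Conf m)} (kernelOp K f) =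
      kernelOp (∂_{((EuclideanSpace.single j (1 : ℝ) : Conf m), (0 : Conf n))} K) f := by
  ext x
  have h : (kernelOp K f : Conf m → ℂ) = fun x => ∫ y, K (x, y) * f y :=
    funext (kernelOp_apply K f)
  rw [SchwartzMap.lineDerivOp_apply_eq_fderiv, h, (hasFDerivAt_kernel_integral K f x).fderiv,
    sum_apply, kernelOp_apply]
  simp only [ContinuousLinearMap.smulRight_apply]
  rw [Finset.sum_eq_single j]
  · simp
  · intro i _ hi
    simp [hi.symm]
  · simp

theorem posOp_kernelOp (K : 𝓢(Conf m × Conf n, ℂ)) (f : L2 (Conf n)) (l : Conf m →L[ℝ] ℝ) :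
    posOp l (kernelOp K f) =
      kernelOp (posOp (l ∘L ContinuousLinearMap.fst ℝ (Conf m) (Conf n)) K) f := by
  ext x
  rw [posOp_apply, kernelOp_apply, kernelOp_apply, ← integral_const_mul]
  refine integral_congr_ae (Filter.Eventually.of_forall fun y => ?_)
  simp only [posOp_apply]
  simp [mul_assoc]

/-- The quantized phase space coordinates: multiplication by `xⱼ` and `-i ∂/∂xⱼ`. -/
def phaseOp (a : Fin n ⊕ Fin n) : 𝓢(Conf n, ℂ) →L[ℂ] 𝓢(Conf n, ℂ) :=
  Sum.elim (fun j => posOp (EuclideanSpace.proj j))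
    (fun j => momOp (EuclideanSpace.single j (1 : ℝ))) a

theorem momOp_apply {W : Type} [NormedAddCommGroup W] [NormedSpace ℝ W] (v : W)
    (φ : 𝓢(W, ℂ)) (w : W) : momOp v φ w = -I * fderiv ℝ φ w v := rfl

theorem kernelOp_smul (c : ℂ) (K : 𝓢(Conf m × Conf n, ℂ)) (f : L2 (Conf n)) :
    kernelOp (c • K) f = c • kernelOp K f := by
  ext x
  rw [smul_apply, kernelOp_apply, kernelOp_apply, smul_eq_mul, ← integral_const_mul]
  refine integral_congr_ae (Filter.Eventually.of_forall fun y => ?_)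
  simp [mul_assoc]

theorem kernelOp_add (K K' : 𝓢(Conf m × Conf n, ℂ)) (f : L2 (Conf n)) :
    kernelOp (K + K') f = kernelOp K f + kernelOp K' f := by
  ext x
  rw [add_apply, kernelOp_apply, kernelOp_apply, kernelOp_apply,
    ← integral_add (integrable_kernel_mul K f x) (integrable_kernel_mul K' f x)]
  refine integral_congr_ae (Filter.Eventually.of_forall fun y => ?_)
  simp [add_mul]

/-- Positions and momenta pass through the integral onto the first variable of the kernel. Thus
`phaseOp a` composed with the operator of kernel `K` has the Schwartz kernel `sysOp a K`. -/
theorem phaseOp_kernelOp (K : 𝓢(Conf m × Conf n, ℂ)) (f : L2 (Conf n)) (a : Fin m ⊕ Fin m) :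
    phaseOp a (kernelOp K f) = kernelOp (sysOp a K) f := by
  cases a with
  | inl j => exact posOp_kernelOp K f _
  | inr j =>
    change (-I) • ∂_{(EuclideanSpace.single j (1 : ℝ) : Conf m)} (kernelOp K f) =
      kernelOp ((-I) • ∂_{((EuclideanSpace.single j (1 : ℝ) : Conf m), (0 : Conf n))} K) f
    rw [lineDeriv_kernelOp, kernelOp_smul]

theorem kernelOp_map_add (K : 𝓢(Conf m × Conf n, ℂ)) (f g : L2 (Conf n)) :
    kernelOp K (f + g) = kernelOp K f + kernelOp K g := by
  ext x
  rw [add_apply, kernelOp_apply, kernelOp_apply, kernelOp_apply,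
    ← integral_add (integrable_kernel_mul K f x) (integrable_kernel_mul K g x)]
  refine integral_congr_ae ?_
  filter_upwards [Lp.coeFn_add f g] with y hy
  rw [hy, Pi.add_apply, mul_add]

theorem kernelOp_map_smul (K : 𝓢(Conf m × Conf n, ℂ)) (c : ℂ) (f : L2 (Conf n)) :
    kernelOp K (c • f) = c • kernelOp K f := by
  ext x
  rw [smul_apply, kernelOp_apply, kernelOp_apply, smul_eq_mul, ← integral_const_mul]
  refine integral_congr_ae ?_
  filter_upwards [Lp.coeFn_smul c f] with y hy
  rw [hy, Pi.smul_apply, smul_eq_mul, mul_left_comm]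

theorem toLp_add {W : Type} [NormedAddCommGroup W] [NormedSpace ℝ W] [MeasureSpace W]
    [BorelSpace W] [SecondCountableTopology W] [(volume : Measure W).HasTemperateGrowth]
    (φ χ : 𝓢(W, ℂ)) : (φ + χ).toLp 2 volume = φ.toLp 2 volume + χ.toLp 2 volume :=
  (SchwartzMap.toLpCLM ℂ ℂ 2 (volume : Measure W)).map_add φ χ

theorem toLp_smul {W : Type} [NormedAddCommGroup W] [NormedSpace ℝ W] [MeasureSpace W]
    [BorelSpace W] [SecondCountableTopology W] [(volume : Measure W).HasTemperateGrowth]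
    (c : ℂ) (φ : 𝓢(W, ℂ)) : (c • φ).toLp 2 volume = c • φ.toLp 2 volume :=
  (SchwartzMap.toLpCLM ℂ ℂ 2 (volume : Measure W)).map_smul c φ

theorem integral_weight_mul_norm_le (f : L2 (Conf n)) :
    ∫ y, weight y * ‖f y‖ ≤ ‖(memLp_weight (n := n)).toLp‖ * ‖f‖ := by
  have h := real_inner_le_norm ((memLp_weight (n := n)).toLp) ((Lp.memLp f).norm.toLp)
  rw [Lp.norm_toLp (f := fun y => ‖f y‖), eLpNorm_norm, ← Lp.norm_def, L2.inner_def] at h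
  refine le_trans (le_of_eq (integral_congr_ae ?_)) h
  filter_upwards [(memLp_weight (n := n)).coeFn_toLp, (Lp.memLp f).norm.coeFn_toLp] with y h1 h2
  rw [h1, h2, real_inner_eq_re_inner ℝ]
  simp [mul_comm]

/-- The bounded operator of `L²` with kernel `K`. -/
def kernelCLM (K : 𝓢(Conf m × Conf n, ℂ)) : L2 (Conf n) →L[ℂ] L2 (Conf m) :=
  LinearMap.mkContinuousOfExistsBound
    { toFun := fun f => (kernelOp K f).toLp 2 volume
      map_add' := fun f g => by rw [kernelOp_map_add, toLp_add]
      map_smul' := fun c f => by rw [kernelOp_map_smul, toLp_smul]; rfl }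
    (by
      obtain ⟨C, hC, h⟩ := exists_bound_weight K (m + 1)
      refine ⟨C * ‖(memLp_weight (n := n)).toLp‖ * ‖(memLp_weight (n := m)).toLp‖, fun f => ?_⟩
      change ‖(kernelOp K f).toLp 2 volume‖ ≤ _
      have hle : ∀ᵐ x, ‖(kernelOp K f).toLp 2 volume x‖ ≤
          C * (‖(memLp_weight (n := n)).toLp‖ * ‖f‖) * ‖(memLp_weight (n := m)).toLp weight x‖ := by
        filter_upwards [(kernelOp K f).coeFn_toLp 2 volume,
          (memLp_weight (n := m)).coeFn_toLp] with x h1 h2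
        rw [h1, h2, kernelOp_apply, Real.norm_of_nonneg (weight_pos x).le]
        have hb : ‖∫ y, K (x, y) * f y‖ ≤ ∫ y, C * weight x * (weight y * ‖f y‖) := by
          refine norm_integral_le_of_norm_le ((memLp_weight_mul_norm f).const_mul _)
            (Filter.Eventually.of_forall fun y => ?_)
          rw [norm_mul, ← mul_assoc]
          refine mul_le_mul_of_nonneg_right ?_ (norm_nonneg _)
          have := h x y
          rw [weight, mul_right_comm, ← div_eq_mul_inv, le_div_iff₀ (by positivity), mul_comm]
          exact this
        refine hb.trans ?_
        rw [integral_const_mul, mul_right_comm]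
        gcongr
        · exact (weight_pos x).le
        · exact integral_weight_mul_norm_le f
      refine (Lp.norm_le_mul_norm_of_ae_le_mul hle).trans_eq ?_
      ring)

theorem kernelCLM_apply (K : 𝓢(Conf m × Conf n, ℂ)) (f : L2 (Conf n)) :
    kernelCLM K f = (kernelOp K f).toLp 2 volume := rfl

end Product

/-! ### The partial Fourier transform -/

section PartialFourier

variable {m n : ℕ}

theorem fourier_slice_apply (F : 𝓢(Conf m × Conf n, ℂ)) (x : Conf m) (v : Conf n) :
    𝓕 (slice F x) v = ∫ η : Conf n, exp (((-2 * Real.pi * ⟪η, v⟫_ℝ : ℝ) : ℂ) * I) * F (x, η) := by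
  rw [SchwartzMap.fourier_coe, Real.fourier_eq']
  rfl

/-- The linear forms `xⱼ` and `vⱼ` on `ℝᵐ × ℝⁿ`. -/
def prodCoord (i : Fin m ⊕ Fin n) : Conf m × Conf n →L[ℝ] ℝ :=
  Sum.elim (fun j => EuclideanSpace.proj j ∘L ContinuousLinearMap.fst ℝ (Conf m) (Conf n))
    (fun j => EuclideanSpace.proj j ∘L ContinuousLinearMap.snd ℝ (Conf m) (Conf n)) i

/-- The effect on a function of the derivatives of its partial Fourier transform. -/
def partialFourierDeriv (i : Fin m ⊕ Fin n) (F : 𝓢(Conf m × Conf n, ℂ)) :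
    𝓢(Conf m × Conf n, ℂ) :=
  Sum.elim (fun j => ∂_{((EuclideanSpace.single j (1 : ℝ) : Conf m), (0 : Conf n))} F)
    (fun j => (-2 * Real.pi * I) • posOp (prodCoord (Sum.inr j)) F) i

theorem norm_exp_fourier_mul (t : ℝ) (z : ℂ) : ‖exp ((t : ℂ) * I) * z‖ = ‖z‖ := by
  rw [norm_mul, norm_exp_ofReal_mul_I, one_mul]

theorem integrable_exp_mul_slice (F : 𝓢(Conf m × Conf n, ℂ)) (x : Conf m) (v : Conf n) :
    Integrable fun η : Conf n => exp (((-2 * Real.pi * ⟪η, v⟫_ℝ : ℝ) : ℂ) * I) * F (x, η) := by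
  refine (slice F x).integrable.norm.mono' (Continuous.aestronglyMeasurable ?_)
    (Filter.Eventually.of_forall fun η => (norm_exp_fourier_mul _ _).le)
  exact Continuous.mul (by fun_prop) (slice F x).continuous

theorem hasFDerivAt_exp_mul (F : 𝓢(Conf m × Conf n, ℂ)) (η : Conf n) (p : Conf m × Conf n) :
    HasFDerivAt (fun p : Conf m × Conf n =>
        exp (((-2 * Real.pi * ⟪η, p.2⟫_ℝ : ℝ) : ℂ) * I) * F (p.1, η))
      (∑ i, (prodCoord i).smulRight (exp (((-2 * Real.pi * ⟪η, p.2⟫_ℝ : ℝ) : ℂ) * I) *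
        partialFourierDeriv i F (p.1, η))) p := by
  have h1 := (hasFDerivAt_fst_slice F p.1 η).comp p (hasFDerivAt_fst (𝕜 := ℝ) (p := p))
  let L : Conf m × Conf n →L[ℝ] ℂ := (I • ofRealCLM) ∘L ((-2 * Real.pi) • (innerSL ℝ η ∘L
    ContinuousLinearMap.snd ℝ (Conf m) (Conf n)))
  have hL : ∀ p : Conf m × Conf n, L p = ((-2 * Real.pi * ⟪η, p.2⟫_ℝ : ℝ) : ℂ) * I := fun p => by
    simp [L]
    ring
  have h2 : HasFDerivAt (fun p : Conf m × Conf n =>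
      exp (((-2 * Real.pi * ⟪η, p.2⟫_ℝ : ℝ) : ℂ) * I))
      (exp (((-2 * Real.pi * ⟪η, p.2⟫_ℝ : ℝ) : ℂ) * I) • L) p := by
    have := (L.hasFDerivAt (x := p)).cexp
    simpa only [hL] using this
  refine (h2.mul h1).congr_fderiv ?_
  refine ContinuousLinearMap.ext fun v => ?_
  have hp : ∀ j (w : Conf m), EuclideanSpace.proj (𝕜 := ℝ) j w = w j := fun _ _ => rfl
  have hp' : ∀ j (w : Conf n), EuclideanSpace.proj (𝕜 := ℝ) j w = w j := fun _ _ => rfl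
  have hin : ⟪η, v.2⟫_ℝ = ∑ j, v.2 j * η j := by simp [PiLp.inner_apply]
  simp only [add_apply, smul_apply, smul_eq_mul, ContinuousLinearMap.comp_apply, sum_apply,
    ContinuousLinearMap.smulRight_apply, hL, Fintype.sum_sum_type, partialFourierDeriv,
    prodCoord, Sum.elim_inl, Sum.elim_inr, posOp_apply, Finset.mul_sum, hin, Function.comp_apply,
    ContinuousLinearMap.coe_fst', ContinuousLinearMap.coe_snd', hp, hp',
    real_smul, ofReal_sum, Finset.sum_mul]
  congr 1 <;> refine Finset.sum_congr rfl fun j _ => ?_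
  · ring
  · push_cast
    ring

theorem hasFDerivAt_partialFourier (F : 𝓢(Conf m × Conf n, ℂ)) (p : Conf m × Conf n) :
    HasFDerivAt (fun p : Conf m × Conf n => 𝓕 (slice F p.1) p.2)
      (∑ i, (prodCoord i).smulRight (𝓕 (slice (partialFourierDeriv i F) p.1) p.2)) p := by
  simp only [fourier_slice_apply]
  rw [← integrable_family_sum prodCoord fun i => integrable_exp_mul_slice _ p.1 p.2]
  choose C hC hCb using fun i : Fin m ⊕ Fin n => exists_bound_weight (partialFourierDeriv i F) 0
  refine hasFDerivAt_integral_of_dominated_of_fderiv_le (s := Set.univ)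
    (F := fun p η => exp (((-2 * Real.pi * ⟪η, p.2⟫_ℝ : ℝ) : ℂ) * I) * F (p.1, η))
    (F' := fun p η => ∑ i, (prodCoord i).smulRight
      (exp (((-2 * Real.pi * ⟪η, p.2⟫_ℝ : ℝ) : ℂ) * I) * partialFourierDeriv i F (p.1, η)))
    (bound := fun η => ∑ i : Fin m ⊕ Fin n, ‖(prodCoord i : Conf m × Conf n →L[ℝ] ℝ)‖ *
      (C i * weight η))
    Filter.univ_mem (Filter.Eventually.of_forall fun p =>
      (integrable_exp_mul_slice F p.1 p.2).aestronglyMeasurable)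
    (integrable_exp_mul_slice F p.1 p.2) ?_ ?_ ?_ ?_
  · exact Finset.aestronglyMeasurable_fun_sum _ fun i _ =>
      (ContinuousLinearMap.smulRightL ℝ (Conf m × Conf n) ℂ (prodCoord i)).continuous.comp_aestronglyMeasurable
        (integrable_exp_mul_slice _ p.1 p.2).aestronglyMeasurable
  · refine Filter.Eventually.of_forall fun η p _ => norm_sum_le_of_le _ fun i _ => ?_
    rw [ContinuousLinearMap.norm_smulRight_apply, norm_exp_fourier_mul]
    gcongr
    exact norm_le_weight_of_bound (hCb i) p.1 η
  · exact integrable_finsetSum _ fun j _ => (integrable_weight.const_mul _).const_mul _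
  · exact Filter.Eventually.of_forall fun η p _ => hasFDerivAt_exp_mul F η p

theorem norm_le_sum_norm_coord (v : Conf n) : ‖v‖ ≤ ∑ j, |v j| := by
  conv_lhs => rw [← sum_coord_smul_single v]
  refine norm_sum_le_of_le _ fun j _ => ?_
  rw [norm_smul, PiLp.norm_single]
  simp

theorem coord_mul_fourier_slice (F : 𝓢(Conf m × Conf n, ℂ)) (x : Conf m) (v : Conf n)
    (j : Fin n) : (2 * Real.pi * I) * ((v j : ℂ) * 𝓕 (slice F x) v) =
      𝓕 (slice (∂_{((0 : Conf m), (EuclideanSpace.single j (1 : ℝ) : Conf n))} F) x) v := by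
  rw [← lineDeriv_slice, SchwartzMap.fourier_lineDerivOp_eq, smul_apply, smul_eq_mul,
    SchwartzMap.smulLeftCLM_apply_apply (by fun_prop),
    EuclideanSpace.inner_single_right]
  simp

theorem exists_bound_fourier_fst (F : 𝓢(Conf m × Conf n, ℂ)) (k : ℕ) :
    ∃ C, ∀ x v, ‖x‖ ^ k * ‖𝓕 (slice F x) v‖ ≤ C := by
  obtain ⟨C, hC, h⟩ := exists_bound_weight F k
  refine ⟨∫ η : Conf n, C * weight η, fun x v => ?_⟩
  have hn : ‖x‖ ^ k = ‖((‖x‖ ^ k : ℝ) : ℂ)‖ := by simp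
  rw [hn, ← norm_mul, fourier_slice_apply, ← integral_const_mul]
  refine norm_integral_le_of_norm_le (integrable_weight.const_mul C)
    (Filter.Eventually.of_forall fun η => ?_)
  rw [norm_mul, ← hn, norm_exp_fourier_mul]
  refine le_trans ?_ (h x η)
  gcongr
  linarith

/-- Decay in the frequency is gained one power at a time, since multiplication by `v j` amounts to a
derivative of `F` in its second variable. -/
theorem exists_bound_fourier_snd (k : ℕ) (F : 𝓢(Conf m × Conf n, ℂ)) :
    ∃ C, ∀ x v, ‖v‖ ^ k * ‖𝓕 (slice F x) v‖ ≤ C := by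
  induction k generalizing F with
  | zero => simpa using exists_bound_fourier_fst F 0
  | succ k ih =>
    choose C hC using fun j : Fin n =>
      ih (∂_{((0 : Conf m), (EuclideanSpace.single j (1 : ℝ) : Conf n))} F)
    refine ⟨∑ j, C j, fun x v => ?_⟩
    calc ‖v‖ ^ (k + 1) * ‖𝓕 (slice F x) v‖
        = ‖v‖ * (‖v‖ ^ k * ‖𝓕 (slice F x) v‖) := by ring
      _ ≤ (∑ j, |v j|) * (‖v‖ ^ k * ‖𝓕 (slice F x) v‖) := by
        gcongr
        exact norm_le_sum_norm_coord v
      _ = ∑ j, ‖v‖ ^ k * (|v j| * ‖𝓕 (slice F x) v‖) := by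
        rw [Finset.sum_mul]
        exact Finset.sum_congr rfl fun j _ => by ring
      _ ≤ ∑ j, C j := by
        refine Finset.sum_le_sum fun j _ => le_trans ?_ (hC j x v)
        rw [← coord_mul_fourier_slice, norm_mul, norm_mul (v j : ℂ)]
        rw [norm_real, Real.norm_eq_abs]
        refine mul_le_mul_of_nonneg_left ?_ (by positivity)
        -- The factor `2πi` produced by the derivative has modulus at least one and may be dropped.
        refine le_mul_of_one_le_left (by positivity) ?_
        have : ‖(2 * Real.pi * I : ℂ)‖ = 2 * Real.pi := by
          simp [abs_of_pos Real.pi_pos]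
        rw [this]
        linarith [Real.pi_gt_three]

theorem exists_partialFourier (F : 𝓢(Conf m × Conf n, ℂ)) :
    ∃ φ : 𝓢(Conf m × Conf n, ℂ), ∀ p : Conf m × Conf n, φ p = 𝓕 (slice F p.1) p.2 := by
  refine exists_schwartzMap_family (f := fun (F : 𝓢(Conf m × Conf n, ℂ)) (p : Conf m × Conf n) =>
    𝓕 (slice F p.1) p.2) (l := prodCoord) (D := partialFourierDeriv)
    hasFDerivAt_partialFourier (fun F k => ?_) F
  obtain ⟨C, hC⟩ := exists_bound_fourier_fst F k
  obtain ⟨C', hC'⟩ := exists_bound_fourier_snd k F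
  refine ⟨max C C', fun p => ?_⟩
  rcases le_total ‖p.1‖ ‖p.2‖ with h | h
  · rw [Prod.norm_def, max_eq_right h]
    exact (hC' _ _).trans (le_max_right _ _)
  · rw [Prod.norm_def, max_eq_left h]
    exact (hC _ _).trans (le_max_left _ _)

/-- The Fourier transform in the second variable. -/
def partialFourier (F : 𝓢(Conf m × Conf n, ℂ)) : 𝓢(Conf m × Conf n, ℂ) :=
  (exists_partialFourier F).choose

theorem slice_partialFourier (F : 𝓢(Conf m × Conf n, ℂ)) (x : Conf m) :
    slice (partialFourier F) x = 𝓕 (slice F x) := by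
  ext v
  exact (exists_partialFourier F).choose_spec (x, v)

theorem partialFourier_apply (F : 𝓢(Conf m × Conf n, ℂ)) (x : Conf m) (v : Conf n) :
    partialFourier F (x, v) =
      ∫ η : Conf n, exp (((-2 * Real.pi * ⟪η, v⟫_ℝ : ℝ) : ℂ) * I) * F (x, η) := by
  rw [← fourier_slice_apply, ← slice_partialFourier, slice_apply]

theorem integral_exp_mul_partialFourier (F : 𝓢(Conf m × Conf n, ℂ)) (x : Conf m) (y : Conf n) :
    ∫ v : Conf n, exp (((2 * Real.pi * ⟪v, y⟫_ℝ : ℝ) : ℂ) * I) * partialFourier F (x, v) =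
      F (x, y) := by
  have h : 𝓕⁻ (𝓕 (slice F x)) = slice F x := FourierTransform.fourierInv_fourier_eq _
  rw [← slice_apply F, ← h, SchwartzMap.fourierInv_coe, Real.fourierInv_eq', ← slice_partialFourier]
  rfl

end PartialFourier

/-! ### The trace of an operator with Schwartz kernel -/

/-- Distinct basis vectors are at distance `√2`, so the balls of radius `1 / 2` around them are
disjoint. Countability is needed to exchange a sum over the basis with an integral. -/
theorem HilbertBasis.countable_of_separableSpace {H ι : Type} [NormedAddCommGroup H]
    [InnerProductSpace ℂ H] [TopologicalSpace.SeparableSpace H] (b : HilbertBasis ι ℂ H) :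
    Countable ι := by
  have hd : (Set.univ : Set ι).PairwiseDisjoint fun i => Metric.ball (b i) (1 / 2) := by
    intro i _ j _ hij
    refine Metric.ball_disjoint_ball ?_
    rw [dist_eq_norm]
    have h : ‖b i - b j‖ ^ 2 = 2 := by
      rw [@norm_sub_sq ℂ, b.orthonormal.1, b.orthonormal.1, b.orthonormal.2 hij]
      norm_num
    nlinarith [norm_nonneg (b i - b j)]
  exact Set.countable_univ_iff.1 (hd.countable_of_isOpen (fun i _ => Metric.isOpen_ball)
    fun i _ => ⟨b i, Metric.mem_ball_self (by norm_num)⟩)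

section Trace

variable {n : ℕ}

instance separableSpace_L2 : TopologicalSpace.SeparableSpace (L2 (Conf n)) := by
  have : Fact ((2 : ℝ≥0∞) ≠ ∞) := ⟨by simp⟩
  have := Lp.SecondCountableTopology (X := Conf n) (E := ℂ) (p := 2) (μ := volume)
  infer_instance

/-- The polynomial `(1 + ‖x‖²)ⁿ⁺¹` on `ℝⁿ`. -/
def growth (x : Conf n) : ℝ := (1 + ‖x‖ ^ 2) ^ (n + 1)

theorem growth_pos (x : Conf n) : 0 < growth x := by
  unfold growth
  positivity

theorem hasTemperateGrowth_growth : (fun x : Conf n => (growth x : ℂ)).HasTemperateGrowth := by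
  have h : (fun x : Conf n => (1 + ‖x‖ ^ 2 : ℝ)).HasTemperateGrowth :=
    (Function.HasTemperateGrowth.const 1).add (Function.hasTemperateGrowth_norm_sq (H := Conf n))
  exact ofRealCLM.hasTemperateGrowth.comp (h.pow (n + 1))

theorem growth_inv_le (x : Conf n) : (growth x)⁻¹ ≤ 2 ^ (n + 1) * weight x := by
  unfold growth weight
  rw [← div_eq_mul_inv, le_div_iff₀ (by positivity), inv_mul_le_iff₀ (by positivity), ← mul_pow]
  refine pow_le_pow_left₀ (by positivity) ?_ _
  nlinarith [norm_nonneg x, sq_nonneg (‖x‖ - 1)]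

theorem continuous_growth : Continuous (growth : Conf n → ℝ) := by
  unfold growth
  fun_prop

/-- The damped plane wave `x ↦ (1 + ‖x‖²)⁻ⁿ⁻¹ exp (2πi η · x)`. -/
def planeWave (η x : Conf n) : ℂ :=
  exp (((2 * Real.pi * ⟪η, x⟫_ℝ : ℝ) : ℂ) * I) * ((growth x)⁻¹ : ℝ)

theorem norm_planeWave_le (η x : Conf n) : ‖planeWave η x‖ ≤ 2 ^ (n + 1) * weight x := by
  rw [planeWave, norm_exp_fourier_mul, norm_real, Real.norm_of_nonneg
    (inv_nonneg.2 (growth_pos x).le)]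
  exact growth_inv_le x

theorem continuous_planeWave : Continuous fun p : Conf n × Conf n => planeWave p.1 p.2 := by
  unfold planeWave
  refine Continuous.mul (by fun_prop) (continuous_ofReal.comp ?_)
  exact (continuous_growth.comp continuous_snd).inv₀ fun p => (growth_pos p.2).ne'

theorem memLp_of_norm_le_weight {f : Conf n → ℂ} (hf : Continuous f) {C : ℝ}
    (h : ∀ x, ‖f x‖ ≤ C * weight x) : MemLp f 2 :=
  memLp_weight.of_le_mul hf.aestronglyMeasurable (c := C) (Filter.Eventually.of_forall fun x =>
    (h x).trans_eq (by rw [Real.norm_of_nonneg (weight_pos x).le]))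

theorem norm_toLp_le_of_norm_le_weight {f : Conf n → ℂ} (hf : MemLp f 2) {C : ℝ}
    (h : ∀ x, ‖f x‖ ≤ C * weight x) : ‖hf.toLp‖ ≤ C * ‖(memLp_weight (n := n)).toLp‖ := by
  refine Lp.norm_le_mul_norm_of_ae_le_mul ?_
  filter_upwards [hf.coeFn_toLp, (memLp_weight (n := n)).coeFn_toLp] with x h1 h2
  rw [h1, h2, Real.norm_of_nonneg (weight_pos x).le]
  exact h x

/-- Every Schwartz kernel is a superposition of products. -/
theorem exists_kernel_eq_integral (K : 𝓢(Conf n × Conf n, ℂ)) :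
    ∃ c : 𝓢(Conf n × Conf n, ℂ), ∀ x y, ∫ η, planeWave η x * c (η, y) = K (x, y) := by
  have hg : (fun p : Conf n × Conf n => (growth p.1 : ℂ)).HasTemperateGrowth :=
    hasTemperateGrowth_growth.comp (ContinuousLinearMap.fst ℝ (Conf n) (Conf n)).hasTemperateGrowth
  -- Fourier inversion in the first variable is applied to `growth x * K (x, y)`; the extra factor
  -- cancels the damping which makes the plane waves square integrable.
  let J := SchwartzMap.smulLeftCLM ℂ (fun p : Conf n × Conf n => (growth p.1 : ℂ)) K
  refine ⟨swapMap (partialFourier (swapMap J)), fun x y => ?_⟩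
  have h := integral_exp_mul_partialFourier (swapMap J) y x
  rw [swapMap_apply, SchwartzMap.smulLeftCLM_apply_apply hg, smul_eq_mul] at h
  have h0 : (growth x : ℂ) ≠ 0 := ofReal_ne_zero.2 (growth_pos x).ne'
  rw [← mul_right_inj' h0, ← h, ← integral_const_mul]
  refine integral_congr_ae (Filter.Eventually.of_forall fun η => ?_)
  simp only [planeWave, swapMap_apply]
  push_cast
  field_simp

theorem exists_bound_weight_weight {m : ℕ} (K : 𝓢(Conf m × Conf n, ℂ)) :
    ∃ C, 0 ≤ C ∧ ∀ x y, ‖K (x, y)‖ ≤ C * weight x * weight y := by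
  obtain ⟨C, hC, h⟩ := exists_bound_weight K (m + 1)
  refine ⟨C, hC, fun x y => ?_⟩
  have := h x y
  rw [weight, mul_right_comm, ← div_eq_mul_inv, le_div_iff₀ (by positivity), mul_comm]
  exact this

theorem integrable_planeWave_mul (g : L2 (Conf n)) (h : 𝓢(Conf n, ℂ)) :
    Integrable fun p : Conf n × Conf n =>
      (starRingEnd ℂ) (g p.1) * (planeWave p.2 p.1 * h p.2) := by
  have hb : Integrable fun p : Conf n × Conf n =>
      2 ^ (n + 1) * ((weight p.1 * ‖g p.1‖) * ‖h p.2‖) :=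
    ((memLp_weight_mul_norm g).mul_prod h.integrable.norm).const_mul _
  refine hb.mono' ?_ (Filter.Eventually.of_forall fun p => ?_)
  · refine AEStronglyMeasurable.mul ?_ (Continuous.aestronglyMeasurable ?_)
    · exact continuous_conj.comp_aestronglyMeasurable (Lp.aestronglyMeasurable g).comp_fst
    · exact (continuous_planeWave.comp continuous_swap).mul (h.continuous.comp continuous_snd)
  · rw [norm_mul, norm_mul, RCLike.norm_conj]
    calc _ ≤ ‖g p.1‖ * (2 ^ (n + 1) * weight p.1 * ‖h p.2‖) := by
          gcongr
          exact norm_planeWave_le _ _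
      _ = _ := by ring

theorem memLp_planeWave (η : Conf n) : MemLp (planeWave η) 2 := by
  have h : Continuous (planeWave η) := by
    have hg := continuous_growth.inv₀ fun x : Conf n => (growth_pos x).ne'
    exact Continuous.mul (by fun_prop) (continuous_ofReal.comp hg)
  exact memLp_of_norm_le_weight (f := planeWave η) (C := 2 ^ (n + 1)) h (norm_planeWave_le η)

theorem inner_planeWave (g : L2 (Conf n)) (η : Conf n) :
    ⟪g, (memLp_planeWave η).toLp⟫_ℂ = ∫ x, (starRingEnd ℂ) (g x) * planeWave η x := by
  rw [L2.inner_def]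
  refine integral_congr_ae ?_
  filter_upwards [(memLp_planeWave η).coeFn_toLp] with x hx
  rw [hx, RCLike.inner_apply, mul_comm]

/-- The conjugate makes the `L²` scalar product, antilinear on the left, reproduce the bilinear
pairing with the slice of `c`. -/
theorem exists_memLp_conj_slice (c : 𝓢(Conf n × Conf n, ℂ)) :
    ∃ s : Conf n → L2 (Conf n), (∀ η f, ⟪s η, f⟫_ℂ = ∫ y, c (η, y) * f y) ∧
      ∃ C, ∀ η, ‖s η‖ ≤ C * weight η := by
  obtain ⟨C, hC, h⟩ := exists_bound_weight_weight c
  have hb : ∀ η y, ‖(starRingEnd ℂ) (c (η, y))‖ ≤ C * weight η * weight y := fun η y => by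
    rw [RCLike.norm_conj]
    exact h η y
  have hm : ∀ η, MemLp (fun y => (starRingEnd ℂ) (c (η, y))) 2 := fun η =>
    memLp_of_norm_le_weight (continuous_conj.comp (slice c η).continuous) (hb η)
  refine ⟨fun η => (hm η).toLp, fun η f => ?_, C * ‖(memLp_weight (n := n)).toLp‖, fun η =>
    (norm_toLp_le_of_norm_le_weight (hm η) (hb η)).trans_eq (by ring)⟩
  rw [L2.inner_def]
  refine integral_congr_ae ?_
  filter_upwards [(hm η).coeFn_toLp] with y hy
  rw [hy, RCLike.inner_apply, conj_conj, mul_comm]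

theorem kernelOp_eq_integral {K c : 𝓢(Conf n × Conf n, ℂ)}
    (h : ∀ x y, ∫ η, planeWave η x * c (η, y) = K (x, y)) (f : L2 (Conf n)) (x : Conf n) :
    kernelOp K f x = ∫ η, planeWave η x * kernelOp c f η := by
  obtain ⟨C, hC, hb⟩ := exists_bound_weight_weight c
  simp only [kernelOp_apply, ← h, ← integral_const_mul, ← integral_mul_const]
  refine integral_integral_swap (f := fun y η => planeWave η x * c (η, y) * f y) ?_ |>.trans ?_
  · have hi : Integrable fun p : Conf n × Conf n =>
        2 ^ (n + 1) * C * ((weight p.1 * ‖f p.1‖) * weight p.2) :=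
      ((memLp_weight_mul_norm f).mul_prod integrable_weight).const_mul _
    refine hi.mono' ?_ (Filter.Eventually.of_forall fun p => ?_)
    · refine AEStronglyMeasurable.mul (Continuous.aestronglyMeasurable ?_)
        (Lp.aestronglyMeasurable f).comp_fst
      exact (continuous_planeWave.comp (by fun_prop :
        Continuous fun p : Conf n × Conf n => (p.2, x))).mul (c.continuous.comp continuous_swap)
    · simp only [Function.uncurry, norm_mul]
      calc _ ≤ (2 ^ (n + 1) * 1) * (C * weight p.2 * weight p.1) * ‖f p.1‖ := by
            gcongr
            · exact (norm_planeWave_le _ _).trans (by gcongr; exact weight_le_one x)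
            · exact hb _ _
        _ = _ := by ring
  · simp only [mul_assoc]

/-- In the weak sense the operator is the integral over `η` of rank one operators, with the damped
plane wave as range and pairing with `c (η, ·)` as functional. -/
theorem inner_kernelCLM {K c : 𝓢(Conf n × Conf n, ℂ)}
    (h : ∀ x y, ∫ η, planeWave η x * c (η, y) = K (x, y)) (g f : L2 (Conf n)) :
    ⟪g, kernelCLM K f⟫_ℂ =
      ∫ η, ⟪g, (memLp_planeWave η).toLp⟫_ℂ * kernelOp c f η := by
  rw [kernelCLM_apply, L2.inner_def]
  have h1 : ∫ x, ⟪g x, (kernelOp K f).toLp 2 volume x⟫_ℂ =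
      ∫ x, ∫ η, (starRingEnd ℂ) (g x) * (planeWave η x * kernelOp c f η) := by
    refine integral_congr_ae ?_
    filter_upwards [(kernelOp K f).coeFn_toLp 2 volume] with x hx
    rw [hx, RCLike.inner_apply, kernelOp_eq_integral h, integral_const_mul, mul_comm]
  rw [h1, integral_integral_swap (integrable_planeWave_mul g (kernelOp c f))]
  simp only [inner_planeWave, ← integral_mul_const, mul_assoc]

theorem integrable_inner_planeWave_mul (g : L2 (Conf n)) (h : 𝓢(Conf n, ℂ)) :
    Integrable fun η => ⟪g, (memLp_planeWave η).toLp⟫_ℂ * h η := by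
  refine (integrable_planeWave_mul g h).integral_prod_right.congr
    (Filter.Eventually.of_forall fun η => ?_)
  simp only [inner_planeWave, ← integral_mul_const, mul_assoc]

/-- An operator with Schwartz kernel is trace class, and its trace in every Hilbert basis is the
integral of the kernel over the diagonal. -/
theorem hasSum_inner_kernelCLM {ι : Type} (b : HilbertBasis ι ℂ (L2 (Conf n)))
    (K : 𝓢(Conf n × Conf n, ℂ)) :
    HasSum (fun i => ⟪b i, kernelCLM K (b i)⟫_ℂ) (∫ y, K (y, y)) := by
  have := HilbertBasis.countable_of_separableSpace b
  obtain ⟨c, hc⟩ := exists_kernel_eq_integral K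
  obtain ⟨s, hs, C, hC⟩ := exists_memLp_conj_slice c
  let w : Conf n → L2 (Conf n) := fun η => (memLp_planeWave η).toLp
  have hw : ∀ η, ‖w η‖ ≤ 2 ^ (n + 1) * ‖(memLp_weight (n := n)).toLp‖ := fun η =>
    norm_toLp_le_of_norm_le_weight _ (norm_planeWave_le η)
  have hk : ∀ i η, kernelOp c (b i) η = ⟪s η, b i⟫_ℂ := fun i η => by rw [hs, kernelOp_apply]
  have hF : ∀ i, Integrable fun η => ⟪s η, b i⟫_ℂ * ⟪b i, w η⟫_ℂ := fun i => by
    refine (integrable_inner_planeWave_mul (b i) (kernelOp c (b i))).congr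
      (Filter.Eventually.of_forall fun η => ?_)
    simp only [hk, mul_comm, w]
  -- For fixed `η` the sum over any finite set of indices is at most `‖s η‖ * ‖w η‖`, which is
  -- bounded by a multiple of `weight η`, uniformly in the finite set.
  have hsum : Summable fun i => ∫ η, ‖⟪s η, b i⟫_ℂ * ⟪b i, w η⟫_ℂ‖ := by
    refine summable_of_sum_le (c := ∫ η : Conf n, C * weight η *
      (2 ^ (n + 1) * ‖(memLp_weight (n := n)).toLp‖))
      (fun i => integral_nonneg fun η => norm_nonneg _) fun u => ?_
    rw [← integral_finsetSum _ fun i _ => (hF i).norm]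
    refine integral_mono (integrable_finsetSum _ fun i _ => (hF i).norm)
      ((integrable_weight.const_mul C).mul_const _) fun η => ?_
    obtain ⟨h1, h2⟩ := summable_norm_inner_mul_inner b (s η) (w η)
    refine (h1.sum_le_tsum u fun i _ => norm_nonneg _).trans (h2.trans ?_)
    exact mul_le_mul (hC η) (hw η) (norm_nonneg _) ((norm_nonneg _).trans (hC η))
  have h := hasSum_integral_of_summable_integral_norm hF hsum
  -- Parseval collapses the sum to `⟨s η, w η⟩`, and exchanging the integrals over `η` and `y`
  -- reconstitutes the kernel on the diagonal.
  have hdiag : ∫ η, ∑' i, ⟪s η, b i⟫_ℂ * ⟪b i, w η⟫_ℂ = ∫ y, K (y, y) := by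
    have h1 : ∀ η, ∑' i, ⟪s η, b i⟫_ℂ * ⟪b i, w η⟫_ℂ = ∫ y, planeWave η y * c (η, y) := fun η => by
      rw [(b.hasSum_inner_mul_inner (s η) (w η)).tsum_eq, hs]
      refine integral_congr_ae ?_
      filter_upwards [(memLp_planeWave η).coeFn_toLp] with y hy
      rw [hy, mul_comm]
    simp only [h1, ← hc]
    refine integral_integral_swap (f := fun η y => planeWave η y * c (η, y)) ?_
    obtain ⟨C, hC, hb⟩ := exists_bound_weight_weight c
    have hi : Integrable fun p : Conf n × Conf n => 2 ^ (n + 1) * C * (weight p.1 * weight p.2) :=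
      (integrable_weight.mul_prod integrable_weight).const_mul _
    refine hi.mono' (continuous_planeWave.mul c.continuous).aestronglyMeasurable
      (Filter.Eventually.of_forall fun p => ?_)
    simp only [Function.uncurry, norm_mul]
    calc _ ≤ (2 ^ (n + 1) * 1) * (C * weight p.1 * weight p.2) := by
          gcongr
          · exact (norm_planeWave_le _ _).trans (by gcongr; exact weight_le_one _)
          · exact hb _ _
      _ = _ := by ring
  rw [hdiag] at h
  refine (congrArg (HasSum · _ _) (funext fun i => ?_)).mp h
  rw [inner_kernelCLM hc]
  refine integral_congr_ae (Filter.Eventually.of_forall fun η => ?_)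
  simp only [hk, mul_comm, w]

end Trace

/-! ### Integration by parts on phase space -/

section Parts

variable {n : ℕ}

instance isAddHaarMeasure_volume_phase :
    (volume : Measure (Phase n)).IsAddHaarMeasure :=
  inferInstanceAs ((volume : Measure (Conf n)).prod (volume : Measure (Conf n))).IsAddHaarMeasure

/-- Integration by parts against the constant function one. -/
theorem integral_lineDeriv_eq_zero (w : 𝓢(Phase n, ℂ)) (v : Phase n) : ∫ z, (∂_{v} w) z = 0 := by
  have h := integral_bilinear_hasLineDerivAt_right_eq_neg_left_of_integrable
    (μ := (volume : Measure (Phase n))) (B := ContinuousLinearMap.mul ℝ ℂ)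
    (f := fun _ => 1) (f' := fun _ => 0) (g := w) (g' := (∂_{v} w : 𝓢(Phase n, ℂ))) (v := v)
    (by simp) (by simpa using (∂_{v} w : 𝓢(Phase n, ℂ)).integrable) (by simpa using w.integrable)
    (fun x _ => (hasFDerivAt_const (𝕜 := ℝ) (1 : ℂ) x).hasLineDerivAt v)
    (fun x _ => (w.hasFDerivAt x).hasLineDerivAt v)
  simpa using h

theorem lineDeriv_posOp {W : Type} [NormedAddCommGroup W] [NormedSpace ℝ W] (l : W →L[ℝ] ℝ)
    (v : W) (φ : 𝓢(W, ℂ)) :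
    ∂_{v} (posOp l φ) = (l v : ℂ) • φ + posOp l (∂_{v} φ) := by
  ext z
  have h1 : HasFDerivAt (fun z => (l z : ℂ)) (ofRealCLM ∘L l) z := (ofRealCLM ∘L l).hasFDerivAt
  have h2 : HasFDerivAt (posOp l φ) _ z := (h1.mul (φ.hasFDerivAt z)).congr_of_eventuallyEq
    (Filter.Eventually.of_forall fun z => posOp_apply l φ z)
  rw [SchwartzMap.lineDerivOp_apply_eq_fderiv, h2.fderiv, add_apply, add_apply, posOp_apply,
    SchwartzMap.lineDerivOp_apply_eq_fderiv]
  simp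
  ring

theorem integral_mul_lineDeriv (l : Phase n →L[ℝ] ℝ) (v : Phase n) (w : 𝓢(Phase n, ℂ)) :
    ∫ z, (l z : ℂ) * (∂_{v} w) z = -(l v * ∫ z, w z) := by
  have h := integral_lineDeriv_eq_zero (posOp l w) v
  have h2 : ∀ z, (∂_{v} (posOp l w)) z = l v * w z + posOp l (∂_{v} w) z := fun z => by
    rw [lineDeriv_posOp]; rfl
  simp only [h2] at h
  rw [integral_add (w.integrable.const_mul _) (posOp l (∂_{v} w)).integrable,
    integral_const_mul] at h
  simp only [posOp_apply] at h
  linear_combination h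

end Parts

/-! ### The kernel of a Weyl operator -/

section Weyl

variable {n : ℕ}

theorem partialFourier_add {m : ℕ} (F F' : 𝓢(Conf m × Conf n, ℂ)) :
    partialFourier (F + F') = partialFourier F + partialFourier F' := by
  ext ⟨x, v⟩
  have h : slice (F + F') x = slice F x + slice F' x := rfl
  rw [add_apply]
  simp only [← slice_apply, slice_partialFourier, h, FourierTransform.fourier_add, add_apply]

theorem partialFourier_smul {m : ℕ} (c : ℂ) (F : 𝓢(Conf m × Conf n, ℂ)) :
    partialFourier (c • F) = c • partialFourier F := by
  ext ⟨x, v⟩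
  have h : slice (c • F) x = c • slice F x := rfl
  rw [smul_apply]
  simp only [← slice_apply, slice_partialFourier, h, FourierTransform.fourier_smul, smul_apply]

theorem hasFDerivAt_partialFourier' {m : ℕ} (F : 𝓢(Conf m × Conf n, ℂ)) (p : Conf m × Conf n) :
    HasFDerivAt (partialFourier F)
      (∑ i, (prodCoord i).smulRight (partialFourier (partialFourierDeriv i F) p)) p := by
  have h : ∀ (F : 𝓢(Conf m × Conf n, ℂ)) (p : Conf m × Conf n),
      partialFourier F p = 𝓕 (slice F p.1) p.2 := fun F p => by
    rw [← slice_partialFourier, slice_apply]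
  simp only [h]
  exact (hasFDerivAt_partialFourier F p).congr_of_eventuallyEq
    (Filter.Eventually.of_forall fun p => h F p)

/-- The change of variables `(y, y') ↦ ((y + y') / 2, -(y - y') / 2π)`. -/
def weylCoord (n : ℕ) : (Conf n × Conf n) ≃L[ℝ] (Conf n × Conf n) :=
  LinearEquiv.toContinuousLinearEquiv
    { toFun := fun p => ((1 / 2 : ℝ) • (p.1 + p.2), -(2 * Real.pi)⁻¹ • (p.1 - p.2))
      invFun := fun q => (q.1 - Real.pi • q.2, q.1 + Real.pi • q.2)
      map_add' := fun p q => by ext <;> simp <;> ring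
      map_smul' := fun c p => by ext <;> simp <;> ring
      left_inv := fun p => by
        have := Real.pi_ne_zero
        ext <;> simp <;> field_simp <;> ring
      right_inv := fun q => by
        have := Real.pi_ne_zero
        ext <;> simp <;> field_simp <;> ring }

theorem weylCoord_apply (p : Conf n × Conf n) :
    weylCoord n p = ((1 / 2 : ℝ) • (p.1 + p.2), -(2 * Real.pi)⁻¹ • (p.1 - p.2)) := rfl

/-- The kernel of the Weyl quantization of a Schwartz symbol. -/
def weylKernel (w : 𝓢(Phase n, ℂ)) : 𝓢(Conf n × Conf n, ℂ) :=
  (((2 * Real.pi : ℝ) : ℂ)⁻¹ ^ n) • SchwartzMap.compCLMOfContinuousLinearEquiv ℂ (weylCoord n)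
    (partialFourier w)

theorem weylKernel_apply' (w : 𝓢(Phase n, ℂ)) (p : Conf n × Conf n) :
    weylKernel w p = ((2 * Real.pi : ℝ) : ℂ)⁻¹ ^ n * partialFourier w (weylCoord n p) := rfl

theorem weylKernel_apply (w : 𝓢(Phase n, ℂ)) (x y : Conf n) :
    weylKernel w (x, y) = ((2 * Real.pi : ℝ) : ℂ)⁻¹ ^ n * ∫ ξ : Conf n,
      exp (I * (⟪ξ, x - y⟫_ℝ : ℂ)) * w ((1 / 2 : ℝ) • (x + y), ξ) := by
  rw [weylKernel_apply', weylCoord_apply, partialFourier_apply]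
  congr 1
  refine integral_congr_ae (Filter.Eventually.of_forall fun ξ => ?_)
  have := Real.pi_ne_zero
  have h : -2 * Real.pi * ⟪ξ, -(2 * Real.pi)⁻¹ • (x - y)⟫_ℝ = ⟪ξ, x - y⟫_ℝ := by
    rw [inner_smul_right]
    field_simp
  simp only [h, mul_comm I]

/-- The Hamiltonian vector of a phase space coordinate. -/
def hamVec (a : Fin n ⊕ Fin n) : Phase n :=
  Sum.elim (fun j => (0, EuclideanSpace.single j (1 : ℝ)))
    (fun j => (-EuclideanSpace.single j (1 : ℝ), 0)) a

/-- The Moyal product `u_a ⋆ w = u_a w + (i/2) {u_a, w}` with a phase space coordinate. -/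
def moyal (a : Fin n ⊕ Fin n) (w : 𝓢(Phase n, ℂ)) : 𝓢(Phase n, ℂ) :=
  posOp (prodCoord a) w + (I / 2) • ∂_{hamVec a} w

theorem fderiv_weylKernel (w : 𝓢(Phase n, ℂ)) (p v : Conf n × Conf n) :
    fderiv ℝ (weylKernel w) p v = ((2 * Real.pi : ℝ) : ℂ)⁻¹ ^ n *
      ∑ i, (prodCoord i (weylCoord n v) : ℂ) *
        partialFourier (partialFourierDeriv i w) (weylCoord n p) := by
  have h := ((hasFDerivAt_partialFourier' w (weylCoord n p)).comp p
    (weylCoord n).hasFDerivAt).const_mul (((2 * Real.pi : ℝ) : ℂ)⁻¹ ^ n)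
  have h2 : HasFDerivAt (weylKernel w) _ p := h
  rw [h2.fderiv, smul_apply, smul_eq_mul, ContinuousLinearMap.comp_apply, sum_apply]
  simp only [ContinuousLinearMap.smulRight_apply, real_smul]
  rfl

theorem coord_mul_partialFourier {m : ℕ} (F : 𝓢(Conf m × Conf n, ℂ)) (p : Conf m × Conf n)
    (j : Fin n) : (2 * Real.pi * I) * ((p.2 j : ℂ) * partialFourier F p) =
      partialFourier (∂_{((0 : Conf m), (EuclideanSpace.single j (1 : ℝ) : Conf n))} F) p := by
  have h := coord_mul_fourier_slice F p.1 p.2 j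
  rwa [← slice_partialFourier, ← slice_partialFourier] at h

theorem coord_mul_partialFourier_fst {m : ℕ} (F : 𝓢(Conf m × Conf n, ℂ)) (p : Conf m × Conf n)
    (j : Fin m) : (p.1 j : ℂ) * partialFourier F p =
      partialFourier (posOp (prodCoord (Sum.inl j)) F) p := by
  rw [partialFourier_apply F p.1 p.2, partialFourier_apply _ p.1 p.2, ← integral_const_mul]
  refine integral_congr_ae (Filter.Eventually.of_forall fun η => ?_)
  simp only [posOp_apply]
  have : prodCoord (Sum.inl j) (p.1, η) = p.1 j := rfl
  rw [this]
  ring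

/-- In the variables `m = (x + y) / 2`, `v = -(x - y) / 2π` one has `x = m - π v`, and
multiplication by `v` is a momentum derivative of the symbol. Likewise `∂/∂x` is half the derivative
in `m` minus `(2π)⁻¹` times the derivative in `v`, and the latter is multiplication of the symbol by
the momentum. This is composition of operators read off on symbols. -/
theorem sysOp_weylKernel (a : Fin n ⊕ Fin n) (w : 𝓢(Phase n, ℂ)) :
    sysOp a (weylKernel w) = weylKernel (moyal a w) := by
  have hpi : (Real.pi : ℂ) ≠ 0 := ofReal_ne_zero.2 Real.pi_ne_zero
  ext p
  rw [weylKernel_apply' (moyal a w), moyal, partialFourier_add, add_apply, partialFourier_smul,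
    smul_apply]
  cases a with
  | inl j =>
    have h1 : (sysOp (Sum.inl j) (weylKernel w)) p = (p.1 j : ℂ) * weylKernel w p :=
      posOp_apply _ _ _
    have h2 : (p.1 j : ℂ) = ((weylCoord n p).1 j : ℂ) - Real.pi * ((weylCoord n p).2 j : ℂ) := by
      rw [weylCoord_apply]
      simp
      field_simp
      ring
    rw [h1, h2, weylKernel_apply', hamVec, Sum.elim_inl, ← coord_mul_partialFourier,
      ← coord_mul_partialFourier_fst, smul_eq_mul]
    linear_combination (((2 * Real.pi : ℝ) : ℂ)⁻¹ ^ n) * (-Real.pi * ((weylCoord n p).2 j : ℂ) *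
      partialFourier w (weylCoord n p)) * I_sq
  | inr j =>
    have h1 : (sysOp (Sum.inr j) (weylKernel w)) p =
      -I * fderiv ℝ (weylKernel w) p (EuclideanSpace.single j (1 : ℝ), 0) := momOp_apply _ _ _
    have h2 : hamVec (Sum.inr j : Fin n ⊕ Fin n) =
        -((EuclideanSpace.single j (1 : ℝ) : Conf n), (0 : Conf n)) := by
      simp [hamVec]
    have h3 : ∂_{hamVec (Sum.inr j)} w =
        (-1 : ℂ) • ∂_{((EuclideanSpace.single j (1 : ℝ) : Conf n), (0 : Conf n))} w := by
      rw [h2, LineDeriv.lineDerivOp_left_neg, neg_one_smul]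
    have hl : ∀ i, prodCoord (Sum.inl i) (weylCoord n (EuclideanSpace.single j (1 : ℝ), 0)) =
        if i = j then 1 / 2 else 0 := fun i => by
      change ((1 / 2 : ℝ) • (EuclideanSpace.single j (1 : ℝ) + 0) : Conf n) i = _
      simp
    have hr : ∀ i, prodCoord (Sum.inr i) (weylCoord n (EuclideanSpace.single j (1 : ℝ), 0)) =
        if i = j then -(2 * Real.pi)⁻¹ else 0 := fun i => by
      change (-(2 * Real.pi)⁻¹ • (EuclideanSpace.single j (1 : ℝ) - 0) : Conf n) i = _
      by_cases hij : i = j <;> simp [hij]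
    rw [h1, h3, fderiv_weylKernel, Fintype.sum_sum_type]
    simp only [hl, hr, apply_ite ofReal, ofReal_zero, ite_mul, zero_mul, Finset.sum_ite_eq',
      Finset.mem_univ, if_true, partialFourierDeriv, Sum.elim_inl, Sum.elim_inr,
      partialFourier_smul, smul_apply, smul_eq_mul]
    push_cast
    field_simp
    linear_combination (-2 * partialFourier (posOp (prodCoord (Sum.inr j)) w) (weylCoord n p)) * I_sq

theorem integral_weylKernel_diag (w : 𝓢(Phase n, ℂ)) :
    ∫ y, weylKernel w (y, y) = ((2 * Real.pi : ℝ) : ℂ)⁻¹ ^ n * ∫ z, w z := by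
  have h : ∫ z, w z = ∫ y, ∫ ξ, w (y, ξ) := integral_prod _ (w.integrable (μ := volume))
  simp only [weylKernel_apply, sub_self, inner_zero_right, ofReal_zero, mul_zero, exp_zero,
    one_mul, integral_const_mul, h]
  congr 1
  refine integral_congr_ae (Filter.Eventually.of_forall fun y => ?_)
  have : (1 / 2 : ℝ) • (y + y) = y := by rw [← two_smul ℝ y, smul_smul]; norm_num
  simp only [this]

theorem integral_moyal (a : Fin n ⊕ Fin n) (w : 𝓢(Phase n, ℂ)) :
    ∫ z, moyal a w z = ∫ z, (coord a z : ℂ) * w z := by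
  have h : ∀ z, moyal a w z = posOp (prodCoord a) w z + (I / 2) * (∂_{hamVec a} w) z :=
    fun z => rfl
  simp only [h]
  rw [integral_add (SchwartzMap.integrable (μ := volume) _) ((SchwartzMap.integrable _).const_mul _),
    integral_const_mul, integral_lineDeriv_eq_zero, mul_zero, add_zero]
  refine integral_congr_ae (Filter.Eventually.of_forall fun z => ?_)
  rw [posOp_apply]
  cases a <;> rfl

theorem prodCoord_eq_coord (a : Fin n ⊕ Fin n) (z : Phase n) : prodCoord a z = coord a z := by
  cases a <;> rfl

theorem coord_hamVec (a b : Fin n ⊕ Fin n) :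
    prodCoord a (hamVec b) = Matrix.J (Fin n) ℝ a b := by
  rcases a with a | a <;> rcases b with b | b <;>
    simp [prodCoord, hamVec, Matrix.J, Matrix.one_apply]

/-- The outer Poisson bracket integrates to zero. The inner one, integrated by parts against `coord
a`, leaves the symplectic product of the two coordinates, that is half the canonical commutator. -/
theorem integral_moyal_moyal (a b : Fin n ⊕ Fin n) (w : 𝓢(Phase n, ℂ)) :
    ∫ z, moyal a (moyal b w) z = (∫ z, (coord a z : ℂ) * (coord b z * w z)) -
      (I / 2) * (Matrix.J (Fin n) ℝ a b * ∫ z, w z) := by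
  have h : ∀ z, (coord a z : ℂ) * moyal b w z = posOp (prodCoord a) (posOp (prodCoord b) w) z +
      (I / 2) * ((prodCoord a z : ℂ) * (∂_{hamVec b} w) z) := fun z => by
    have : moyal b w z = posOp (prodCoord b) w z + (I / 2) * (∂_{hamVec b} w) z := rfl
    rw [this, posOp_apply (prodCoord a), prodCoord_eq_coord]
    ring
  have hi : Integrable fun z => (prodCoord a z : ℂ) * (∂_{hamVec b} w) z := by
    refine ((posOp (prodCoord a) (∂_{hamVec b} w : 𝓢(Phase n, ℂ))).integrable
      (μ := volume)).congr (Filter.Eventually.of_forall fun z => posOp_apply _ _ z)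
  rw [integral_moyal]
  simp only [h]
  rw [integral_add (SchwartzMap.integrable (μ := volume) _) (hi.const_mul _), integral_const_mul,
    integral_mul_lineDeriv, coord_hamVec]
  simp only [posOp_apply, prodCoord_eq_coord]
  ring

end Weyl

/-! ### Tensor products of Schwartz functions -/

section SchwartzTensor

variable {m n : ℕ}

theorem hasFDerivAt_schwartz_coord (f : 𝓢(Conf m, ℂ)) (x : Conf m) :
    HasFDerivAt f (∑ j, (EuclideanSpace.proj j : Conf m →L[ℝ] ℝ).smulRight
      ((∂_{(EuclideanSpace.single j (1 : ℝ) : Conf m)} f) x)) x := by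
  refine (f.hasFDerivAt x).congr_fderiv ?_
  ext v
  conv_lhs => rw [← sum_coord_smul_single v]
  rw [map_sum, sum_apply]
  refine Finset.sum_congr rfl fun j _ => ?_
  rw [map_smul, SchwartzMap.lineDerivOp_apply_eq_fderiv]
  rfl

/-- The family closed under differentiation consists of all pairs, each derivative acting on one
member of the pair. -/
theorem exists_schwartzTensor (p : 𝓢(Conf m, ℂ) × 𝓢(Conf n, ℂ)) :
    ∃ φ : 𝓢(Conf m × Conf n, ℂ), ∀ z : Conf m × Conf n, φ z = p.1 z.1 * p.2 z.2 := by
  refine exists_schwartzMap_family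
    (f := fun (p : 𝓢(Conf m, ℂ) × 𝓢(Conf n, ℂ)) (z : Conf m × Conf n) => p.1 z.1 * p.2 z.2)
    (l := prodCoord)
    (D := fun i p => Sum.elim
      (fun j => (∂_{(EuclideanSpace.single j (1 : ℝ) : Conf m)} p.1, p.2))
      (fun j => (p.1, ∂_{(EuclideanSpace.single j (1 : ℝ) : Conf n)} p.2)) i)
    (fun p z => ?_) (fun p k => ?_) p
  · have h1 := (hasFDerivAt_schwartz_coord p.1 z.1).comp z (hasFDerivAt_fst (𝕜 := ℝ) (p := z))
    have h2 := (hasFDerivAt_schwartz_coord p.2 z.2).comp z (hasFDerivAt_snd (𝕜 := ℝ) (p := z))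
    refine (h1.mul h2).congr_fderiv (ContinuousLinearMap.ext fun v => ?_)
    simp only [add_apply, smul_apply, smul_eq_mul, ContinuousLinearMap.comp_apply, sum_apply,
      ContinuousLinearMap.smulRight_apply, Fintype.sum_sum_type, prodCoord, Sum.elim_inl,
      Sum.elim_inr, Finset.mul_sum, Function.comp_apply, real_smul]
    rw [add_comm]
    congr 1 <;> refine Finset.sum_congr rfl fun j _ => ?_ <;> ring
  · obtain ⟨C, hC⟩ := p.1.decay k 0
    obtain ⟨C', hC'⟩ := p.2.decay k 0
    obtain ⟨D, hD⟩ := p.1.decay 0 0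
    obtain ⟨D', hD'⟩ := p.2.decay 0 0
    simp only [norm_iteratedFDeriv_zero, pow_zero, one_mul] at hC hC' hD hD'
    refine ⟨max (C * D') (D * C'), fun z => ?_⟩
    rw [norm_mul]
    rcases le_total ‖z.1‖ ‖z.2‖ with h | h
    · rw [Prod.norm_def, max_eq_right h, mul_left_comm]
      exact (mul_le_mul (hD.2 _) (hC'.2 _) (by positivity)
        hD.1.le).trans (le_max_right _ _)
    · rw [Prod.norm_def, max_eq_left h, ← mul_assoc]
      exact (mul_le_mul (hC.2 _) (hD'.2 _) (norm_nonneg _) hC.1.le).trans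
        (le_max_left _ _)

/-- The tensor product `(x, y) ↦ f x * g y` of Schwartz functions. -/
def schwartzTensor (f : 𝓢(Conf m, ℂ)) (g : 𝓢(Conf n, ℂ)) : 𝓢(Conf m × Conf n, ℂ) :=
  (exists_schwartzTensor (f, g)).choose

theorem schwartzTensor_apply (f : 𝓢(Conf m, ℂ)) (g : 𝓢(Conf n, ℂ)) (z : Conf m × Conf n) :
    schwartzTensor f g z = f z.1 * g z.2 :=
  (exists_schwartzTensor (f, g)).choose_spec z

theorem toLp_schwartzTensor (f : 𝓢(Conf m, ℂ)) (g : 𝓢(Conf n, ℂ)) :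
    (schwartzTensor f g).toLp 2 volume = tensor (f.toLp 2 volume) (g.toLp 2 volume) := by
  apply Lp.ext
  filter_upwards [(schwartzTensor f g).coeFn_toLp 2 volume,
    coeFn_tensor (f.toLp 2 volume) (g.toLp 2 volume), ae_fst (N := n) (f.coeFn_toLp 2 volume),
    ae_snd (d := m) (g.coeFn_toLp 2 volume)] with z h1 h2 h3 h4
  rw [h1, h2, h3, h4, schwartzTensor_apply]

theorem fderiv_schwartzTensor (f : 𝓢(Conf m, ℂ)) (g : 𝓢(Conf n, ℂ)) (z v : Conf m × Conf n) :
    fderiv ℝ (schwartzTensor f g) z v =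
      f z.1 * fderiv ℝ g z.2 v.2 + fderiv ℝ f z.1 v.1 * g z.2 := by
  have h1 := (f.hasFDerivAt z.1).comp z (hasFDerivAt_fst (𝕜 := ℝ) (p := z))
  have h2 := (g.hasFDerivAt z.2).comp z (hasFDerivAt_snd (𝕜 := ℝ) (p := z))
  have h : HasFDerivAt (schwartzTensor f g) _ z := (h1.mul h2).congr_of_eventuallyEq
    (Filter.Eventually.of_forall fun z => schwartzTensor_apply f g z)
  rw [h.fderiv]
  simp [mul_comm]

theorem sysOp_schwartzTensor (a : Fin m ⊕ Fin m) (f : 𝓢(Conf m, ℂ)) (g : 𝓢(Conf n, ℂ)) :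
    sysOp a (schwartzTensor f g) = schwartzTensor (phaseOp a f) g := by
  ext z
  rw [schwartzTensor_apply]
  cases a with
  | inl j =>
    refine (posOp_apply _ _ _).trans ?_
    rw [schwartzTensor_apply, ← mul_assoc]
    congr 1
    exact (posOp_apply (EuclideanSpace.proj j : Conf m →L[ℝ] ℝ) f z.1).symm
  | inr j =>
    refine (momOp_apply _ _ _).trans ?_
    rw [fderiv_schwartzTensor, map_zero, mul_zero, zero_add, ← mul_assoc]
    rfl

theorem envOp_schwartzTensor (a : Fin n ⊕ Fin n) (f : 𝓢(Conf m, ℂ)) (g : 𝓢(Conf n, ℂ)) :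
    envOp a (schwartzTensor f g) = schwartzTensor f (phaseOp a g) := by
  ext z
  rw [schwartzTensor_apply]
  cases a with
  | inl j =>
    refine (posOp_apply _ _ _).trans ?_
    rw [schwartzTensor_apply, mul_left_comm]
    congr 1
    exact (posOp_apply (EuclideanSpace.proj j : Conf n →L[ℝ] ℝ) g z.2).symm
  | inr j =>
    refine (momOp_apply _ _ _).trans ?_
    rw [fderiv_schwartzTensor, map_zero, zero_mul, add_zero, mul_left_comm]
    rfl

end SchwartzTensor

/-! ### The Wigner function as a Weyl symbol -/

section Wigner

variable {n : ℕ}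

/-- The complex conjugate of a Schwartz function. -/
def schwartzConj (f : 𝓢(Conf n, ℂ)) : 𝓢(Conf n, ℂ) :=
  SchwartzMap.postcompCLM (𝕜 := ℝ) (conjCLE : ℂ →L[ℝ] ℂ) f

theorem schwartzConj_apply (f : 𝓢(Conf n, ℂ)) (x : Conf n) :
    schwartzConj f x = (starRingEnd ℂ) (f x) := rfl

/-- The change of variables `(x, y) ↦ (x + y / 2, x - y / 2)`. -/
def wignerCoord (n : ℕ) : (Conf n × Conf n) ≃L[ℝ] (Conf n × Conf n) :=
  LinearEquiv.toContinuousLinearEquiv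
    { toFun := fun p => (p.1 + (1 / 2 : ℝ) • p.2, p.1 - (1 / 2 : ℝ) • p.2)
      invFun := fun q => ((1 / 2 : ℝ) • (q.1 + q.2), q.1 - q.2)
      map_add' := fun p q => by ext <;> simp <;> ring
      map_smul' := fun c p => by ext <;> simp <;> ring
      left_inv := fun p => by ext <;> simp <;> ring
      right_inv := fun q => by ext <;> simp <;> ring }

/-- The change of variables `(x, ξ) ↦ (x, ξ / 2π)`. -/
def scaleCoord (n : ℕ) : (Conf n × Conf n) ≃L[ℝ] (Conf n × Conf n) :=
  LinearEquiv.toContinuousLinearEquiv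
    { toFun := fun p => (p.1, (2 * Real.pi)⁻¹ • p.2)
      invFun := fun q => (q.1, (2 * Real.pi) • q.2)
      map_add' := fun p q => by simp
      map_smul' := fun c p => by simp [smul_comm c]
      left_inv := fun p => by
        simp only [smul_smul, mul_inv_cancel₀ Real.two_pi_pos.ne', one_smul]
      right_inv := fun q => by
        simp only [smul_smul, inv_mul_cancel₀ Real.two_pi_pos.ne', one_smul] }

/-- The function `(x, y) ↦ ψ (x + y / 2) conj (ψ (x - y / 2))`. -/
def wignerIntegrand (ψ : 𝓢(Conf n, ℂ)) : 𝓢(Conf n × Conf n, ℂ) :=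
  SchwartzMap.compCLMOfContinuousLinearEquiv ℂ (wignerCoord n) (schwartzTensor ψ (schwartzConj ψ))

theorem wignerIntegrand_apply (ψ : 𝓢(Conf n, ℂ)) (x y : Conf n) :
    wignerIntegrand ψ (x, y) =
      ψ (x + (1 / 2 : ℝ) • y) * (starRingEnd ℂ) (ψ (x - (1 / 2 : ℝ) • y)) :=
  schwartzTensor_apply _ _ _

/-- The Wigner function as a Schwartz function. -/
def wignerSchwartz (ψ : 𝓢(Conf n, ℂ)) : 𝓢(Phase n, ℂ) :=
  SchwartzMap.compCLMOfContinuousLinearEquiv ℂ (scaleCoord n) (partialFourier (wignerIntegrand ψ))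

theorem wignerSchwartz_apply' (ψ : 𝓢(Conf n, ℂ)) (z : Phase n) :
    wignerSchwartz ψ z = partialFourier (wignerIntegrand ψ) (z.1, (2 * Real.pi)⁻¹ • z.2) := rfl

theorem wignerSchwartz_apply (ψ : 𝓢(Conf n, ℂ)) (z : Phase n) :
    wignerSchwartz ψ z = ∫ y : Conf n, exp (-I * (⟪z.2, y⟫_ℝ : ℂ)) * ψ (z.1 + (1 / 2 : ℝ) • y) *
      (starRingEnd ℂ) (ψ (z.1 - (1 / 2 : ℝ) • y)) := by
  rw [wignerSchwartz_apply', partialFourier_apply]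
  refine integral_congr_ae (Filter.Eventually.of_forall fun y => ?_)
  have := Real.pi_ne_zero
  have h : -2 * Real.pi * ⟪y, (2 * Real.pi)⁻¹ • z.2⟫_ℝ = -⟪z.2, y⟫_ℝ := by
    rw [inner_smul_right, real_inner_comm]
    field_simp
  simp only [h, wignerIntegrand_apply, mul_assoc]
  congr 2
  push_cast
  ring

/-- Conjugation of the integrand is undone by the substitution `y ↦ -y`, so the integral is real and
taking the real part loses nothing. -/
theorem ofReal_wigner (ψ : 𝓢(Conf n, ℂ)) (z : Phase n) : (wigner ψ z : ℂ) = wignerSchwartz ψ z := by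
  rw [wigner, ← wignerSchwartz_apply, ← conj_eq_iff_re, wignerSchwartz_apply, ← integral_conj,
    ← integral_neg_eq_self]
  refine integral_congr_ae (Filter.Eventually.of_forall fun y => ?_)
  simp only [map_mul, conj_conj, ← exp_conj, map_neg, conj_I, conj_ofReal, inner_neg_right,
    smul_neg, sub_neg_eq_add, ← sub_eq_add_neg]
  push_cast
  simp only [neg_neg, mul_neg, neg_mul]
  ring

/-- The Wigner function is the Weyl symbol of the projector. -/
theorem weylKernel_wignerSchwartz (ψ : 𝓢(Conf n, ℂ)) :
    weylKernel (wignerSchwartz ψ) = schwartzTensor ψ (schwartzConj ψ) := by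
  ext ⟨x, y⟩
  have hpi : (0 : ℝ) < 2 * Real.pi := by positivity
  have h1 : ∫ ξ : Conf n, exp (I * (⟪ξ, x - y⟫_ℝ : ℂ)) *
      wignerSchwartz ψ ((1 / 2 : ℝ) • (x + y), ξ) =
      (((2 * Real.pi) ^ n : ℝ) : ℂ) * wignerIntegrand ψ ((1 / 2 : ℝ) • (x + y), x - y) := by
    rw [← integral_exp_mul_partialFourier, ← real_smul]
    have h2 := Measure.integral_comp_inv_smul_of_nonneg (volume : Measure (Conf n))
      (fun v => exp (((2 * Real.pi * ⟪v, x - y⟫_ℝ : ℝ) : ℂ) * I) *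
        partialFourier (wignerIntegrand ψ) ((1 / 2 : ℝ) • (x + y), v)) hpi.le
    rw [finrank_euclideanSpace_fin] at h2
    rw [← h2]
    refine integral_congr_ae (Filter.Eventually.of_forall fun ξ => ?_)
    have h3 : 2 * Real.pi * ⟪(2 * Real.pi)⁻¹ • ξ, x - y⟫_ℝ = ⟪ξ, x - y⟫_ℝ := by
      rw [real_inner_smul_left]
      field_simp
    simp only [h3, wignerSchwartz_apply', mul_comm I]
  have h4 : (1 / 2 : ℝ) • (x + y) + (1 / 2 : ℝ) • (x - y) = x := by module
  have h5 : (1 / 2 : ℝ) • (x + y) - (1 / 2 : ℝ) • (x - y) = y := by module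
  rw [weylKernel_apply, h1, wignerIntegrand_apply, h4, h5, schwartzTensor_apply,
    schwartzConj_apply, ← mul_assoc]
  have h6 : ((2 * Real.pi : ℝ) : ℂ) ≠ 0 := ofReal_ne_zero.2 hpi.ne'
  push_cast at h6 ⊢
  rw [inv_pow, inv_mul_cancel₀ (pow_ne_zero _ h6), one_mul]

end Wigner

/-! ### Weyl operators as kernel operators, and their moments as phase space integrals -/

section Moments

variable {n : ℕ}

/-- The Weyl formula prescribes the operator only on Schwartz functions. These are dense in `L²`,
and both sides are bounded. -/
theorem eq_kernelCLM_weylKernel {T : L2 (Conf n) →L[ℂ] L2 (Conf n)} {a : Phase n → ℝ}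
    (hT : HasWeylSymbol T a) {w : 𝓢(Phase n, ℂ)} (hw : ∀ z, w z = a z) :
    T = kernelCLM (weylKernel w) := by
  have hd : DenseRange (SchwartzMap.toLpCLM ℂ ℂ 2 (volume : Measure (Conf n))) :=
    SchwartzMap.denseRange_toLpCLM (by simp)
  refine DFunLike.coe_injective (hd.equalizer T.continuous (kernelCLM (weylKernel w)).continuous
    (funext fun φ => ?_))
  change T (φ.toLp 2) = kernelCLM (weylKernel w) (φ.toLp 2)
  apply Lp.ext
  rw [kernelCLM_apply]
  filter_upwards [hT φ, (kernelOp (weylKernel w) (φ.toLp 2)).coeFn_toLp 2 volume] with x h1 h2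
  rw [h1, h2, kernelOp_apply, ← integral_const_mul]
  refine integral_congr_ae ?_
  filter_upwards [φ.coeFn_toLp 2 volume] with y hy
  rw [hy, weylKernel_apply, integral_mul_const, mul_assoc]
  simp only [hw]

variable {w : 𝓢(Phase n, ℂ)} {a : Phase n → ℝ}

theorem integral_weylKernel_diag_eq (hw : ∀ z, w z = a z) :
    ∫ y, weylKernel w (y, y) = ((∫ z, quasiProb a z : ℝ) : ℂ) := by
  rw [integral_weylKernel_diag, ← integral_const_mul, ← integral_complex_ofReal]
  refine integral_congr_ae (Filter.Eventually.of_forall fun z => ?_)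
  simp only [quasiProb, hw]
  push_cast
  rfl

theorem integral_sysOp_weylKernel_diag (hw : ∀ z, w z = a z) (i : Fin n ⊕ Fin n) :
    ∫ y, sysOp i (weylKernel w) (y, y) = (mean (quasiProb a) i : ℂ) := by
  rw [sysOp_weylKernel, integral_weylKernel_diag, integral_moyal, ← integral_const_mul, mean,
    ← integral_complex_ofReal]
  refine integral_congr_ae (Filter.Eventually.of_forall fun z => ?_)
  simp only [quasiProb, hw]
  push_cast
  ring

theorem integral_sysOp_sysOp_weylKernel_diag (hw : ∀ z, w z = a z) (i j : Fin n ⊕ Fin n) :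
    ∫ y, sysOp i (sysOp j (weylKernel w)) (y, y) =
      ((∫ z, coord i z * coord j z * quasiProb a z : ℝ) : ℂ) -
        (I / 2) * (Matrix.J (Fin n) ℝ i j * ((∫ z, quasiProb a z : ℝ) : ℂ)) := by
  rw [sysOp_weylKernel, sysOp_weylKernel, integral_weylKernel_diag, integral_moyal_moyal, mul_sub,
    ← integral_const_mul, ← integral_weylKernel_diag_eq hw, integral_weylKernel_diag,
    ← integral_complex_ofReal]
  congr 1
  · refine integral_congr_ae (Filter.Eventually.of_forall fun z => ?_)
    simp only [quasiProb, hw]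
    push_cast
    ring
  · ring

end Moments

/-! ### Symmetric operators on Schwartz functions -/

section SymmOp

variable {n : ℕ}

/-- Symmetric operators on the Schwartz space. -/
def IsSymmOp (A : 𝓢(Conf n, ℂ) →L[ℂ] 𝓢(Conf n, ℂ)) : Prop :=
  ∀ f g : 𝓢(Conf n, ℂ), ⟪f.toLp 2 volume, (A g).toLp 2 volume⟫_ℂ =
    ⟪(A f).toLp 2 volume, g.toLp 2 volume⟫_ℂ

theorem isSymmOp_id : IsSymmOp (ContinuousLinearMap.id ℂ 𝓢(Conf n, ℂ)) := fun _ _ => rfl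

theorem inner_toLp_toLp (f g : 𝓢(Conf n, ℂ)) :
    ⟪f.toLp 2 volume, g.toLp 2 volume⟫_ℂ = ∫ x, g x * (starRingEnd ℂ) (f x) :=
  SchwartzMap.inner_toL2_toL2_eq f g volume

theorem isSymmOp_posOp (l : Conf n →L[ℝ] ℝ) : IsSymmOp (posOp l) := fun f g => by
  rw [inner_toLp_toLp, inner_toLp_toLp]
  refine integral_congr_ae (Filter.Eventually.of_forall fun x => ?_)
  simp only [posOp_apply, map_mul, conj_ofReal]
  ring

theorem isSymmOp_momOp (v : Conf n) : IsSymmOp (momOp v) := fun f g => by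
  have h := SchwartzMap.integral_bilinear_lineDerivOp_right_eq_neg_left
    (μ := (volume : Measure (Conf n))) f g
    ((ContinuousLinearMap.mul ℝ ℂ).comp (conjCLE : ℂ →L[ℝ] ℂ)) v
  rw [inner_toLp_toLp, inner_toLp_toLp]
  have h1 : ∀ (f : 𝓢(Conf n, ℂ)) x, momOp v f x = -I * (∂_{v} f) x := fun f x => rfl
  simp only [h1, map_mul, map_neg, conj_I, neg_neg]
  have h2 : ∫ x, (starRingEnd ℂ) (f x) * (∂_{v} g) x =
      -∫ x, (starRingEnd ℂ) ((∂_{v} f) x) * g x := h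
  have h3 : ∀ x, -I * (∂_{v} g) x * (starRingEnd ℂ) (f x) =
      -I * ((starRingEnd ℂ) (f x) * (∂_{v} g) x) := fun x => by ring
  have h4 : ∀ x, g x * (I * (starRingEnd ℂ) ((∂_{v} f) x)) =
      I * ((starRingEnd ℂ) ((∂_{v} f) x) * g x) := fun x => by ring
  simp only [h3, h4, integral_const_mul, h2]
  ring

theorem isSymmOp_phaseOp (a : Fin n ⊕ Fin n) : IsSymmOp (phaseOp a) := by
  cases a with
  | inl j => exact isSymmOp_posOp _
  | inr j => exact isSymmOp_momOp _

theorem toLp_sum {W ι : Type} [NormedAddCommGroup W] [NormedSpace ℝ W] [MeasureSpace W]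
    [BorelSpace W] [SecondCountableTopology W] [(volume : Measure W).HasTemperateGrowth]
    (s : Finset ι) (φ : ι → 𝓢(W, ℂ)) :
    (∑ i ∈ s, φ i).toLp 2 volume = ∑ i ∈ s, (φ i).toLp 2 volume :=
  map_sum (SchwartzMap.toLpCLM ℂ ℂ 2 (volume : Measure W)) φ s

/-- The Weyl quantization of the quadratic form `½ z · M z` for symmetric `M`. -/
def quadOp (M : Matrix (Fin n ⊕ Fin n) (Fin n ⊕ Fin n) ℝ) : 𝓢(Conf n, ℂ) →L[ℂ] 𝓢(Conf n, ℂ) :=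
  (1 / 2 : ℂ) • ∑ a, ∑ b, (M a b : ℂ) • (phaseOp a ∘L phaseOp b)

theorem quadOp_apply (M : Matrix (Fin n ⊕ Fin n) (Fin n ⊕ Fin n) ℝ) (f : 𝓢(Conf n, ℂ)) :
    quadOp M f = (1 / 2 : ℂ) • ∑ a, ∑ b, (M a b : ℂ) • phaseOp a (phaseOp b f) := by
  simp only [quadOp, smul_apply, sum_apply, ContinuousLinearMap.comp_apply]

/-- Passing to the adjoint reverses the order of the two coordinates, which the symmetry of `M`
absorbs. -/
theorem isSymmOp_quadOp {M : Matrix (Fin n ⊕ Fin n) (Fin n ⊕ Fin n) ℝ} (hM : M.IsSymm) :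
    IsSymmOp (quadOp M) := fun f g => by
  have h2 : (starRingEnd ℂ) (1 / 2 : ℂ) = 1 / 2 := by
    rw [map_div₀, map_one, map_ofNat]
  simp only [quadOp_apply, toLp_smul, toLp_sum, inner_smul_right, inner_smul_left, inner_sum,
    sum_inner, conj_ofReal, h2]
  rw [Finset.sum_comm]
  congr 1
  refine Finset.sum_congr rfl fun a _ => Finset.sum_congr rfl fun b _ => ?_
  rw [isSymmOp_phaseOp, isSymmOp_phaseOp, hM.apply a b]

end SymmOp

/-! ### Lifting operators to kernels -/

section Lift

variable {m n : ℕ}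

/-- The operator `B` on kernels corresponds to composition with `A`. -/
def IsLift (A : 𝓢(Conf m, ℂ) →L[ℂ] 𝓢(Conf m, ℂ))
    (B : 𝓢(Conf m × Conf n, ℂ) →L[ℂ] 𝓢(Conf m × Conf n, ℂ)) : Prop :=
  ∀ K f, A (kernelOp K f) = kernelOp (B K) f

theorem isLift_id : IsLift (ContinuousLinearMap.id ℂ 𝓢(Conf m, ℂ))
    (ContinuousLinearMap.id ℂ 𝓢(Conf m × Conf n, ℂ)) := fun _ _ => rfl

theorem isLift_phaseOp (a : Fin m ⊕ Fin m) : IsLift (n := n) (phaseOp a) (sysOp a) :=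
  fun K f => phaseOp_kernelOp K f a

theorem IsLift.comp {A A' : 𝓢(Conf m, ℂ) →L[ℂ] 𝓢(Conf m, ℂ)}
    {B B' : 𝓢(Conf m × Conf n, ℂ) →L[ℂ] 𝓢(Conf m × Conf n, ℂ)} (h : IsLift A B)
    (h' : IsLift A' B') : IsLift (A ∘L A') (B ∘L B') := fun K f => by
  rw [ContinuousLinearMap.comp_apply, h', h, ContinuousLinearMap.comp_apply]

theorem kernelOp_sum {ι : Type} (s : Finset ι) (K : ι → 𝓢(Conf m × Conf n, ℂ)) (f : L2 (Conf n)) :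
    kernelOp (∑ i ∈ s, K i) f = ∑ i ∈ s, kernelOp (K i) f :=
  map_sum ({ toFun := fun K => kernelOp K f
             map_zero' := by simpa using kernelOp_smul 0 (0 : 𝓢(Conf m × Conf n, ℂ)) f
             map_add' := fun K K' => kernelOp_add K K' f } :
    𝓢(Conf m × Conf n, ℂ) →+ 𝓢(Conf m, ℂ)) K s

/-- The lift of `quadOp` to kernels. -/
def quadLift (n : ℕ) (M : Matrix (Fin m ⊕ Fin m) (Fin m ⊕ Fin m) ℝ) :
    𝓢(Conf m × Conf n, ℂ) →L[ℂ] 𝓢(Conf m × Conf n, ℂ) :=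
  (1 / 2 : ℂ) • ∑ a, ∑ b, (M a b : ℂ) • (sysOp a ∘L sysOp b)

theorem isLift_quadOp (M : Matrix (Fin m ⊕ Fin m) (Fin m ⊕ Fin m) ℝ) :
    IsLift (quadOp M) (quadLift n M) := fun K f => by
  simp only [quadOp_apply, quadLift, smul_apply, sum_apply, ContinuousLinearMap.comp_apply,
    kernelOp_smul, kernelOp_sum, phaseOp_kernelOp]

end Lift

/-! ### Eigenfunctions of a state with Schwartz kernel -/

section Eigenfunctions

variable {n : ℕ} {ι : Type}

/-- The Schwartz representative of `√lᵢ • eᵢ`, where `eᵢ` is an eigenvector of the operator with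
kernel `K` for the eigenvalue `lᵢ`. -/
def eigenFun (K : 𝓢(Conf n × Conf n, ℂ)) (e : ι → L2 (Conf n)) (l : ι → ℝ) (i : ι) :
    𝓢(Conf n, ℂ) :=
  ((Real.sqrt (l i))⁻¹ : ℂ) • kernelOp K (e i)

variable {K : 𝓢(Conf n × Conf n, ℂ)} {e : ι → L2 (Conf n)} {l : ι → ℝ}

theorem toLp_eigenFun (hl : ∀ i, 0 ≤ l i) (he : ∀ i, kernelCLM K (e i) = (l i : ℂ) • e i) (i : ι) :
    (eigenFun K e l i).toLp 2 volume = (Real.sqrt (l i) : ℂ) • e i := by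
  rw [eigenFun, toLp_smul, ← kernelCLM_apply, he, smul_smul]
  congr 1
  rcases (hl i).eq_or_lt with h | h
  · simp [← h]
  · have h1 : (Real.sqrt (l i) : ℂ) ≠ 0 := ofReal_ne_zero.2 (Real.sqrt_pos.2 h).ne'
    have h2 : (l i : ℂ) = Real.sqrt (l i) * Real.sqrt (l i) := by
      rw [← ofReal_mul, Real.mul_self_sqrt h.le]
    rw [h2]
    field_simp

/-- The factor `√lᵢ` on the left cancels the inverse inside `eigenFun`, so a quadratic expression in
the eigenfunctions becomes a diagonal element of a kernel operator, whose sum is a trace. -/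
theorem inner_eigenFun (hl : ∀ i, 0 ≤ l i) (he : ∀ i, kernelCLM K (e i) = (l i : ℂ) • e i)
    {A : 𝓢(Conf n, ℂ) →L[ℂ] 𝓢(Conf n, ℂ)}
    {B : 𝓢(Conf n × Conf n, ℂ) →L[ℂ] 𝓢(Conf n × Conf n, ℂ)} (hAB : IsLift A B) (i : ι) :
    ⟪(eigenFun K e l i).toLp 2 volume, (A (eigenFun K e l i)).toLp 2 volume⟫_ℂ =
      ⟪e i, kernelCLM (B K) (e i)⟫_ℂ := by
  rw [toLp_eigenFun hl he, eigenFun, map_smul, hAB, toLp_smul, inner_smul_left, inner_smul_right,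
    kernelCLM_apply, conj_ofReal, ← mul_assoc]
  -- For eigenvalue zero the left side vanishes because `√0 = 0`. The right side vanishes because `K
  -- eᵢ = 0`, first in `L²`, then as a Schwartz function by injectivity, hence also after `A`.
  rcases (hl i).eq_or_lt with h | h
  · have h0 : kernelOp K (e i) = 0 := by
      refine SchwartzMap.injective_toLp 2 volume ?_
      have := he i
      rw [kernelCLM_apply, ← h, ofReal_zero, zero_smul] at this
      simp only [this]
      exact ((SchwartzMap.toLpCLM ℂ ℂ 2 (volume : Measure (Conf n))).map_zero).symm
    have h1 : kernelOp (B K) (e i) = 0 := by rw [← hAB, h0, map_zero]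
    have h2 : (0 : 𝓢(Conf n, ℂ)).toLp 2 volume = 0 :=
      (SchwartzMap.toLpCLM ℂ ℂ 2 (volume : Measure (Conf n))).map_zero
    rw [h1, h2]
    simp
  · have h1 : (Real.sqrt (l i) : ℂ) ≠ 0 := ofReal_ne_zero.2 (Real.sqrt_pos.2 h).ne'
    rw [mul_inv_cancel₀ h1, one_mul]

theorem hasSum_inner_eigenFun (b : HilbertBasis ι ℂ (L2 (Conf n))) (hl : ∀ i, 0 ≤ l i)
    (he : ∀ i, kernelCLM K (b i) = (l i : ℂ) • b i)
    {A : 𝓢(Conf n, ℂ) →L[ℂ] 𝓢(Conf n, ℂ)}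
    {B : 𝓢(Conf n × Conf n, ℂ) →L[ℂ] 𝓢(Conf n × Conf n, ℂ)} (hAB : IsLift A B) :
    HasSum (fun i => ⟪(eigenFun K b l i).toLp 2 volume, (A (eigenFun K b l i)).toLp 2 volume⟫_ℂ)
      (∫ y, B K (y, y)) :=
  (congrArg (HasSum · _ _) (funext fun i => (inner_eigenFun hl he hAB i).symm)).mp
    (hasSum_inner_kernelCLM b (B K))

end Eigenfunctions

/-! ### The Hamiltonian as a sum of product operators -/

section HamiltonianTerms

variable {d N : ℕ}

/-- The tensor product with a fixed second factor. -/
def schwartzTensorRight (g : 𝓢(Conf N, ℂ)) : 𝓢(Conf d, ℂ) →ₗ[ℂ] 𝓢(Conf d × Conf N, ℂ) where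
  toFun f := schwartzTensor f g
  map_add' f f' := by
    ext z
    simp only [schwartzTensor_apply, add_apply, add_mul]
  map_smul' c f := by
    ext z
    simp only [schwartzTensor_apply, smul_apply, smul_eq_mul, mul_assoc, RingHom.id_apply]

theorem schwartzTensorRight_apply (f : 𝓢(Conf d, ℂ)) (g : 𝓢(Conf N, ℂ)) :
    schwartzTensorRight g f = schwartzTensor f g := rfl

/-- The tensor product with a fixed first factor. -/
def schwartzTensorLeft (f : 𝓢(Conf d, ℂ)) : 𝓢(Conf N, ℂ) →ₗ[ℂ] 𝓢(Conf d × Conf N, ℂ) where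
  toFun g := schwartzTensor f g
  map_add' g g' := by
    ext z
    simp only [schwartzTensor_apply, add_apply, mul_add]
  map_smul' c g := by
    ext z
    simp only [schwartzTensor_apply, smul_apply, smul_eq_mul, mul_left_comm, RingHom.id_apply]

theorem schwartzTensorLeft_apply (f : 𝓢(Conf d, ℂ)) (g : 𝓢(Conf N, ℂ)) :
    schwartzTensorLeft f g = schwartzTensor f g := rfl

/-- The terms of the Hamiltonian: the system, the environment, and the coupling of two
coordinates. -/
abbrev Term (d N : ℕ) : Type := Unit ⊕ Unit ⊕ ((Fin d ⊕ Fin d) × (Fin N ⊕ Fin N))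

/-- The system factor of a term of the Hamiltonian. -/
def sysTerm (MS : Matrix (Fin d ⊕ Fin d) (Fin d ⊕ Fin d) ℝ)
    (G : Matrix (Fin d ⊕ Fin d) (Fin N ⊕ Fin N) ℝ) :
    Term d N → 𝓢(Conf d, ℂ) →L[ℂ] 𝓢(Conf d, ℂ)
  | Sum.inl _ => quadOp MS
  | Sum.inr (Sum.inl _) => ContinuousLinearMap.id ℂ _
  | Sum.inr (Sum.inr p) => (G p.1 p.2 : ℂ) • phaseOp p.1

/-- The environment factor of a term of the Hamiltonian. -/
def envTerm (d : ℕ) (ME : Matrix (Fin N ⊕ Fin N) (Fin N ⊕ Fin N) ℝ) :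
    Term d N → 𝓢(Conf N, ℂ) →L[ℂ] 𝓢(Conf N, ℂ)
  | Sum.inl _ => ContinuousLinearMap.id ℂ _
  | Sum.inr (Sum.inl _) => quadOp ME
  | Sum.inr (Sum.inr p) => phaseOp p.2

/-- The lifts to kernels of the environment factors. -/
def envLift (d : ℕ) (ME : Matrix (Fin N ⊕ Fin N) (Fin N ⊕ Fin N) ℝ) :
    Term d N → 𝓢(Conf N × Conf N, ℂ) →L[ℂ] 𝓢(Conf N × Conf N, ℂ)
  | Sum.inl _ => ContinuousLinearMap.id ℂ _
  | Sum.inr (Sum.inl _) => quadLift N ME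
  | Sum.inr (Sum.inr p) => sysOp p.2

theorem isLift_envTerm (ME : Matrix (Fin N ⊕ Fin N) (Fin N ⊕ Fin N) ℝ) :
    ∀ θ : Term d N, IsLift (envTerm d ME θ) (envLift d ME θ)
  | Sum.inl _ => isLift_id
  | Sum.inr (Sum.inl _) => isLift_quadOp ME
  | Sum.inr (Sum.inr p) => isLift_phaseOp p.2

theorem isSymmOp_envTerm {ME : Matrix (Fin N ⊕ Fin N) (Fin N ⊕ Fin N) ℝ} (hM : ME.IsSymm) :
    ∀ θ : Term d N, IsSymmOp (envTerm d ME θ)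
  | Sum.inl _ => isSymmOp_id
  | Sum.inr (Sum.inl _) => isSymmOp_quadOp hM
  | Sum.inr (Sum.inr p) => isSymmOp_phaseOp p.2

theorem IsSymmOp.real_smul {A : 𝓢(Conf N, ℂ) →L[ℂ] 𝓢(Conf N, ℂ)} (hA : IsSymmOp A) (c : ℝ) :
    IsSymmOp ((c : ℂ) • A) := fun f g => by
  rw [smul_apply, smul_apply, toLp_smul, toLp_smul, inner_smul_left, inner_smul_right,
    conj_ofReal, hA f g]

theorem isSymmOp_sysTerm {MS : Matrix (Fin d ⊕ Fin d) (Fin d ⊕ Fin d) ℝ} (hM : MS.IsSymm)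
    (G : Matrix (Fin d ⊕ Fin d) (Fin N ⊕ Fin N) ℝ) :
    ∀ θ : Term d N, IsSymmOp (sysTerm MS G θ)
  | Sum.inl _ => isSymmOp_quadOp hM
  | Sum.inr (Sum.inl _) => isSymmOp_id
  | Sum.inr (Sum.inr p) => (isSymmOp_phaseOp p.1).real_smul _

theorem hamiltonian_schwartzTensor (MS : Matrix (Fin d ⊕ Fin d) (Fin d ⊕ Fin d) ℝ)
    (ME : Matrix (Fin N ⊕ Fin N) (Fin N ⊕ Fin N) ℝ)
    (G : Matrix (Fin d ⊕ Fin d) (Fin N ⊕ Fin N) ℝ) (f : 𝓢(Conf d, ℂ)) (g : 𝓢(Conf N, ℂ)) :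
    hamiltonian MS ME G (schwartzTensor f g) =
      ∑ θ : Term d N, schwartzTensor (sysTerm MS G θ f) (envTerm d ME θ g) := by
  have h1 : schwartzTensor (quadOp MS f) g = (1 / 2 : ℂ) • ∑ a, ∑ b, (MS a b : ℂ) •
      schwartzTensor (phaseOp a (phaseOp b f)) g := by
    simp only [quadOp_apply, ← schwartzTensorRight_apply, map_smul, map_sum]
  have h2 : schwartzTensor f (quadOp ME g) = (1 / 2 : ℂ) • ∑ a, ∑ b, (ME a b : ℂ) •
      schwartzTensor f (phaseOp a (phaseOp b g)) := by
    simp only [quadOp_apply, ← schwartzTensorLeft_apply, map_smul, map_sum]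
  have h3 : ∀ a b, schwartzTensor ((G a b : ℂ) • phaseOp a f) (phaseOp b g) =
      (G a b : ℂ) • schwartzTensor (phaseOp a f) (phaseOp b g) := fun a b =>
    (schwartzTensorRight (phaseOp b g)).map_smul _ _
  rw [Fintype.sum_sum_type, Fintype.sum_sum_type, Fintype.sum_prod_type]
  simp only [Finset.univ_unique, Finset.sum_singleton, sysTerm, envTerm,
    ContinuousLinearMap.id_apply, smul_apply, h1, h2, h3]
  simp only [hamiltonian, add_apply, smul_apply, sum_apply, ContinuousLinearMap.comp_apply,
    sysOp_schwartzTensor, envOp_schwartzTensor]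
  rw [add_assoc]

end HamiltonianTerms

/-! ### Moments of a pure state -/

section PureMoments

variable {d : ℕ} (ψ : 𝓢(Conf d, ℂ))

theorem inner_self_eq_integral_wigner :
    ⟪ψ.toLp 2 volume, ψ.toLp 2 volume⟫_ℂ = ((∫ z, quasiProb (wigner ψ) z : ℝ) : ℂ) := by
  rw [← integral_weylKernel_diag_eq fun z => (ofReal_wigner ψ z).symm, weylKernel_wignerSchwartz,
    inner_toLp_toLp]
  simp only [schwartzTensor_apply, schwartzConj_apply]

theorem inner_phaseOp (a : Fin d ⊕ Fin d) :
    ⟪ψ.toLp 2 volume, (phaseOp a ψ).toLp 2 volume⟫_ℂ = (mean (quasiProb (wigner ψ)) a : ℂ) := by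
  rw [← integral_sysOp_weylKernel_diag fun z => (ofReal_wigner ψ z).symm,
    weylKernel_wignerSchwartz, inner_toLp_toLp, sysOp_schwartzTensor]
  simp only [schwartzTensor_apply, schwartzConj_apply]

theorem inner_phaseOp_phaseOp (a b : Fin d ⊕ Fin d) :
    ⟪(phaseOp a ψ).toLp 2 volume, (phaseOp b ψ).toLp 2 volume⟫_ℂ =
      ((∫ z, coord a z * coord b z * quasiProb (wigner ψ) z : ℝ) : ℂ) -
        (I / 2) * (Matrix.J (Fin d) ℝ a b * ((∫ z, quasiProb (wigner ψ) z : ℝ) : ℂ)) := by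
  rw [← integral_sysOp_sysOp_weylKernel_diag fun z => (ofReal_wigner ψ z).symm,
    weylKernel_wignerSchwartz, ← isSymmOp_phaseOp a, inner_toLp_toLp, sysOp_schwartzTensor,
    sysOp_schwartzTensor]
  simp only [schwartzTensor_apply, schwartzConj_apply]

end PureMoments

/-! ### From the eigenfunctions of the bath to the purity formula -/

theorem summable_sq_of_le_sum {ι Θ : Type} [Fintype Θ] {f : ι → ℝ} {c : Θ → ℝ} {a : ι → Θ → ℝ}
    (h0 : ∀ i, 0 ≤ f i) (hf : ∀ i, f i ≤ ∑ θ, c θ * a i θ)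
    (ha : ∀ θ, Summable fun i => a i θ ^ 2) : Summable fun i => f i ^ 2 := by
  have h : Summable fun i => Fintype.card Θ * ∑ θ, c θ ^ 2 * a i θ ^ 2 :=
    (summable_sum fun θ _ => (ha θ).mul_left (c θ ^ 2)).mul_left _
  refine Summable.of_nonneg_of_le (fun i => sq_nonneg _) (fun i => ?_) h
  refine (pow_le_pow_left₀ (h0 i) (hf i) 2).trans ?_
  have := sq_sum_le_card_mul_sum_sq (s := Finset.univ) (f := fun θ => c θ * a i θ)
  simpa only [mul_pow, Finset.card_univ] using this

/-- The real part of `(C - (i/2) J)(C' - (i/2) J')` is `C C' - J J' / 4`. Expanding the trace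
produces the transpose of the environment matrix, so the antisymmetry of `JE` fixes the sign of the
second term. -/
theorem sum_sum_coupling {α β : Type} [Fintype α] [Fintype β] (CS JS : Matrix α α ℝ)
    (CE JE : Matrix β β ℝ) (G : Matrix α β ℝ) (hC : CE.transpose = CE) (hJ : JE.transpose = -JE) :
    -4 * (∑ p : α × β, ∑ q : α × β, ((G p.1 p.2 : ℂ) * G q.1 q.2 *
        (CS p.1 q.1 - I / 2 * JS p.1 q.1)) * (CE p.2 q.2 - I / 2 * JE p.2 q.2)).re =
      -4 * (CS * G * CE * G.transpose).trace - (JS * G * JE * G.transpose).trace := by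
  have ht : ∀ (A : Matrix α α ℝ) (B : Matrix β β ℝ), (A * G * B * G.transpose).trace =
      ∑ p : α × β, ∑ q : α × β, G p.1 p.2 * G q.1 q.2 * A p.1 q.1 * B.transpose p.2 q.2 := by
    intro A B
    simp only [Matrix.trace, Matrix.diag, Matrix.mul_apply, Matrix.transpose_apply,
      Fintype.sum_prod_type, Finset.sum_mul]
    refine Finset.sum_congr rfl fun a _ => Finset.sum_congr rfl fun c _ => ?_
    rw [Finset.sum_comm]
    refine Finset.sum_congr rfl fun b _ => Finset.sum_congr rfl fun e _ => ?_
    ring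
  rw [ht, ht, hC, hJ, re_sum, Finset.mul_sum, Finset.mul_sum, ← Finset.sum_sub_distrib]
  refine Finset.sum_congr rfl fun p _ => ?_
  rw [re_sum, Finset.mul_sum, Finset.mul_sum, ← Finset.sum_sub_distrib]
  refine Finset.sum_congr rfl fun q _ => ?_
  simp
  ring

/-- Here `A'` acts as the adjoint of `A`, so the sum of the squared norms is the trace of `A' A`
times the state, which converges because the kernel stays Schwartz. -/
theorem summable_norm_sq_eigenFun {n : ℕ} {ι : Type} {K : 𝓢(Conf n × Conf n, ℂ)} {l : ι → ℝ}
    (b : HilbertBasis ι ℂ (L2 (Conf n))) (hl : ∀ i, 0 ≤ l i)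
    (he : ∀ i, kernelCLM K (b i) = (l i : ℂ) • b i)
    {A A' : 𝓢(Conf n, ℂ) →L[ℂ] 𝓢(Conf n, ℂ)}
    {B : 𝓢(Conf n × Conf n, ℂ) →L[ℂ] 𝓢(Conf n × Conf n, ℂ)} (hAB : IsLift (A' ∘L A) B)
    (hA : ∀ f, ⟪(A f).toLp 2 volume, (A f).toLp 2 volume⟫_ℂ =
      ⟪f.toLp 2 volume, (A' (A f)).toLp 2 volume⟫_ℂ) :
    Summable fun i => ‖(A (eigenFun K b l i)).toLp 2 volume‖ ^ 2 := by
  have h := (hasSum_inner_eigenFun b hl he hAB).summable.mapL reCLM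
  refine h.congr fun i => ?_
  rw [ContinuousLinearMap.comp_apply, ← hA, reCLM_apply]
  exact (inner_self_eq_norm_sq (𝕜 := ℂ) _)

theorem hasSum_inner_eigenFun_comp {n : ℕ} {ι : Type} {K : 𝓢(Conf n × Conf n, ℂ)} {l : ι → ℝ}
    (b : HilbertBasis ι ℂ (L2 (Conf n))) (hl : ∀ i, 0 ≤ l i)
    (he : ∀ i, kernelCLM K (b i) = (l i : ℂ) • b i)
    {A A' : 𝓢(Conf n, ℂ) →L[ℂ] 𝓢(Conf n, ℂ)}
    {B B' : 𝓢(Conf n × Conf n, ℂ) →L[ℂ] 𝓢(Conf n × Conf n, ℂ)} (h : IsLift A B)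
    (h' : IsLift A' B') :
    HasSum (fun i => ⟪(eigenFun K b l i).toLp 2 volume,
      (A (A' (eigenFun K b l i))).toLp 2 volume⟫_ℂ) (∫ y, B (B' K) (y, y)) := by
  simpa only [ContinuousLinearMap.comp_apply] using hasSum_inner_eigenFun b hl he (h.comp h')

theorem hasSum_norm_sq_of_hasSum_inner {H ι : Type} [NormedAddCommGroup H] [InnerProductSpace ℂ H]
    {f : ι → H} {c : ℂ} (h : HasSum (fun i => ⟪f i, f i⟫_ℂ) c) :
    HasSum (fun i => ‖f i‖ ^ 2) c.re :=
  (congrArg (HasSum · _ _) (funext fun i => inner_self_eq_norm_sq (𝕜 := ℂ) (f i))).mp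
    (h.mapL reCLM)

theorem rankOne_sqrt_smul {H : Type} [NormedAddCommGroup H] [InnerProductSpace ℂ H] {l : ℝ}
    (hl : 0 ≤ l) (e : H) :
    InnerProductSpace.rankOne ℂ ((Real.sqrt l : ℂ) • e) ((Real.sqrt l : ℂ) • e) =
      (l : ℂ) • InnerProductSpace.rankOne ℂ e e := by
  ext1 f
  simp only [InnerProductSpace.rankOne_apply, smul_apply, inner_smul_left, conj_ofReal, smul_smul]
  congr 1
  rw [mul_right_comm, ← ofReal_mul, Real.mul_self_sqrt hl]

theorem hasSum_rankOne_of_eq_sqrt_smul {H : Type} [NormedAddCommGroup H] [InnerProductSpace ℂ H]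
    [CompleteSpace H] {ρ : H →L[ℂ] H} {ι : Type} (e : HilbertBasis ι ℂ H) {l : ι → ℝ} {g : ι → H}
    (hl : ∀ i, 0 ≤ l i) (hs : Summable fun i => ‖g i‖ ^ 2) (he : ∀ i, ρ (e i) = (l i : ℂ) • e i)
    (hg : ∀ i, g i = (Real.sqrt (l i) : ℂ) • e i) :
    HasSum (fun i => InnerProductSpace.rankOne ℂ (g i) (g i)) ρ := by
  have hls : Summable l := by
    refine hs.congr fun i => ?_
    rw [hg, norm_smul, e.orthonormal.1 i, mul_one, norm_real,
      Real.norm_of_nonneg (Real.sqrt_nonneg _), Real.sq_sqrt (hl i)]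
  refine (congrArg (HasSum · _ _) (funext fun i => ?_)).mp (hasSum_eigenbasis e hl hls he)
  rw [hg, rankOne_sqrt_smul (hl i)]

theorem integral_diag_eq_one {n : ℕ} {K : 𝓢(Conf n × Conf n, ℂ)}
    (hρ : IsDensityOperator (kernelCLM K)) : ∫ y, K (y, y) = 1 := by
  rw [← hρ.trace_eq_one]
  exact (hasSum_inner_kernelCLM (hilbertBasis _) K).tsum_eq.symm

section EigenState

variable {n : ℕ} {ι : Type} {K : 𝓢(Conf n × Conf n, ℂ)} {l : ι → ℝ}

theorem hasSum_inner_self_eigenFun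
    (hρ : IsDensityOperator (kernelCLM K)) (b : HilbertBasis ι ℂ (L2 (Conf n)))
    (hl : ∀ i, 0 ≤ l i) (he : ∀ i, kernelCLM K (b i) = (l i : ℂ) • b i) :
    HasSum (fun i => ⟪(eigenFun K b l i).toLp 2 volume, (eigenFun K b l i).toLp 2 volume⟫_ℂ) 1 := by
  have h := hasSum_inner_eigenFun b hl he isLift_id
  simpa only [ContinuousLinearMap.id_apply, integral_diag_eq_one hρ] using h

theorem hasSum_rankOne_eigenFun
    (hρ : IsDensityOperator (kernelCLM K)) (b : HilbertBasis ι ℂ (L2 (Conf n)))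
    (hl : ∀ i, 0 ≤ l i) (he : ∀ i, kernelCLM K (b i) = (l i : ℂ) • b i) :
    HasSum (fun i => InnerProductSpace.rankOne ℂ ((eigenFun K b l i).toLp 2 volume)
      ((eigenFun K b l i).toLp 2 volume)) (kernelCLM K) :=
  hasSum_rankOne_of_eq_sqrt_smul b
    (g := fun i => (eigenFun K b l i).toLp 2 volume) hl
    (hasSum_norm_sq_of_hasSum_inner (hasSum_inner_self_eigenFun hρ b hl he)).summable he
    (toLp_eigenFun hl he)

end EigenState

section PartOne

variable {d N : ℕ} {MS : Matrix (Fin d ⊕ Fin d) (Fin d ⊕ Fin d) ℝ}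
  {ME : Matrix (Fin N ⊕ Fin N) (Fin N ⊕ Fin N) ℝ} {G : Matrix (Fin d ⊕ Fin d) (Fin N ⊕ Fin N) ℝ}

/-- The generator `-i Ĥ` on a product. -/
theorem generator_schwartzTensor (f : 𝓢(Conf d, ℂ)) (g : 𝓢(Conf N, ℂ)) :
    ((((-I) • hamiltonian MS ME G) (schwartzTensor f g)).toLp 2 volume :
      L2 (Conf d × Conf N)) = (-I) • ∑ θ : Term d N,
      tensor ((sysTerm MS G θ f).toLp 2 volume) ((envTerm d ME θ g).toLp 2 volume) := by
  rw [smul_apply, toLp_smul, hamiltonian_schwartzTensor, toLp_sum]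
  simp only [toLp_schwartzTensor]

theorem generator_generator_schwartzTensor (f : 𝓢(Conf d, ℂ)) (g : 𝓢(Conf N, ℂ)) :
    ((((-I) • hamiltonian MS ME G) (((-I) • hamiltonian MS ME G)
      (schwartzTensor f g))).toLp 2 volume :
      L2 (Conf d × Conf N)) = (-1 : ℂ) • ∑ θ : Term d N, ∑ θ' : Term d N,
      tensor ((sysTerm MS G θ (sysTerm MS G θ' f)).toLp 2 volume)
        ((envTerm d ME θ (envTerm d ME θ' g)).toLp 2 volume) := by
  have h : (-I) * (-I) = (-1 : ℂ) := by rw [neg_mul_neg, I_mul_I]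
  rw [smul_apply, smul_apply, map_smul, smul_smul, h, toLp_smul, hamiltonian_schwartzTensor,
    map_sum, toLp_sum, Finset.sum_comm]
  congr 1
  refine Finset.sum_congr rfl fun θ' _ => ?_
  rw [hamiltonian_schwartzTensor, toLp_sum]
  simp only [toLp_schwartzTensor]

theorem hasSum_rankOne_initialState {ψ : L2 (Conf d)} {ρE : L2 (Conf N) →L[ℂ] L2 (Conf N)}
    {ι : Type} {g : ι → L2 (Conf N)}
    (hg : HasSum (fun i => InnerProductSpace.rankOne ℂ (g i) (g i)) ρE) :
    HasSum (fun i => InnerProductSpace.rankOne ℂ (tensor ψ (g i)) (tensor ψ (g i)))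
      (initialState ψ ρE) :=
  OpenQuantum.HasSum.conj_adjoint hg (tensorLeft ψ)

section Family

variable {ι : Type} {U : ℝ → L2 (Conf d × Conf N) →L[ℂ] L2 (Conf d × Conf N)}
  {ψ : 𝓢(Conf d, ℂ)} {χ : ι → 𝓢(Conf N, ℂ)}

theorem summable_norm_sq_generator
    (hs : ∀ θ : Term d N, Summable fun i => ‖(envTerm d ME θ (χ i)).toLp 2 volume‖ ^ 2) :
    Summable fun i => ‖((((-I) • hamiltonian MS ME G) (schwartzTensor ψ (χ i))).toLp 2 volume :
      L2 (Conf d × Conf N))‖ ^ 2 := by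
  refine summable_sq_of_le_sum (c := fun θ : Term d N => ‖(sysTerm MS G θ ψ).toLp 2 volume‖)
    (fun i => norm_nonneg _) (fun i => ?_) hs
  rw [generator_schwartzTensor, norm_smul, norm_neg, norm_I, one_mul]
  exact norm_sum_le_of_le _ fun θ _ => (norm_tensor _ _).le

theorem summable_norm_sq_generator_generator
    (hs : ∀ θ θ' : Term d N, Summable fun i =>
      ‖(envTerm d ME θ (envTerm d ME θ' (χ i))).toLp 2 volume‖ ^ 2) :
    Summable fun i => ‖((((-I) • hamiltonian MS ME G) (((-I) • hamiltonian MS ME G)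
      (schwartzTensor ψ (χ i)))).toLp 2 volume : L2 (Conf d × Conf N))‖ ^ 2 := by
  refine summable_sq_of_le_sum (c := fun θ : Term d N × Term d N =>
    ‖(sysTerm MS G θ.1 (sysTerm MS G θ.2 ψ)).toLp 2 volume‖)
    (a := fun i θ => ‖(envTerm d ME θ.1 (envTerm d ME θ.2 (χ i))).toLp 2 volume‖)
    (fun i => norm_nonneg _) (fun i => ?_) fun θ => hs θ.1 θ.2
  rw [generator_generator_schwartzTensor, norm_smul, norm_neg, norm_one, one_mul,
    ← Fintype.sum_prod_type']
  exact norm_sum_le_of_le _ fun θ _ => (norm_tensor _ _).le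

theorem summable_add_add_sq {a b c : ι → ℝ} (ha : Summable fun i => a i ^ 2)
    (hb : Summable fun i => b i ^ 2) (hc : Summable fun i => c i ^ 2) :
    Summable fun i => (a i + b i + c i) ^ 2 := by
  refine Summable.of_nonneg_of_le (fun i => sq_nonneg _) (fun i => ?_)
    (((ha.add hb).add hc).mul_left 3)
  nlinarith [sq_nonneg (a i - b i), sq_nonneg (a i - c i), sq_nonneg (b i - c i)]

theorem contDiff_two_of_orbit {E K : Type} [NormedAddCommGroup E] [NormedSpace ℝ E]
    [NormedAddCommGroup K] [InnerProductSpace ℂ K] [NormedSpace ℝ K] {B : E →L[ℝ] E →L[ℝ] K}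
    (hB : ∀ x y, ‖B x y‖ ≤ ‖x‖ * ‖y‖) {V : ℝ → E → E} (h0 : ∀ f, V 0 f = f)
    (hV : ∀ t f, ‖V t f‖ = ‖f‖) (hc : ∀ f, Continuous fun t => V t f) {v v' v'' : ι → E}
    (hd : ∀ i t, HasDerivAt (fun t => V t (v i)) (V t (v' i)) t)
    (hd' : ∀ i t, HasDerivAt (fun t => V t (v' i)) (V t (v'' i)) t)
    (hs : Summable fun i => ‖v i‖ ^ 2) (hs' : Summable fun i => ‖v' i‖ ^ 2)
    (hs'' : Summable fun i => ‖v'' i‖ ^ 2) :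
    ContDiff ℝ 2 (fun t => ∑' p : ι × ι, ‖B (V t (v p.1)) (V t (v p.2))‖ ^ 2) ∧
    iteratedDeriv 2 (fun t => ∑' p : ι × ι, ‖B (V t (v p.1)) (V t (v p.2))‖ ^ 2) 0 =
      ∑' p : ι × ι, normSqDeriv₂ B (v p.1) (v p.2) (v' p.1) (v' p.2) (v'' p.1) (v'' p.2) := by
  have h := contDiff_two_tsum_norm_sq hB
    (x := fun i t => V t (v i)) (x' := fun i t => V t (v' i)) (x'' := fun i t => V t (v'' i))
    (summable_add_add_sq hs hs' hs'') hd hd' (fun i => hc _)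
    (fun i t => by
      rw [hV, add_assoc]
      exact le_add_of_nonneg_right (add_nonneg (norm_nonneg _) (norm_nonneg _)))
    (fun i t => by
      rw [hV, add_right_comm]
      exact le_add_of_nonneg_left (add_nonneg (norm_nonneg _) (norm_nonneg _)))
    (fun i t => by
      rw [hV]
      exact le_add_of_nonneg_left (add_nonneg (norm_nonneg _) (norm_nonneg _)))
  refine ⟨h.1, h.2.trans ?_⟩
  simp only [h0]

theorem hasSum_rankOne_evolved {ρE : L2 (Conf N) →L[ℂ] L2 (Conf N)}
    (hχ : HasSum (fun i => InnerProductSpace.rankOne ℂ ((χ i).toLp 2 volume)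
      ((χ i).toLp 2 volume)) ρE) (t : ℝ) :
    HasSum (fun i => InnerProductSpace.rankOne ℂ (U t ((schwartzTensor ψ (χ i)).toLp 2 volume))
        (U t ((schwartzTensor ψ (χ i)).toLp 2 volume)))
      (U t ∘L initialState (ψ.toLp 2 volume) ρE ∘L (U t).adjoint) := by
  have h := OpenQuantum.HasSum.conj_adjoint
    (hasSum_rankOne_initialState (ψ := ψ.toLp 2 volume) hχ) (U t)
  simpa only [toLp_schwartzTensor] using h

theorem hasSum_norm_sq_evolved (hU : IsPropagator (hamiltonian MS ME G) U)
    (hψ : ‖ψ.toLp 2‖ = 1)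
    (hg : HasSum (fun i => ⟪(χ i).toLp 2 volume, (χ i).toLp 2 volume⟫_ℂ) 1) (t : ℝ) :
    HasSum (fun i => ‖U t ((schwartzTensor ψ (χ i)).toLp 2 volume)‖ ^ 2) 1 := by
  have h := hasSum_norm_sq_of_hasSum_inner hg
  simpa only [hU.norm_apply, toLp_schwartzTensor, norm_tensor, hψ, one_mul, one_re] using h

theorem purity_eq_tsum (hU : IsPropagator (hamiltonian MS ME G) U)
    (hψ : ‖ψ.toLp 2‖ = 1) {ρE : L2 (Conf N) →L[ℂ] L2 (Conf N)}
    (hχ : HasSum (fun i => InnerProductSpace.rankOne ℂ ((χ i).toLp 2 volume)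
      ((χ i).toLp 2 volume)) ρE)
    (hg : HasSum (fun i => ⟪(χ i).toLp 2 volume, (χ i).toLp 2 volume⟫_ℂ) 1) :
    purity U ψ ρE = fun t => ∑' p : ι × ι, ‖gram (hilbertBasis (L2 (Conf N)))
      (U t ((schwartzTensor ψ (χ p.1)).toLp 2 volume))
      (U t ((schwartzTensor ψ (χ p.2)).toLp 2 volume))‖ ^ 2 := by
  funext t
  simp only [gram_eq]
  exact opTrace_partialTrace_sq (hasSum_norm_sq_evolved hU hψ hg t).summable
    (hasSum_rankOne_evolved hχ t)

theorem contDiff_purity (hU : IsPropagator (hamiltonian MS ME G) U)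
    (hψ : ‖ψ.toLp 2‖ = 1) {ρE : L2 (Conf N) →L[ℂ] L2 (Conf N)}
    (hχ : HasSum (fun i => InnerProductSpace.rankOne ℂ ((χ i).toLp 2 volume)
      ((χ i).toLp 2 volume)) ρE)
    (hg : HasSum (fun i => ⟪(χ i).toLp 2 volume, (χ i).toLp 2 volume⟫_ℂ) 1)
    (hs : ∀ θ θ' : Term d N, Summable fun i =>
      ‖(envTerm d ME θ (envTerm d ME θ' (χ i))).toLp 2 volume‖ ^ 2) :
    ContDiff ℝ 2 (purity U ψ ρE) ∧ iteratedDeriv 2 (purity U ψ ρE) 0 =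
      ∑' p : ι × ι, normSqDeriv₂ (gram (hilbertBasis (L2 (Conf N))))
        ((schwartzTensor ψ (χ p.1)).toLp 2 volume) ((schwartzTensor ψ (χ p.2)).toLp 2 volume)
        ((((-I) • hamiltonian MS ME G) (schwartzTensor ψ (χ p.1))).toLp 2 volume)
        ((((-I) • hamiltonian MS ME G) (schwartzTensor ψ (χ p.2))).toLp 2 volume)
        ((((-I) • hamiltonian MS ME G) (((-I) • hamiltonian MS ME G)
          (schwartzTensor ψ (χ p.1)))).toLp 2 volume)
        ((((-I) • hamiltonian MS ME G) (((-I) • hamiltonian MS ME G)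
          (schwartzTensor ψ (χ p.2)))).toLp 2 volume) := by
  rw [purity_eq_tsum hU hψ hχ hg]
  have hB : ∀ y z : L2 (Conf d × Conf N),
      ‖gram (hilbertBasis (L2 (Conf N))) y z‖ ≤ ‖y‖ * ‖z‖ := fun y z => by
    rw [gram_eq]
    exact norm_gramVec_le _ y z
  have h0 : Summable fun i => ‖((schwartzTensor ψ (χ i)).toLp 2 volume :
      L2 (Conf d × Conf N))‖ ^ 2 := by
    simpa only [hU.norm_apply] using (hasSum_norm_sq_evolved hU hψ hg 0).summable
  exact contDiff_two_of_orbit (V := fun t => U t)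
    (v := fun i => (schwartzTensor ψ (χ i)).toLp 2 volume)
    (v' := fun i => (((-I) • hamiltonian MS ME G) (schwartzTensor ψ (χ i))).toLp 2 volume)
    (v'' := fun i => (((-I) • hamiltonian MS ME G) (((-I) • hamiltonian MS ME G)
      (schwartzTensor ψ (χ i)))).toLp 2 volume) hB
    (fun f => by rw [hU.zero, one_apply_eq_self]) hU.norm_apply hU.continuous
    (fun i => hU.hasDerivAt_apply _) (fun i => hU.hasDerivAt_apply _) h0
    -- The index `Sum.inl ()` has the identity as its environment factor, so the first order
    -- estimate is a special case of the second order one.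
    (summable_norm_sq_generator fun θ => hs (Sum.inl ()) θ)
    (summable_norm_sq_generator_generator hs)

variable (MS G ψ) in
theorem hasSum_normSqDeriv₂_generator (hMS : MS.IsSymm) (hME : ME.IsSymm) (hψ : ‖ψ.toLp 2‖ = 1)
    {ε : Term d N → ℂ} {ε₂ : Term d N → Term d N → ℂ}
    (hg : HasSum (fun i => ⟪(χ i).toLp 2 volume, (χ i).toLp 2 volume⟫_ℂ) 1)
    (hε : ∀ θ : Term d N, HasSum (fun i => ⟪(χ i).toLp 2 volume,
      (envTerm d ME θ (χ i)).toLp 2 volume⟫_ℂ) (ε θ))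
    (hε₂ : ∀ θ θ' : Term d N, HasSum (fun i => ⟪(χ i).toLp 2 volume,
      (envTerm d ME θ (envTerm d ME θ' (χ i))).toLp 2 volume⟫_ℂ) (ε₂ θ θ')) :
    HasSum (fun p : ι × ι => normSqDeriv₂ (gram (hilbertBasis (L2 (Conf N))))
        ((schwartzTensor ψ (χ p.1)).toLp 2 volume) ((schwartzTensor ψ (χ p.2)).toLp 2 volume)
        ((((-I) • hamiltonian MS ME G) (schwartzTensor ψ (χ p.1))).toLp 2 volume)
        ((((-I) • hamiltonian MS ME G) (schwartzTensor ψ (χ p.2))).toLp 2 volume)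
        ((((-I) • hamiltonian MS ME G) (((-I) • hamiltonian MS ME G)
          (schwartzTensor ψ (χ p.1)))).toLp 2 volume)
        ((((-I) • hamiltonian MS ME G) (((-I) • hamiltonian MS ME G)
          (schwartzTensor ψ (χ p.2)))).toLp 2 volume))
      (-4 * (∑ θ : Term d N, ∑ θ' : Term d N,
        (⟪(sysTerm MS G θ ψ).toLp 2 volume, (sysTerm MS G θ' ψ).toLp 2 volume⟫_ℂ -
          ⟪ψ.toLp 2 volume, (sysTerm MS G θ ψ).toLp 2 volume⟫_ℂ *
            ⟪ψ.toLp 2 volume, (sysTerm MS G θ' ψ).toLp 2 volume⟫_ℂ) *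
        (ε₂ θ θ' - ε θ * ε θ')).re) := by
  have hS := isSymmOp_sysTerm (N := N) hMS G
  have hE := isSymmOp_envTerm (d := d) hME
  have hψ1 : ⟪ψ.toLp 2 volume, ψ.toLp 2 volume⟫_ℂ = 1 := by
    rw [inner_self_eq_norm_sq_to_K, hψ]
    simp
  have hε' : ∀ θ : Term d N, HasSum (fun i => ⟪(envTerm d ME θ (χ i)).toLp 2 volume,
      (χ i).toLp 2 volume⟫_ℂ) (ε θ) := fun θ =>
    (congrArg (HasSum · _ _) (funext fun i => hE θ _ _)).mp (hε θ)
  have hε₃ : ∀ θ θ' : Term d N, HasSum (fun i => ⟪(envTerm d ME θ (χ i)).toLp 2 volume,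
      (envTerm d ME θ' (χ i)).toLp 2 volume⟫_ℂ) (ε₂ θ θ') := fun θ θ' =>
    (congrArg (HasSum · _ _) (funext fun i => hE θ _ _)).mp (hε₂ θ θ')
  have hε₄ : ∀ θ θ' : Term d N, HasSum (fun i => ⟪(envTerm d ME θ (envTerm d ME θ'
      (χ i))).toLp 2 volume, (χ i).toLp 2 volume⟫_ℂ) (ε₂ θ' θ) := fun θ θ' =>
    (congrArg (HasSum · _ _) (funext fun i => hE θ _ _)).mp (hε₃ θ' θ)
  exact hasSum_normSqDeriv₂_tensor (hilbertBasis (L2 (Conf N)))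
    (ψ := ψ.toLp 2 volume) (s := fun θ => (sysTerm MS G θ ψ).toLp 2 volume)
    (g := fun i => (χ i).toLp 2 volume) (e := fun i θ => (envTerm d ME θ (χ i)).toLp 2 volume)
    (e₂ := fun i θ θ' => (envTerm d ME θ (envTerm d ME θ' (χ i))).toLp 2 volume)
    (σ := fun θ => ⟪ψ.toLp 2 volume, (sysTerm MS G θ ψ).toLp 2 volume⟫_ℂ)
    (ε := ε) (ε₂ := ε₂)
    (σ₂ := fun θ θ' => ⟪(sysTerm MS G θ ψ).toLp 2 volume, (sysTerm MS G θ' ψ).toLp 2 volume⟫_ℂ)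
    (x := fun i => (schwartzTensor ψ (χ i)).toLp 2 volume)
    (x' := fun i => (((-I) • hamiltonian MS ME G) (schwartzTensor ψ (χ i))).toLp 2 volume)
    (x'' := fun i => (((-I) • hamiltonian MS ME G) (((-I) • hamiltonian MS ME G)
          (schwartzTensor ψ (χ i)))).toLp 2 volume)
    (s₂ := fun θ θ' => (sysTerm MS G θ (sysTerm MS G θ' ψ)).toLp 2 volume)
    hψ1 (fun _ => rfl) (fun θ => (hS θ _ _).symm) (fun _ _ => rfl) (fun θ θ' => hS θ _ _)
    (fun θ θ' => (hS θ _ _).symm) hg hε hε' hε₃ hε₂ hε₄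
    (fun i => toLp_schwartzTensor _ _) (fun i => generator_schwartzTensor _ _)
    (fun i => generator_generator_schwartzTensor _ _)

end Family

/-- The palindromic product `E_θ' E_θ E_θ E_θ'` is the one whose expectation is the squared norm of
`E_θ E_θ' χ`. -/
theorem isLift_envTerm_comp (ME : Matrix (Fin N ⊕ Fin N) (Fin N ⊕ Fin N) ℝ) (θ θ' : Term d N) :
    IsLift ((envTerm d ME θ' ∘L envTerm d ME θ) ∘L (envTerm d ME θ ∘L envTerm d ME θ'))
      ((envLift d ME θ' ∘L envLift d ME θ) ∘L (envLift d ME θ ∘L envLift d ME θ')) :=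
  ((isLift_envTerm ME θ').comp (isLift_envTerm ME θ)).comp
    ((isLift_envTerm ME θ).comp (isLift_envTerm ME θ'))

theorem inner_envTerm_envTerm (hME : ME.IsSymm) (θ θ' : Term d N) (f : 𝓢(Conf N, ℂ)) :
    ⟪(envTerm d ME θ (envTerm d ME θ' f)).toLp 2 volume,
        (envTerm d ME θ (envTerm d ME θ' f)).toLp 2 volume⟫_ℂ =
      ⟪f.toLp 2 volume, (envTerm d ME θ' (envTerm d ME θ (envTerm d ME θ
        (envTerm d ME θ' f)))).toLp 2 volume⟫_ℂ := by
  rw [isSymmOp_envTerm hME θ' f, isSymmOp_envTerm hME θ (envTerm d ME θ' f)]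

theorem summable_norm_sq_envTerm {ι : Type} {K : 𝓢(Conf N × Conf N, ℂ)} {l : ι → ℝ}
    (hME : ME.IsSymm) (b : HilbertBasis ι ℂ (L2 (Conf N))) (hl : ∀ i, 0 ≤ l i)
    (he : ∀ i, kernelCLM K (b i) = (l i : ℂ) • b i) (θ θ' : Term d N) :
    Summable fun i =>
      ‖(envTerm d ME θ (envTerm d ME θ' (eigenFun K b l i))).toLp 2 volume‖ ^ 2 := by
  have h := summable_norm_sq_eigenFun (A := envTerm d ME θ ∘L envTerm d ME θ') b hl he
    (isLift_envTerm_comp ME θ θ') (fun f => by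
      simpa only [ContinuousLinearMap.comp_apply] using inner_envTerm_envTerm hME θ θ' f)
  simpa only [ContinuousLinearMap.comp_apply] using h

variable (MS ME G) in
theorem purity_of_family {ι : Type} {U : ℝ → L2 (Conf d × Conf N) →L[ℂ] L2 (Conf d × Conf N)}
    {ψ : 𝓢(Conf d, ℂ)} {χ : ι → 𝓢(Conf N, ℂ)} {ρE : L2 (Conf N) →L[ℂ] L2 (Conf N)}
    {ε : Term d N → ℂ} {ε₂ : Term d N → Term d N → ℂ} (hMS : MS.IsSymm) (hME : ME.IsSymm)
    (hU : IsPropagator (hamiltonian MS ME G) U) (hψ : ‖ψ.toLp 2‖ = 1)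
    (hχ : HasSum (fun i => InnerProductSpace.rankOne ℂ ((χ i).toLp 2 volume)
      ((χ i).toLp 2 volume)) ρE)
    (hg : HasSum (fun i => ⟪(χ i).toLp 2 volume, (χ i).toLp 2 volume⟫_ℂ) 1)
    (hε : ∀ θ : Term d N, HasSum (fun i => ⟪(χ i).toLp 2 volume,
      (envTerm d ME θ (χ i)).toLp 2 volume⟫_ℂ) (ε θ))
    (hε₂ : ∀ θ θ' : Term d N, HasSum (fun i => ⟪(χ i).toLp 2 volume,
      (envTerm d ME θ (envTerm d ME θ' (χ i))).toLp 2 volume⟫_ℂ) (ε₂ θ θ'))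
    (hs : ∀ θ θ' : Term d N, Summable fun i =>
      ‖(envTerm d ME θ (envTerm d ME θ' (χ i))).toLp 2 volume‖ ^ 2) :
    (∀ t, IsDensityOperator (reducedState U ψ ρE t)) ∧ ContDiff ℝ 2 (purity U ψ ρE) ∧
      iteratedDeriv 2 (purity U ψ ρE) 0 = -4 * (∑ θ : Term d N, ∑ θ' : Term d N,
        (⟪(sysTerm MS G θ ψ).toLp 2 volume, (sysTerm MS G θ' ψ).toLp 2 volume⟫_ℂ -
          ⟪ψ.toLp 2 volume, (sysTerm MS G θ ψ).toLp 2 volume⟫_ℂ *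
            ⟪ψ.toLp 2 volume, (sysTerm MS G θ' ψ).toLp 2 volume⟫_ℂ) *
        (ε₂ θ θ' - ε θ * ε θ')).re := by
  obtain ⟨hC, hD⟩ := contDiff_purity hU hψ hχ hg hs
  have h := (hasSum_normSqDeriv₂_generator MS G ψ hMS hME hψ hg hε hε₂).tsum_eq
  refine ⟨fun t => ?_, hC, hD.trans h⟩
  exact isDensityOperator_partialTrace (hasSum_norm_sq_evolved hU hψ hg t)
    (hasSum_rankOne_evolved hχ t)

variable (MS ME G) in
/-- The second derivative of the purity in terms of expectation values. -/
theorem purity_of_eigenFun {U : ℝ → L2 (Conf d × Conf N) →L[ℂ] L2 (Conf d × Conf N)}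
    {ψ : 𝓢(Conf d, ℂ)} {K : 𝓢(Conf N × Conf N, ℂ)} (hMS : MS.IsSymm) (hME : ME.IsSymm)
    (hU : IsPropagator (hamiltonian MS ME G) U) (hψ : ‖ψ.toLp 2‖ = 1)
    (hρ : IsDensityOperator (kernelCLM K)) :
    (∀ t, IsDensityOperator (reducedState U ψ (kernelCLM K) t)) ∧
      ContDiff ℝ 2 (purity U ψ (kernelCLM K)) ∧
      iteratedDeriv 2 (purity U ψ (kernelCLM K)) 0 = -4 * (∑ θ : Term d N, ∑ θ' : Term d N,
        (⟪(sysTerm MS G θ ψ).toLp 2 volume, (sysTerm MS G θ' ψ).toLp 2 volume⟫_ℂ -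
          ⟪ψ.toLp 2 volume, (sysTerm MS G θ ψ).toLp 2 volume⟫_ℂ *
            ⟪ψ.toLp 2 volume, (sysTerm MS G θ' ψ).toLp 2 volume⟫_ℂ) *
        ((∫ y, envLift d ME θ (envLift d ME θ' K) (y, y)) -
          (∫ y, envLift d ME θ K (y, y)) * ∫ y, envLift d ME θ' K (y, y))).re := by
  obtain ⟨ι, b, l, hl, he⟩ := exists_eigenbasis hρ.isPositive (hilbertBasis _) hρ.summable
  exact purity_of_family MS ME G hMS hME hU hψ (hasSum_rankOne_eigenFun hρ b hl he)
    (hasSum_inner_self_eigenFun hρ b hl he)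
    (fun θ => hasSum_inner_eigenFun b hl he (isLift_envTerm ME θ))
    (fun θ θ' => hasSum_inner_eigenFun_comp b hl he (isLift_envTerm ME θ) (isLift_envTerm ME θ'))
    (fun θ θ' => summable_norm_sq_envTerm hME b hl he θ θ')

theorem cov_transpose {n : ℕ} (π : Phase n → ℝ) : (cov π).transpose = cov π := by
  ext a b
  simp only [cov, Matrix.transpose_apply, Matrix.of_apply, mul_comm (coord b _)]
  rw [mul_comm (mean π b)]

theorem purity_formula {U : ℝ → L2 (Conf d × Conf N) →L[ℂ] L2 (Conf d × Conf N)}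
    {ψ : 𝓢(Conf d, ℂ)} {ρE : L2 (Conf N) →L[ℂ] L2 (Conf N)} {wE : 𝓢(Phase N, ℝ)}
    (hMS : MS.IsSymm) (hME : ME.IsSymm)
    (hU : IsPropagator (hamiltonian MS ME G) U) (hψ : ‖ψ.toLp 2‖ = 1)
    (hρ : IsDensityOperator ρE) (hw : HasWeylSymbol ρE wE) :
    (∀ t, IsDensityOperator (reducedState U ψ ρE t)) ∧
      ContDiff ℝ 2 (purity U ψ ρE) ∧
      iteratedDeriv 2 (purity U ψ ρE) 0 =
        -4 * (cov (quasiProb (wigner ψ)) * G * cov (quasiProb wE) * G.transpose).trace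
          - (Matrix.J (Fin d) ℝ * G * Matrix.J (Fin N) ℝ * G.transpose).trace := by
  let w : 𝓢(Phase N, ℂ) := SchwartzMap.postcompCLM (𝕜 := ℝ) ofRealCLM wE
  have hwE : ∀ z, w z = wE z := fun z => rfl
  have hK := eq_kernelCLM_weylKernel hw hwE
  set K := weylKernel w with hKdef
  subst hK
  obtain ⟨h1, h2, h3⟩ := purity_of_eigenFun MS ME G hMS hME hU hψ hρ
  refine ⟨h1, h2, h3.trans ?_⟩
  have htr : ∫ y, K (y, y) = 1 := by
    rw [← hρ.trace_eq_one]
    exact (hasSum_inner_kernelCLM (hilbertBasis _) K).tsum_eq.symm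
  have hψ1 : ⟪ψ.toLp 2 volume, ψ.toLp 2 volume⟫_ℂ = 1 := by
    rw [inner_self_eq_norm_sq_to_K, hψ]
    simp
  have hpE : ((∫ z, quasiProb wE z : ℝ) : ℂ) = 1 := by
    rw [← integral_weylKernel_diag_eq hwE, htr]
  have hpS : ((∫ z, quasiProb (wigner ψ) z : ℝ) : ℂ) = 1 := by
    rw [← inner_self_eq_integral_wigner, hψ1]
  rw [← sum_sum_coupling _ _ _ _ G (cov_transpose _) (Matrix.J_transpose _ _)]
  congr 2
  -- For two elementary couplings the operator covariances are `Cov - (i/2) J` on either side,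
  -- because both quasi-probability densities have total mass one.
  have hp : ∀ p q : (Fin d ⊕ Fin d) × (Fin N ⊕ Fin N),
      (⟪(sysTerm MS G (Sum.inr (Sum.inr p)) ψ).toLp 2 volume,
          (sysTerm MS G (Sum.inr (Sum.inr q)) ψ).toLp 2 volume⟫_ℂ -
        ⟪ψ.toLp 2 volume, (sysTerm MS G (Sum.inr (Sum.inr p)) ψ).toLp 2 volume⟫_ℂ *
          ⟪ψ.toLp 2 volume, (sysTerm MS G (Sum.inr (Sum.inr q)) ψ).toLp 2 volume⟫_ℂ) *
      ((∫ y, envLift d ME (Sum.inr (Sum.inr p)) (envLift d ME (Sum.inr (Sum.inr q)) K) (y, y)) -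
        (∫ y, envLift d ME (Sum.inr (Sum.inr p)) K (y, y)) *
          ∫ y, envLift d ME (Sum.inr (Sum.inr q)) K (y, y)) =
      ((G p.1 p.2 : ℂ) * G q.1 q.2 * (cov (quasiProb (wigner ψ)) p.1 q.1 -
        I / 2 * Matrix.J (Fin d) ℝ p.1 q.1)) *
        (cov (quasiProb wE) p.2 q.2 - I / 2 * Matrix.J (Fin N) ℝ p.2 q.2) := fun p q => by
    simp only [sysTerm, envLift, smul_apply, toLp_smul, inner_smul_left, inner_smul_right,
      conj_ofReal, inner_phaseOp, inner_phaseOp_phaseOp, hpS]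
    rw [hKdef, integral_sysOp_sysOp_weylKernel_diag hwE, integral_sysOp_weylKernel_diag hwE,
      integral_sysOp_weylKernel_diag hwE, hpE, cov, cov, Matrix.of_apply, Matrix.of_apply]
    push_cast
    ring
  have hc : ∀ p : (Fin d ⊕ Fin d) × (Fin N ⊕ Fin N),
      ⟪(((G p.1 p.2 : ℂ) • phaseOp p.1) ψ).toLp 2 volume, ψ.toLp 2 volume⟫_ℂ =
        ⟪ψ.toLp 2 volume, (((G p.1 p.2 : ℂ) • phaseOp p.1) ψ).toLp 2 volume⟫_ℂ := fun p =>
    (isSymmOp_sysTerm hMS G (Sum.inr (Sum.inr p)) ψ ψ).symm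
  rw [Fintype.sum_sum_type]
  simp only [Fintype.sum_sum_type (α₁ := Unit) (α₂ := Unit ⊕ _),
    Fintype.sum_sum_type (α₁ := Unit) (α₂ := (Fin d ⊕ Fin d) × (Fin N ⊕ Fin N)), hp,
    Finset.univ_unique, Finset.sum_singleton]
  -- Whenever one of the two terms is a free Hamiltonian, one of its factors is the identity and the
  -- corresponding covariance vanishes. The symmetry `hc` is needed when the identity stands on the
  -- right of a coupling.
  simp only [sysTerm, envLift, ContinuousLinearMap.id_apply, hc, htr, hψ1, one_mul, mul_one, sub_self,
    zero_mul, mul_zero, zero_add, Finset.sum_const_zero, add_zero]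

end PartOne

/-! ### Gaussian symbols -/

theorem hasTemperateGrowth_fderiv_apply {W : Type} [NormedAddCommGroup W] [NormedSpace ℝ W]
    {p : W → ℝ} (hp : p.HasTemperateGrowth) (v : W) :
    (fun z => fderiv ℝ p z v).HasTemperateGrowth := by
  have h : (fderiv ℝ p).HasTemperateGrowth := by
    refine ⟨hp.1.fderiv_right (by simp), fun n => ?_⟩
    obtain ⟨k, C, h⟩ := hp.2 (n + 1)
    exact ⟨k, C, fun x => by rw [norm_iteratedFDeriv_fderiv]; exact h x⟩
  exact (ContinuousLinearMap.apply ℝ ℝ v).hasTemperateGrowth.comp h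

/-- Two estimates are combined: `(1 + r)^m ≤ m! e^(1 + r)`, and `r - c r² ≤ 1 / (4c)` by completing
the square. -/
theorem exists_bound_pow_mul_exp (m : ℕ) {c : ℝ} (hc : 0 < c) :
    ∃ C, 0 ≤ C ∧ ∀ r : ℝ, 0 ≤ r → (1 + r) ^ m * Real.exp (-(c * r ^ 2)) ≤ C := by
  refine ⟨m.factorial * Real.exp (1 + 1 / (4 * c)), by positivity, fun r hr => ?_⟩
  have h1 : (1 + r) ^ m ≤ m.factorial * Real.exp (1 + r) := by
    have := Real.pow_div_factorial_le_exp (1 + r) (by positivity) m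
    rwa [div_le_iff₀ (by positivity), mul_comm] at this
  calc (1 + r) ^ m * Real.exp (-(c * r ^ 2))
      ≤ m.factorial * Real.exp (1 + r) * Real.exp (-(c * r ^ 2)) := by gcongr
    _ = m.factorial * Real.exp (1 + r - c * r ^ 2) := by rw [mul_assoc, ← Real.exp_add]; rfl
    _ ≤ _ := by
      gcongr
      have : 1 / (4 * c) - (r - c * r ^ 2) = c * (r - 1 / (2 * c)) ^ 2 := by
        field_simp
        ring
      nlinarith [mul_nonneg hc.le (sq_nonneg (r - 1 / (2 * c)))]

section Gaussian

variable {n : ℕ}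

/-- The standard basis of phase space. -/
def phaseVec (a : Fin n ⊕ Fin n) : Phase n :=
  Sum.elim (fun j => (EuclideanSpace.single j (1 : ℝ), 0))
    (fun j => (0, EuclideanSpace.single j (1 : ℝ))) a

theorem prodCoord_phaseVec (a b : Fin n ⊕ Fin n) :
    prodCoord a (phaseVec b) = if a = b then 1 else 0 := by
  rcases a with a | a <;> rcases b with b | b <;> simp [prodCoord, phaseVec]

theorem sum_prodCoord_smul_phaseVec (v : Phase n) : ∑ a, prodCoord a v • phaseVec a = v := by
  rw [Fintype.sum_sum_type]
  simp only [prodCoord, phaseVec, Sum.elim_inl, Sum.elim_inr, Prod.smul_mk, smul_zero]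
  refine Prod.ext ?_ ?_
  · simpa [Prod.fst_sum] using sum_coord_smul_single v.1
  · simpa [Prod.snd_sum] using sum_coord_smul_single v.2

/-- The Gaussian `exp (-∑ τ_a u_a²)` on phase space. -/
def phaseGaussian (τ : Fin n ⊕ Fin n → ℝ) (z : Phase n) : ℝ :=
  Real.exp (-∑ a, τ a * prodCoord a z ^ 2)

theorem hasFDerivAt_phaseGaussian (τ : Fin n ⊕ Fin n → ℝ) (z : Phase n) :
    HasFDerivAt (phaseGaussian τ)
      (∑ a, (-2 * τ a * prodCoord a z * phaseGaussian τ z) • prodCoord a) z := by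
  have h1 : ∀ a, HasFDerivAt (fun z : Phase n => τ a * prodCoord a z ^ 2)
      (τ a • ((2 * prodCoord a z) • (prodCoord a : Phase n →L[ℝ] ℝ))) z := fun a => by
    have := ((prodCoord a : Phase n →L[ℝ] ℝ).hasFDerivAt (x := z)).pow 2
    simpa using this.const_mul (τ a)
  have h2 := (HasFDerivAt.fun_sum (u := Finset.univ) fun a _ => h1 a).neg.exp
  refine h2.congr_fderiv ?_
  rw [smul_neg, Finset.smul_sum, ← Finset.sum_neg_distrib]
  refine Finset.sum_congr rfl fun a _ => ?_
  refine ContinuousLinearMap.ext fun v => ?_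
  simp only [neg_apply, smul_apply, smul_eq_mul, phaseGaussian, Pi.neg_apply]
  ring

theorem norm_sq_le_sum_prodCoord (z : Phase n) : ‖z‖ ^ 2 ≤ ∑ a, prodCoord a z ^ 2 := by
  rw [Fintype.sum_sum_type]
  have h1 : ‖z.1‖ ^ 2 = ∑ j, prodCoord (Sum.inl j : Fin n ⊕ Fin n) z ^ 2 := by
    rw [EuclideanSpace.real_norm_sq_eq]
    rfl
  have h2 : ‖z.2‖ ^ 2 = ∑ j, prodCoord (Sum.inr j : Fin n ⊕ Fin n) z ^ 2 := by
    rw [EuclideanSpace.real_norm_sq_eq]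
    rfl
  rw [← h1, ← h2]
  rcases le_total ‖z.1‖ ‖z.2‖ with h | h
  · rw [Prod.norm_def, max_eq_right h]
    nlinarith [sq_nonneg ‖z.1‖]
  · rw [Prod.norm_def, max_eq_left h]
    nlinarith [sq_nonneg ‖z.2‖]

/-- Products of a function `p` of temperate growth with the Gaussian form a family closed under
differentiation: the derivative along coordinate `a` replaces `p` by `∂ₐ p - 2 τₐ uₐ p`. -/
theorem exists_schwartzMap_phaseGaussian {τ : Fin n ⊕ Fin n → ℝ} (hτ : ∀ a, 0 < τ a) :
    ∃ φ : 𝓢(Phase n, ℝ), ∀ z, φ z = phaseGaussian τ z := by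
  have key := exists_schwartzMap_family
    (A := {p : Phase n → ℝ // p.HasTemperateGrowth}) (E := ℝ) (l := prodCoord)
    (f := fun p z => p.1 z * phaseGaussian τ z)
    (D := fun a p => ⟨fun z => fderiv ℝ p.1 z (phaseVec a) + (-2 * τ a) * (prodCoord a z * p.1 z),
      (hasTemperateGrowth_fderiv_apply p.2 _).add
        ((Function.HasTemperateGrowth.const (-2 * τ a)).mul
          ((prodCoord a : Phase n →L[ℝ] ℝ).hasTemperateGrowth.mul p.2))⟩)
    (fun p z => ?_) (fun p k => ?_) ⟨fun _ => 1, Function.HasTemperateGrowth.const 1⟩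
  · obtain ⟨φ, h⟩ := key
    exact ⟨φ, fun z => by rw [h, one_mul]⟩
  · have hp : HasFDerivAt p.1 (fderiv ℝ p.1 z) z :=
      (p.2.1.differentiable (by simp)).differentiableAt.hasFDerivAt
    refine (hp.mul (hasFDerivAt_phaseGaussian τ z)).congr_fderiv
      (ContinuousLinearMap.ext fun v => ?_)
    have hv : fderiv ℝ p.1 z v = ∑ a, prodCoord a v * fderiv ℝ p.1 z (phaseVec a) := by
      conv_lhs => rw [← sum_prodCoord_smul_phaseVec v, map_sum]
      simp only [map_smul, smul_eq_mul]
    simp only [add_apply, smul_apply, sum_apply, smul_eq_mul,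
      ContinuousLinearMap.smulRight_apply, hv, Finset.mul_sum, ← Finset.sum_add_distrib]
    refine Finset.sum_congr rfl fun a _ => ?_
    ring
  · obtain ⟨m, C, hC⟩ := p.2.2 0
    simp only [norm_iteratedFDeriv_zero] at hC
    obtain ⟨c, hc, hcτ⟩ : ∃ c, 0 < c ∧ ∀ a, c ≤ τ a := by
      rcases isEmpty_or_nonempty (Fin n ⊕ Fin n) with h | h
      · exact ⟨1, one_pos, fun a => (h.false a).elim⟩
      · obtain ⟨a, ha⟩ := Finite.exists_min τ
        exact ⟨τ a, hτ a, ha⟩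
    have hg : ∀ z, phaseGaussian τ z ≤ Real.exp (-(c * ‖z‖ ^ 2)) := fun z => by
      refine Real.exp_le_exp.2 (neg_le_neg ?_)
      calc c * ‖z‖ ^ 2 ≤ c * ∑ a, prodCoord a z ^ 2 := by
            gcongr
            exact norm_sq_le_sum_prodCoord z
        _ ≤ _ := by
          rw [Finset.mul_sum]
          refine Finset.sum_le_sum fun a _ => ?_
          gcongr
          exact hcτ a
    obtain ⟨B, hB, h⟩ := exists_bound_pow_mul_exp (k + m) hc
    have hC0 : 0 ≤ C := by
      have := (norm_nonneg _).trans (hC 0)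
      simpa using this
    refine ⟨C * B, fun z => ?_⟩
    have hg0 : 0 ≤ phaseGaussian τ z := (Real.exp_pos _).le
    rw [norm_mul, Real.norm_of_nonneg hg0]
    calc ‖z‖ ^ k * (‖p.1 z‖ * phaseGaussian τ z)
        ≤ (1 + ‖z‖) ^ k * ((C * (1 + ‖z‖) ^ m) * Real.exp (-(c * ‖z‖ ^ 2))) := by
          gcongr
          · linarith
          · exact hC z
          · exact hg z
      _ = C * ((1 + ‖z‖) ^ (k + m) * Real.exp (-(c * ‖z‖ ^ 2))) := by ring
      _ ≤ C * B := by
        gcongr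
        exact h _ (norm_nonneg _)

end Gaussian

/-! ### Moments of thermal states and quantum Brownian motion -/

section Thermal

variable {N : ℕ}

theorem thermalSymbol_eq (τ : Fin N → ℝ) (z : Phase N) :
    thermalSymbol τ z = (∏ j, 2 * τ j) * phaseGaussian (Sum.elim τ τ) z := by
  rw [thermalSymbol, Finset.prod_mul_distrib, ← Real.exp_sum, phaseGaussian, Fintype.sum_sum_type,
    ← Finset.sum_add_distrib, ← Finset.sum_neg_distrib]
  congr 2
  refine Finset.sum_congr rfl fun j _ => ?_
  simp only [Sum.elim_inl, Sum.elim_inr, prodCoord_eq_coord, coord]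
  ring

theorem exists_schwartzMap_thermalSymbol {τ : Fin N → ℝ} (hτ : ∀ j, 0 < τ j) :
    ∃ w : 𝓢(Phase N, ℝ), ∀ z, w z = thermalSymbol τ z := by
  obtain ⟨φ, h⟩ := exists_schwartzMap_phaseGaussian (τ := Sum.elim τ τ) (by
    rintro (j | j) <;> exact hτ j)
  refine ⟨(∏ j, 2 * τ j) • φ, fun z => ?_⟩
  rw [thermalSymbol_eq, smul_apply, h, smul_eq_mul]

/-- The symbol is even and the coordinate is odd. -/
theorem mean_thermalSymbol (τ : Fin N → ℝ) (a : Fin N ⊕ Fin N) :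
    mean (quasiProb (thermalSymbol τ)) a = 0 := by
  have h : mean (quasiProb (thermalSymbol τ)) a = -mean (quasiProb (thermalSymbol τ)) a := by
    have : (volume : Measure (Phase N)).IsNegInvariant :=
      Measure.IsAddHaarMeasure.isNegInvariant_of_regular _
    rw [mean, ← integral_neg, ← integral_neg_eq_self]
    refine integral_congr_ae (Filter.Eventually.of_forall fun z => ?_)
    have h1 : coord a (-z) = -coord a z := by
      rw [← prodCoord_eq_coord, map_neg, prodCoord_eq_coord]
    have h2 : thermalSymbol τ (-z) = thermalSymbol τ z := by
      simp [thermalSymbol]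
    simp only [quasiProb, h1, h2]
    ring
  linarith

/-- Since `∂_b w = -2 τ_b u_b w`, integrating `u_a ∂_b w` by parts expresses the second moments
through the total mass. No Gaussian integral has to be evaluated: the mass is one because the state
has trace one. -/
theorem integral_coord_coord_thermalSymbol {τ : Fin N → ℝ} (hτ : ∀ j, 0 < τ j)
    (a b : Fin N ⊕ Fin N) :
    ∫ z, coord a z * coord b z * quasiProb (thermalSymbol τ) z =
      if a = b then (2 * Sum.elim τ τ b)⁻¹ * ∫ z, quasiProb (thermalSymbol τ) z else 0 := by
  obtain ⟨w₀, hw₀⟩ := exists_schwartzMap_thermalSymbol hτ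
  let w : 𝓢(Phase N, ℂ) := SchwartzMap.postcompCLM (𝕜 := ℝ) ofRealCLM
    ((2 * Real.pi)⁻¹ ^ N • w₀)
  have hw : ∀ z, w z = ((quasiProb (thermalSymbol τ) z : ℝ) : ℂ) := fun z => by
    rw [quasiProb, ← hw₀]
    rfl
  have hb : 0 < Sum.elim τ τ b := by rcases b with j | j <;> exact hτ j
  have hq : (quasiProb (thermalSymbol τ) : Phase N → ℝ) = fun z =>
      ((2 * Real.pi)⁻¹ ^ N * ∏ j, 2 * τ j) * phaseGaussian (Sum.elim τ τ) z := by
    funext z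
    rw [quasiProb, thermalSymbol_eq, mul_assoc]
  have hd : ∀ z, (∂_{phaseVec b} w) z =
      ((-2 * Sum.elim τ τ b * (coord b z * quasiProb (thermalSymbol τ) z) : ℝ) : ℂ) := fun z => by
    have h1 := ((hasFDerivAt_phaseGaussian (Sum.elim τ τ) z).const_mul
      ((2 * Real.pi)⁻¹ ^ N * ∏ j, 2 * τ j))
    rw [← hq] at h1
    have h2 := ofRealCLM.hasFDerivAt.comp z h1
    have h3 : HasFDerivAt w _ z := h2.congr_of_eventuallyEq (Filter.Eventually.of_forall hw)
    rw [SchwartzMap.lineDerivOp_apply_eq_fderiv, h3.fderiv]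
    simp only [ContinuousLinearMap.comp_apply, smul_apply, sum_apply, prodCoord_phaseVec,
      smul_eq_mul, mul_ite, mul_one, mul_zero, Finset.sum_ite_eq', Finset.mem_univ, if_true,
      ofRealCLM_apply, hq]
    simp only [prodCoord_eq_coord]
    push_cast
    ring
  have h := integral_mul_lineDeriv (prodCoord a) (phaseVec b) w
  rw [prodCoord_phaseVec] at h
  simp only [hd, hw, prodCoord_eq_coord, ← ofReal_mul,
    integral_complex_ofReal, ← ofReal_neg] at h
  have h' := ofReal_injective h
  have h'' : ∫ z, coord a z * (-2 * Sum.elim τ τ b * (coord b z * quasiProb (thermalSymbol τ) z)) =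
      -2 * Sum.elim τ τ b * ∫ z, coord a z * coord b z * quasiProb (thermalSymbol τ) z := by
    rw [← integral_const_mul]
    refine integral_congr_ae (Filter.Eventually.of_forall fun z => ?_)
    simp only
    ring
  rw [h''] at h'
  split_ifs at h' ⊢ with hab
  · rw [one_mul] at h'
    field_simp
    linarith
  · have h3 : Sum.elim τ τ b * ∫ z, coord a z * coord b z * quasiProb (thermalSymbol τ) z = 0 := by
      linarith
    exact (mul_eq_zero.1 h3).resolve_left hb.ne'

end Thermal

theorem integral_quasiProb_eq_one {N : ℕ} {ρE : L2 (Conf N) →L[ℂ] L2 (Conf N)}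
    {wE : 𝓢(Phase N, ℝ)} (hρ : IsDensityOperator ρE) (hw : HasWeylSymbol ρE wE) :
    ∫ z, quasiProb wE z = 1 := by
  have hwE : ∀ z, (SchwartzMap.postcompCLM (𝕜 := ℝ) ofRealCLM wE : 𝓢(Phase N, ℂ)) z = wE z :=
    fun z => rfl
  have hK := eq_kernelCLM_weylKernel hw hwE
  rw [hK] at hρ
  have h := integral_weylKernel_diag_eq hwE
  rw [integral_diag_eq_one hρ] at h
  exact_mod_cast h.symm

/-- The Wigner moments equal the expectations of the position operator and of its square, which are
integrals against `|ψ|²`; the commutator term is absent because the diagonal of `J` is zero. -/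
theorem cov_wigner_position (ψ : 𝓢(Conf 1, ℂ)) :
    cov (quasiProb (wigner ψ)) (Sum.inl 0) (Sum.inl 0) = positionVariance ψ := by
  have hx : ∀ x, (phaseOp (Sum.inl 0) ψ) x = ((x 0 : ℝ) : ℂ) * ψ x := fun x => posOp_apply _ _ _
  have hn : ∀ x, ψ x * (starRingEnd ℂ) (ψ x) = ((‖ψ x‖ ^ 2 : ℝ) : ℂ) := fun x => by
    rw [mul_conj, normSq_eq_norm_sq]
  have h1 : mean (quasiProb (wigner ψ)) (Sum.inl 0) = ∫ x : Conf 1, x 0 * ‖ψ x‖ ^ 2 := by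
    have h := inner_phaseOp ψ (Sum.inl 0)
    rw [inner_toLp_toLp] at h
    simp only [hx, mul_assoc, hn, ← ofReal_mul, integral_complex_ofReal] at h
    exact (ofReal_injective h).symm
  have h2 : ∫ z, coord (Sum.inl 0) z * coord (Sum.inl 0) z * quasiProb (wigner ψ) z =
      ∫ x : Conf 1, x 0 ^ 2 * ‖ψ x‖ ^ 2 := by
    have h := inner_phaseOp_phaseOp ψ (Sum.inl 0) (Sum.inl 0)
    have hJ : Matrix.J (Fin 1) ℝ (Sum.inl 0) (Sum.inl 0) = 0 := rfl
    have hm : ∀ x : Conf 1, ((x 0 : ℝ) : ℂ) * ψ x * (starRingEnd ℂ) (((x 0 : ℝ) : ℂ) * ψ x) =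
        ((x 0 ^ 2 * ‖ψ x‖ ^ 2 : ℝ) : ℂ) := fun x => by
      rw [map_mul, conj_ofReal]
      push_cast
      rw [← ofReal_pow ‖ψ x‖, ← hn]
      ring
    rw [inner_toLp_toLp, hJ, ofReal_zero, zero_mul, mul_zero, sub_zero] at h
    simp only [hx, hm, integral_complex_ofReal] at h
    exact (ofReal_injective h).symm
  rw [cov, Matrix.of_apply, h1, h2, positionVariance, sq (∫ x : Conf 1, x 0 * ‖ψ x‖ ^ 2)]

theorem trace_qbmCoupling {N : ℕ} (c : Fin N → ℝ)
    (A : Matrix (Fin 1 ⊕ Fin 1) (Fin 1 ⊕ Fin 1) ℝ) (B : Matrix (Fin N ⊕ Fin N) (Fin N ⊕ Fin N) ℝ) :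
    (A * qbmCoupling c * B * (qbmCoupling c).transpose).trace =
      A (Sum.inl 0) (Sum.inl 0) * ∑ i, ∑ j, c i * c j * B (Sum.inl i) (Sum.inl j) := by
  simp only [Matrix.trace, Matrix.diag, Matrix.mul_apply, Matrix.transpose_apply,
    Fintype.sum_sum_type, qbmCoupling, Matrix.fromBlocks_apply₁₁, Matrix.fromBlocks_apply₁₂,
    Matrix.fromBlocks_apply₂₁, Matrix.fromBlocks_apply₂₂, Matrix.of_apply, Matrix.zero_apply,
    mul_zero, Finset.sum_const_zero, add_zero, zero_mul, Finset.univ_unique, Finset.sum_singleton,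
    Fin.default_eq_zero, Finset.mul_sum, Finset.sum_mul]
  rw [Finset.sum_comm]
  refine Finset.sum_congr rfl fun i _ => Finset.sum_congr rfl fun j _ => ?_
  ring

theorem purity_qbm {N : ℕ} {MS : Matrix (Fin 1 ⊕ Fin 1) (Fin 1 ⊕ Fin 1) ℝ}
    {ME : Matrix (Fin N ⊕ Fin N) (Fin N ⊕ Fin N) ℝ} {c : Fin N → ℝ}
    {U : ℝ → L2 (Conf 1 × Conf N) →L[ℂ] L2 (Conf 1 × Conf N)} {ψ : 𝓢(Conf 1, ℂ)}
    {ρE : L2 (Conf N) →L[ℂ] L2 (Conf N)} (hMS : MS.IsSymm) (hME : ME.IsSymm)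
    (hU : IsPropagator (hamiltonian MS ME (qbmCoupling c)) U) (hψ : ‖ψ.toLp 2‖ = 1)
    (hρ : IsDensityOperator ρE) {τ : Fin N → ℝ} (hτ : ∀ j, 0 < τ j)
    (hw : HasWeylSymbol ρE (thermalSymbol τ)) :
    iteratedDeriv 2 (purity U ψ ρE) 0 = -2 * (∑ j, c j ^ 2 / τ j) * positionVariance ψ := by
  obtain ⟨w, hwτ⟩ := exists_schwartzMap_thermalSymbol hτ
  have hwf : (w : Phase N → ℝ) = thermalSymbol τ := funext hwτ
  rw [← hwf] at hw
  have h1 := integral_quasiProb_eq_one hρ hw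
  have hcov : ∀ i j, cov (quasiProb w) (Sum.inl i) (Sum.inl j) =
      if i = j then (2 * τ j)⁻¹ else 0 := fun i j => by
    rw [hwf] at h1 ⊢
    rw [cov, Matrix.of_apply, integral_coord_coord_thermalSymbol hτ, mean_thermalSymbol, h1]
    simp
  have hJ : Matrix.J (Fin 1) ℝ (Sum.inl 0) (Sum.inl 0) = 0 := rfl
  rw [(purity_formula hMS hME hU hψ hρ hw).2.2, trace_qbmCoupling, trace_qbmCoupling,
    cov_wigner_position, hJ]
  simp only [hcov, mul_ite, mul_zero, Finset.sum_ite_eq, Finset.mem_univ, if_true, zero_mul,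
    sub_zero]
  -- The bath position covariance `1 / (2τ)` turns the universal factor `-4` into `-2`.
  have h2 : ∑ i, c i * c i * (2 * τ i)⁻¹ = 2⁻¹ * ∑ j, c j ^ 2 / τ j := by
    rw [Finset.mul_sum]
    refine Finset.sum_congr rfl fun j _ => ?_
    have := (hτ j).ne'
    field_simp
  rw [h2]
  ring

end OpenQuantum

end

open OpenQuantum

theorem mainTheorem7 :
    (∀ (d N : ℕ)
      (MS : Matrix (Fin d ⊕ Fin d) (Fin d ⊕ Fin d) ℝ)
      (ME : Matrix (Fin N ⊕ Fin N) (Fin N ⊕ Fin N) ℝ)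
      (G : Matrix (Fin d ⊕ Fin d) (Fin N ⊕ Fin N) ℝ)
      (U : ℝ → L2 (Conf d × Conf N) →L[ℂ]
        L2 (Conf d × Conf N))
      (ψ : 𝓢(Conf d, ℂ))
      (ρE : L2 (Conf N) →L[ℂ] L2 (Conf N))
      (wE : 𝓢(Phase N, ℝ)),
      MS.IsSymm → ME.IsSymm →
      IsPropagator (hamiltonian MS ME G) U →
      ‖ψ.toLp 2‖ = 1 →
      IsDensityOperator ρE →
      HasWeylSymbol ρE wE →
      (∀ a, mean (quasiProb wE) a = 0) →
      (∀ t, IsDensityOperator (reducedState U ψ ρE t)) ∧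
      ContDiff ℝ 2 (purity U ψ ρE) ∧
      iteratedDeriv 2 (purity U ψ ρE) 0 =
        -4 * (cov (quasiProb (wigner ψ)) * G *
            cov (quasiProb wE) * G.transpose).trace
          - (Matrix.J (Fin d) ℝ * G * Matrix.J (Fin N) ℝ * G.transpose).trace) ∧
    (∀ (N : ℕ)
      (MS : Matrix (Fin 1 ⊕ Fin 1) (Fin 1 ⊕ Fin 1) ℝ)
      (ME : Matrix (Fin N ⊕ Fin N) (Fin N ⊕ Fin N) ℝ)
      (c : Fin N → ℝ)
      (U : ℝ → L2 (Conf 1 × Conf N) →L[ℂ]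
        L2 (Conf 1 × Conf N))
      (ψ : 𝓢(Conf 1, ℂ))
      (ρE : L2 (Conf N) →L[ℂ] L2 (Conf N)),
      MS.IsSymm → ME.IsSymm →
      IsPropagator
        (hamiltonian MS ME (qbmCoupling c)) U →
      ‖ψ.toLp 2‖ = 1 →
      IsDensityOperator ρE →
      (∀ τ : ℝ, 0 < τ → τ < 1 →
        HasWeylSymbol ρE (thermalSymbol fun _ => τ) →
        iteratedDeriv 2 (purity U ψ ρE) 0 =
          -(2 / τ) * (∑ j, c j ^ 2) * positionVariance ψ) ∧
      (∀ τ : Fin N → ℝ, (∀ j, 0 < τ j ∧ τ j < 1) →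
        HasWeylSymbol ρE (thermalSymbol τ) →
        iteratedDeriv 2 (purity U ψ ρE) 0 =
          -2 * (∑ j, c j ^ 2 / τ j) * positionVariance ψ)) := by
  refine ⟨fun d N MS ME G U ψ ρE wE hMS hME hU hψ hρ hw _ => purity_formula hMS hME hU hψ hρ hw,
    fun N MS ME c U ψ ρE hMS hME hU hψ hρ => ⟨fun τ h0 _ hw => ?_, fun τ hτ hw =>
      purity_qbm hMS hME hU hψ hρ (fun j => (hτ j).1) hw⟩⟩
  rw [purity_qbm hMS hME hU hψ hρ (fun _ => h0) hw, ← Finset.sum_div]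
  ring
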